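/- Let $n\ge 1$, let $c\in\mathbb R$, and let $\bar M^{n+1}(c)$ be the complete simply connected Riemannian manifold of dimension $n+1$ and constant sectional curvature $c$. Let $(M^n,g)$ be a closed (compact, without boundary), connected, orientable Riemannian manifold and $x:M\to\bar M^{n+1}(c)$ a smooth isometric immersion that is biharmonic, i.e. a critical point, under all smooth variations $f_t:M\to\bar M^{n+1}(c)$ of $f_0=x$, of the bienergy $$E_2(f)=\tfrac12\int_M|\tau(f)|^2\,dM,\qquad \tau(f)=\operatorname{tr}(\nabla df).$$ Let $N$ be a smooth unit normal vector field along $x$, let $A$ be the Weingarten operator with respect to $N$ and $H=\frac1n\operatorname{tr}A$ the mean curvature. Let $\psi_c$ be the solution of $y''+cy=0$, $y(0)=0$, $y'(0)=1$, and put $\theta_c=\psi_c'$. Write $d(\cdot,\cdot)$ for the Riemannian distance of $\bar M^{n+1}(c)$. (i) For every base point $x_0\in\bar M^{n+1}(c)$ with $x_0\notin x(M)$, $$\int_M\theta_c\bigl(d(x_0,x(p))\bigr)\,\bigl(H(p)^2-c\bigr)\,dM(p)=0 .$$ (ii) $c>0$; that is, closed biharmonic hypersurfaces do not exist in $\bar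 M^{n+1}(c)$ when $c\le 0$. (iii) Suppose $c>0$, $x(M)$ lies in a closed hemisphere $\{y: d(x_0,y)\le \frac{\pi}{2\sqrt c}\}$, and $c-H^2$ does not change sign on $M$. Then either $x(M)$ is the equator $\{y: d(x_0,y)=\frac{\pi}{2\sqrt c}\}$ of this hemisphere, or $x(M)$ is a small hypersphere $\{y: d(q,y)=\frac{\pi}{4\sqrt c}\}$ for some point $q$ (for $c=1$: a hypersphere $\mathbb S^n(1/\sqrt2)$ of Euclidean radius $1/\sqrt2$). -/

import Mathlib

open Set MeasureTheory Bundle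
open scoped Manifold ContDiff

noncomputable section

namespace BiharmonicHypersurface

/-! ### The complete simply connected space form of dimension `n + 1` and curvature `c` -/

/-- The linear space `ℝⁿ⁺¹ × ℝ` in which the model of the space form lives. -/
abbrev Amb (n : ℕ) : Type := EuclideanSpace ℝ (Fin (n + 1)) × ℝ

/-- The bilinear form `⟨y, y'⟩ + s s' / c` on `ℝⁿ⁺¹ × ℝ`, whose restriction to the tangent spaces is
the Riemannian metric of the space form. It is the Euclidean (`c > 0`) or Lorentzian (`c < 0`)
product after the rescaling `s ↦ s / √|c|`. For `c = 0` the second term is absent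
(`0⁻¹ = 0`) and the form is the Euclidean product of `ℝⁿ⁺¹`. -/
def metric {n : ℕ} (c : ℝ) (v w : Amb n) : ℝ := inner ℝ v.1 w.1 + c⁻¹ * (v.2 * w.2)

/-- The bilinear form `c ⟨y, y'⟩ + s s'`, which is `c` times `metric c` when `c ≠ 0`. -/
def quad {n : ℕ} (c : ℝ) (v w : Amb n) : ℝ := c * inner ℝ v.1 w.1 + v.2 * w.2

/-- The space form `{(y, s) : c |y|² + s² = 1}`, with `s > 0` when `c ≤ 0`.
In the coordinates `(y, s / √|c|)` it is the round sphere of radius `1 / √c` in `ℝⁿ⁺²` if `c > 0`,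
and the upper sheet `|y|² - z² = -1 / |c|` of the hyperboloid in Minkowski space if `c < 0`;
it is the Euclidean space `ℝⁿ⁺¹ × {1}` if `c = 0`. -/
def spaceForm (n : ℕ) (c : ℝ) : Set (Amb n) := {p | quad c p p = 1 ∧ (c ≤ 0 → 0 < p.2)}

/-- The tangent space of the space form at `p` is `{v : quad c p v = 0}`. -/
def IsTangentTo {n : ℕ} (c : ℝ) (p v : Amb n) : Prop := quad c p v = 0

/-- The projection onto the tangent space of the space form at `p`, along the normal line `ℝ p`
if `c ≠ 0`. Applied to ambient derivatives of tangent vector fields it gives the Levi-Civita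
connection. (For `c = 0` such derivatives lie in `ℝⁿ⁺¹ × {0}`, where the projection is the
identity.) -/
def tangentProj {n : ℕ} (c : ℝ) (p w : Amb n) : Amb n := w - quad c p w • p

/-- The Riemannian distance of the space form: the infimum of the lengths of the `C¹` curves in the
space form that join `p` to `q`. -/
def sfDist {n : ℕ} (c : ℝ) (p q : Amb n) : ℝ :=
  sInf {L : ℝ | ∃ γ : ℝ → Amb n, ContDiff ℝ 1 γ ∧ (∀ t ∈ Icc (0 : ℝ) 1, γ t ∈ spaceForm n c) ∧
    γ 0 = p ∧ γ 1 = q ∧ L = ∫ t in (0 : ℝ)..1, √(metric c (deriv γ t) (deriv γ t))}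

/-! ### The functions `ψ_c` and `θ_c` -/

/-- The solution `ψ_c` of `y'' + c y = 0`, `y(0) = 0`, `y'(0) = 1` (see `psi_spec`). -/
def psi (c t : ℝ) : ℝ :=
  if 0 < c then Real.sin (√c * t) / √c
  else if c < 0 then Real.sinh (√(-c) * t) / √(-c)
  else t

/-- `θ_c = ψ_c'`. -/
def theta (c t : ℝ) : ℝ := deriv (psi c) t

theorem psi_spec (c : ℝ) :
    psi c 0 = 0 ∧ theta c 0 = 1 ∧ (∀ t, HasDerivAt (psi c) (theta c t) t) ∧
      ∀ t, HasDerivAt (theta c) (-(c * psi c t)) t := by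
  rcases lt_trichotomy c 0 with hc | rfl | hc
  · have hs : √(-c) ≠ 0 := (Real.sqrt_pos.2 (by linarith)).ne'
    have hsq : √(-c) * √(-c) = -c := Real.mul_self_sqrt (by linarith)
    have hp : psi c = fun t => Real.sinh (√(-c) * t) / √(-c) := by
      funext t; simp [psi, hc, not_lt.2 hc.le]
    have h1 : ∀ t, HasDerivAt (psi c) (Real.cosh (√(-c) * t)) t := fun t => by
      rw [hp]
      have h := ((hasDerivAt_id' t).const_mul (√(-c))).sinh.div_const (√(-c))
      rwa [mul_one, mul_div_cancel_right₀ _ hs] at h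
    have ht : theta c = fun t => Real.cosh (√(-c) * t) := funext fun t => (h1 t).deriv
    refine ⟨by simp [hp], by simp [ht], fun t => by rw [ht]; exact h1 t, fun t => ?_⟩
    rw [ht, hp]
    have h := ((hasDerivAt_id' t).const_mul (√(-c))).cosh
    refine h.congr_deriv ?_
    field_simp
    linear_combination Real.sinh (√(-c) * t) * hsq
  · have hp : psi 0 = fun t => t := by funext t; simp [psi]
    have ht : theta 0 = fun _ => 1 := by funext t; simp [theta, hp]
    refine ⟨by simp [hp], by simp [ht], fun t => ?_, fun t => ?_⟩
    · rw [ht, hp]; exact hasDerivAt_id t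
    · rw [ht]; simpa using hasDerivAt_const t (1 : ℝ)
  · have hs : √c ≠ 0 := (Real.sqrt_pos.2 hc).ne'
    have hsq : √c * √c = c := Real.mul_self_sqrt hc.le
    have hp : psi c = fun t => Real.sin (√c * t) / √c := by
      funext t; simp [psi, hc]
    have h1 : ∀ t, HasDerivAt (psi c) (Real.cos (√c * t)) t := fun t => by
      rw [hp]
      have h := ((hasDerivAt_id' t).const_mul (√c)).sin.div_const (√c)
      rwa [mul_one, mul_div_cancel_right₀ _ hs] at h
    have ht : theta c = fun t => Real.cos (√c * t) := funext fun t => (h1 t).deriv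
    refine ⟨by simp [hp], by simp [ht], fun t => by rw [ht]; exact h1 t, fun t => ?_⟩
    rw [ht, hp]
    have h := ((hasDerivAt_id' t).const_mul (√c)).cos
    refine h.congr_deriv ?_
    field_simp
    linear_combination -Real.sin (√c * t) * hsq

/-! ### Riemannian geometry of `(M, g)` in local coordinates -/

/-- The `i`-th partial derivative of a function on `ℝⁿ`. -/
def pd {n : ℕ} {W : Type*} [NormedAddCommGroup W] [NormedSpace ℝ W] (i : Fin n)
    (f : EuclideanSpace ℝ (Fin n) → W) (u : EuclideanSpace ℝ (Fin n)) : W :=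
  fderiv ℝ f u (EuclideanSpace.single i 1)

/-- Smooth Riemannian metrics on an `n`-manifold `M`. -/
abbrev RMetric (n : ℕ) (M : Type*) [TopologicalSpace M] [ChartedSpace (EuclideanSpace ℝ (Fin n)) M]
    [IsManifold (𝓡 n) ∞ M] :=
  ContMDiffRiemannianMetric (𝓡 n) ∞ (EuclideanSpace ℝ (Fin n)) (fun p : M => TangentSpace (𝓡 n) p)

section Coordinates

variable {n : ℕ} {M : Type*} [TopologicalSpace M] [ChartedSpace (EuclideanSpace ℝ (Fin n)) M]

/-- The expression of a map `f` on `M` in the chart at `q`. -/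
def localRep {W : Type*} (q : M) (f : M → W) : EuclideanSpace ℝ (Fin n) → W :=
  fun u => f ((extChartAt (𝓡 n) q).symm u)

/-- The coordinate vector field `∂ᵢ` of the chart at `q`, at the point with coordinates `u`. -/
def coordVec (q : M) (i : Fin n) (u : EuclideanSpace ℝ (Fin n)) :
    TangentSpace (𝓡 n) ((extChartAt (𝓡 n) q).symm u) :=
  mfderiv 𝓘(ℝ, EuclideanSpace ℝ (Fin n)) (𝓡 n) (extChartAt (𝓡 n) q).symm u
    (EuclideanSpace.single i (1 : ℝ))

variable [IsManifold (𝓡 n) ∞ M]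

/-- The matrix `gᵢⱼ` of the metric in the chart at `q`. -/
def gram (g : RMetric n M) (q : M) (u : EuclideanSpace ℝ (Fin n)) : Matrix (Fin n) (Fin n) ℝ :=
  Matrix.of fun i j =>
    g.inner ((extChartAt (𝓡 n) q).symm u) (coordVec q i u) (coordVec q j u)

/-- The Christoffel symbol `Γᵏᵢⱼ` of the Levi-Civita connection of `g` in the chart at `q`. -/
def christoffel (g : RMetric n M) (q : M) (u : EuclideanSpace ℝ (Fin n)) (i j k : Fin n) : ℝ :=
  2⁻¹ * ∑ l, (gram g q u)⁻¹ k l *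
    (pd i (fun w => gram g q w j l) u + pd j (fun w => gram g q w i l) u
      - pd l (fun w => gram g q w i j) u)

/-- The second fundamental form `(∇df)(∂ᵢ, ∂ⱼ) = ∇̄_{∂ᵢ} (df ∂ⱼ) - df (∇_{∂ᵢ} ∂ⱼ)` of a map `f`
from `(M, g)` into the space form, in the chart at `q`. -/
def hessMap (c : ℝ) (g : RMetric n M) (f : M → Amb n) (q : M) (u : EuclideanSpace ℝ (Fin n))
    (i j : Fin n) : Amb n :=
  tangentProj c (localRep q f u) (pd i (pd j (localRep q f)) u)
    - ∑ k, christoffel g q u i j k • pd k (localRep q f) u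

/-- The tension field `τ(f) = tr (∇df)`. -/
def tension (c : ℝ) (g : RMetric n M) (f : M → Amb n) (p : M) : Amb n :=
  ∑ i, ∑ j, (gram g p (extChartAt (𝓡 n) p p))⁻¹ i j • hessMap c g f p (extChartAt (𝓡 n) p p) i j

/-- The Riemannian measure of `(M, g)`. The measure `√(det gᵢⱼ) du` of a chart, transported to
`M`, is the Riemannian measure restricted to the domain of that chart; the Riemannian measure is
the supremum (in the lattice of measures) of these. -/
def riemVol [MeasurableSpace M] (g : RMetric n M) : Measure M :=
  ⨆ q : M, Measure.map (extChartAt (𝓡 n) q).symm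
    ((volume.restrict (extChartAt (𝓡 n) q).target).withDensity
      fun u => ENNReal.ofReal √(gram g q u).det)

/-- The bienergy `E₂(f) = ½ ∫_M |τ(f)|² dM`. -/
def bienergy [MeasurableSpace M] (c : ℝ) (g : RMetric n M) (f : M → Amb n) : ℝ :=
  2⁻¹ * ∫ p, metric c (tension c g f p) (tension c g f p) ∂(riemVol g)

/-- `F` is a smooth variation, through maps into the space form, of the map `f`. -/
structure IsVariation (c : ℝ) (f : M → Amb n) (F : ℝ → M → Amb n) : Prop where
  smooth : ContMDiff (𝓘(ℝ, ℝ).prod (𝓡 n)) 𝓘(ℝ, Amb n) ∞ (fun z : ℝ × M => F z.1 z.2)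
  mem : ∀ t p, F t p ∈ spaceForm n c
  zero : F 0 = f

/-- A smooth map from a closed Riemannian manifold `(M, g)` into the space form is biharmonic if it
is a critical point of the bienergy. (Every variation is compactly supported, as `M` is compact.) -/
structure IsBiharmonic [CompactSpace M] [MeasurableSpace M] (c : ℝ) (g : RMetric n M)
    (f : M → Amb n) : Prop where
  smooth : ContMDiff (𝓡 n) 𝓘(ℝ, Amb n) ∞ f
  mem : ∀ p, f p ∈ spaceForm n c
  critical : ∀ F : ℝ → M → Amb n, IsVariation c f F →
    HasDerivAt (fun t => bienergy c g (F t)) 0 0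

/-! ### Hypersurfaces -/

/-- `x` is a smooth isometric immersion of `(M, g)` into the space form. -/
structure IsIsometricImmersion (c : ℝ) (g : RMetric n M) (x : M → Amb n) : Prop where
  smooth : ContMDiff (𝓡 n) 𝓘(ℝ, Amb n) ∞ x
  mem : ∀ p, x p ∈ spaceForm n c
  isometric : ∀ (p : M) (v w : TangentSpace (𝓡 n) p),
    metric c (mfderiv (𝓡 n) 𝓘(ℝ, Amb n) x p v) (mfderiv (𝓡 n) 𝓘(ℝ, Amb n) x p w) = g.inner p v w

/-- `N` is a smooth unit normal vector field along `x`. -/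
structure IsUnitNormal (c : ℝ) (x N : M → Amb n) : Prop where
  smooth : ContMDiff (𝓡 n) 𝓘(ℝ, Amb n) ∞ N
  tangent : ∀ p, IsTangentTo c (x p) (N p)
  unit : ∀ p, metric c (N p) (N p) = 1
  normal : ∀ (p : M) (v : TangentSpace (𝓡 n) p),
    metric c (N p) (mfderiv (𝓡 n) 𝓘(ℝ, Amb n) x p v) = 0

/-- `⟨A ∂ᵢ, ∂ⱼ⟩ = ⟨-∇̄_{∂ᵢ} N, dx ∂ⱼ⟩` at `p`, in the chart at `p`, where `A` is the Weingarten
operator of `x` with respect to `N`. -/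
def weingartenForm (c : ℝ) (x N : M → Amb n) (p : M) (i j : Fin n) : ℝ :=
  metric c (-tangentProj c (x p) (pd i (localRep p N) (extChartAt (𝓡 n) p p)))
    (pd j (localRep p x) (extChartAt (𝓡 n) p p))

/-- The mean curvature function `H = (1/n) tr A`. -/
def meanCurv (c : ℝ) (g : RMetric n M) (x N : M → Amb n) (p : M) : ℝ :=
  (n : ℝ)⁻¹ * ∑ i, ∑ j, (gram g p (extChartAt (𝓡 n) p p))⁻¹ i j * weingartenForm c x N p i j

end Coordinates

end BiharmonicHypersurface

end

open BiharmonicHypersurface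

/-! The Euler–Lagrange equation of the bienergy is never derived. It is enough to test criticality
on variations obtained by projecting `x + t Z` radially back to the quadric, for two choices of `Z :
M → Amb n`. The tension field of such a projection is explicit, and `τ(x) = nH N`, so
`first_variation` reads `∫ (-quad(x, Z) (nH)² + nH (⟨N, ΔZ⟩ + nc ⟨N, Z⟩)) = 0`. The other basic
identity is `Δx = nH N - nc x` for the componentwise Laplacian in the linear model
(`lap_immersion`).

Constant `Z = a` (the tangential part of `a` is a closed conformal field of the space form). Then
`ΔZ = 0`, and `Δ⟨a, x⟩ = nH ⟨a, N⟩ - nc ⟨a, x⟩` integrates to zero, which eliminates `⟨a, N⟩` and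
leaves `∫ quad(a, x) (H² - c) = 0` for every vector `a` (`integral_quadL_mul`). For a point `x₀` of
the sphere `θ_c(d(x₀, y)) = quad(x₀, y)`, which gives (i) once `c > 0` is known.

Nonexistence. If `c ≤ 0`, take `a = (0, 1)`: the integrand is nonnegative with a positive first
factor, so `H² = c`, hence `c = 0` and `H = 0`. But then `Δ|x|² = 2n` has integral zero, which is
absurd (`curvature_pos`).

Rigidity. In a hemisphere with `c - H²` of one sign, `quad(x₀, x) (H² - c)` vanishes identically.
Where `quad(x₀, x)` vanishes on an open set, the image lies in a totally geodesic equator and `H =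
0`; elsewhere `H² = c` by closure. Connectedness leaves two cases: the image lies in the equator, or
`H² = c` throughout. In the second case `H` is a constant `H₀ ≠ 0`, and `Z = N` gives `∫ (|dN|² -
nc) = 0`. The integrand is `|d(N + H₀ x)|²`, so `N + H₀ x` is constant, and its normalization is a
pole at distance `π / (4√c)` from all of `x(M)` (`exists_pole_of_meanCurv_sq_eq`). Finally an
immersed closed hypersurface contained in a sphere fills it, by a critical point argument with the
functions `quad(y, x)` (`range_eq_sphere`).

The two forms `metric` and `quad` are proportional for `c ≠ 0`. For `c = 0` they see complementary
coordinates, and the arguments common to all signs of `c` use each where it is nondegenerate. -/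

noncomputable section

namespace BiharmonicHypersurface

set_option linter.unusedSectionVars false

/-! ### The bilinear forms of the model -/

/-- `metric c` as a continuous bilinear map. -/
def metricL (n : ℕ) (c : ℝ) : Amb n →L[ℝ] Amb n →L[ℝ] ℝ :=
  (innerSL ℝ).bilinearComp (ContinuousLinearMap.fst ℝ _ ℝ) (ContinuousLinearMap.fst ℝ _ ℝ)
    + c⁻¹ • (ContinuousLinearMap.mul ℝ ℝ).bilinearComp (ContinuousLinearMap.snd ℝ _ ℝ)
      (ContinuousLinearMap.snd ℝ _ ℝ)

/-- `quad c` as a continuous bilinear map. -/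
def quadL (n : ℕ) (c : ℝ) : Amb n →L[ℝ] Amb n →L[ℝ] ℝ :=
  c • (innerSL ℝ).bilinearComp (ContinuousLinearMap.fst ℝ _ ℝ) (ContinuousLinearMap.fst ℝ _ ℝ)
    + (ContinuousLinearMap.mul ℝ ℝ).bilinearComp (ContinuousLinearMap.snd ℝ _ ℝ)
      (ContinuousLinearMap.snd ℝ _ ℝ)

theorem metric_eq_metricL {n : ℕ} (c : ℝ) (v w : Amb n) : metric c v w = metricL n c v w := by
  simp [metric, metricL]

theorem quad_eq_quadL {n : ℕ} (c : ℝ) (v w : Amb n) : quad c v w = quadL n c v w := by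
  simp [quad, quadL]

theorem metricL_comm {n : ℕ} (c : ℝ) (v w : Amb n) : metricL n c v w = metricL n c w v := by
  simp only [← metric_eq_metricL, metric, real_inner_comm, mul_comm]

theorem quadL_comm {n : ℕ} (c : ℝ) (v w : Amb n) : quadL n c v w = quadL n c w v := by
  simp only [← quad_eq_quadL, quad, real_inner_comm, mul_comm]

theorem quadL_eq_mul_metricL {n : ℕ} {c : ℝ} (hc : c ≠ 0) (v w : Amb n) :
    quadL n c v w = c * metricL n c v w := by
  simp only [← quad_eq_quadL, ← metric_eq_metricL, quad, metric]
  field_simp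

/-! ### Calculus of partial derivatives -/

section PartialDerivatives

variable {n : ℕ} {W W₁ W₂ W₃ : Type*} [NormedAddCommGroup W] [NormedSpace ℝ W]
  [NormedAddCommGroup W₁] [NormedSpace ℝ W₁] [NormedAddCommGroup W₂] [NormedSpace ℝ W₂]
  [NormedAddCommGroup W₃] [NormedSpace ℝ W₃]
  {u : EuclideanSpace ℝ (Fin n)}

theorem pd_congr {f h : EuclideanSpace ℝ (Fin n) → W} (i : Fin n) (hfh : f =ᶠ[nhds u] h) :
    pd i f u = pd i h u := by
  simp only [pd, hfh.fderiv_eq]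

theorem pd_eventually_congr {f h : EuclideanSpace ℝ (Fin n) → W} (i : Fin n)
    (hfh : f =ᶠ[nhds u] h) : pd i f =ᶠ[nhds u] pd i h :=
  hfh.eventuallyEq_nhds.mono fun _ hv => pd_congr i hv

theorem pd_const (i : Fin n) (w : W) : pd i (fun _ => w) u = 0 := by
  simp [pd]

theorem pd_add {f h : EuclideanSpace ℝ (Fin n) → W} (i : Fin n) (hf : DifferentiableAt ℝ f u)
    (hh : DifferentiableAt ℝ h u) : pd i (fun v => f v + h v) u = pd i f u + pd i h u := by
  simp [pd, fderiv_fun_add hf hh]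

theorem pd_sum {ι : Type*} (s : Finset ι) {f : ι → EuclideanSpace ℝ (Fin n) → W} (i : Fin n)
    (hf : ∀ k ∈ s, DifferentiableAt ℝ (f k) u) :
    pd i (fun v => ∑ k ∈ s, f k v) u = ∑ k ∈ s, pd i (f k) u := by
  simp [pd, fderiv_fun_sum hf]

theorem pd_bilin (B : W₁ →L[ℝ] W₂ →L[ℝ] W₃) {f : EuclideanSpace ℝ (Fin n) → W₁}
    {h : EuclideanSpace ℝ (Fin n) → W₂} (i : Fin n) (hf : DifferentiableAt ℝ f u)
    (hh : DifferentiableAt ℝ h u) :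
    pd i (fun v => B (f v) (h v)) u = B (pd i f u) (h u) + B (f u) (pd i h u) := by
  have := (B.hasFDerivAt_of_bilinear hf.hasFDerivAt hh.hasFDerivAt).fderiv
  simp [pd, this, add_comm]

theorem pd_smul {f : EuclideanSpace ℝ (Fin n) → ℝ}
    {h : EuclideanSpace ℝ (Fin n) → W} (i : Fin n) (hf : DifferentiableAt ℝ f u)
    (hh : DifferentiableAt ℝ h u) :
    pd i (fun v => f v • h v) u = pd i f u • h u + f u • pd i h u :=
  pd_bilin (ContinuousLinearMap.lsmul ℝ ℝ) i hf hh

theorem pd_clm (L : W₁ →L[ℝ] W₂) {f : EuclideanSpace ℝ (Fin n) → W₁} (i : Fin n)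
    (hf : DifferentiableAt ℝ f u) : pd i (fun v => L (f v)) u = L (pd i f u) := by
  have := (L.hasFDerivAt.comp u hf.hasFDerivAt).fderiv
  simp only [Function.comp_def] at this
  simp [pd, this]

theorem contDiffAt_pd {f : EuclideanSpace ℝ (Fin n) → W} (hf : ContDiffAt ℝ ∞ f u) (i : Fin n) :
    ContDiffAt ℝ ∞ (pd i f) u :=
  (hf.fderiv_right (m := ∞) (by simp)).clm_apply contDiffAt_const

theorem pd_comm {f : EuclideanSpace ℝ (Fin n) → W} (hf : ContDiffAt ℝ ∞ f u) (i j : Fin n) :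
    pd i (pd j f) u = pd j (pd i f) u := by
  have hd : DifferentiableAt ℝ (fderiv ℝ f) u :=
    (hf.fderiv_right (m := ∞) (by simp)).differentiableAt (by simp)
  have key : ∀ i j : Fin n, pd i (pd j f) u =
      fderiv ℝ (fderiv ℝ f) u (EuclideanSpace.single i 1) (EuclideanSpace.single j 1) := by
    intro i j
    have : pd j f = fun v => ContinuousLinearMap.apply ℝ W (EuclideanSpace.single j (1 : ℝ))
        (fderiv ℝ f v) := rfl
    rw [this, pd_clm _ _ hd]
    rfl
  rw [key, key]
  exact (hf.isSymmSndFDerivAt (by simpa using WithTop.coe_le_coe.2 (le_top : (2 : ℕ∞) ≤ ⊤))).eq _ _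

theorem fderiv_apply_eq_sum_pd {f : EuclideanSpace ℝ (Fin n) → W} (v : EuclideanSpace ℝ (Fin n)) :
    fderiv ℝ f u v = ∑ a, v a • pd a f u := by
  conv_lhs => rw [← (EuclideanSpace.basisFun (Fin n) ℝ).sum_repr v]
  simp [pd]

theorem pd_comp {T : EuclideanSpace ℝ (Fin n) → EuclideanSpace ℝ (Fin n)}
    {f : EuclideanSpace ℝ (Fin n) → W} (i : Fin n) (hf : DifferentiableAt ℝ f (T u))
    (hT : DifferentiableAt ℝ T u) :
    pd i (fun v => f (T v)) u = ∑ a, (pd i T u) a • pd a f (T u) := by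
  rw [← fderiv_apply_eq_sum_pd]
  have := (hf.hasFDerivAt.comp u hT.hasFDerivAt).fderiv
  simp only [Function.comp_def] at this
  simp [pd, this]

end PartialDerivatives

/-! ### Maps and coordinate fields in charts -/

section Charts

variable {n : ℕ} {M : Type*} [TopologicalSpace M] [ChartedSpace (EuclideanSpace ℝ (Fin n)) M]
  {W : Type*} [NormedAddCommGroup W] [NormedSpace ℝ W]
  {q q' : M} {u : EuclideanSpace ℝ (Fin n)}

theorem target_mem_nhds (hu : u ∈ (extChartAt (𝓡 n) q).target) :
    (extChartAt (𝓡 n) q).target ∈ nhds u :=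
  (isOpen_extChartAt_target q).mem_nhds hu

variable [IsManifold (𝓡 n) ∞ M]

theorem contDiffAt_localRep {f : M → W} (hf : ContMDiff (𝓡 n) 𝓘(ℝ, W) ∞ f)
    (hu : u ∈ (extChartAt (𝓡 n) q).target) : ContDiffAt ℝ ∞ (localRep q f) u := by
  have h := (hf.comp_contMDiffOn (contMDiffOn_extChartAt_symm (I := 𝓡 n) (n := ∞) q))
  exact (contMDiffOn_iff_contDiffOn.1 h).contDiffAt (target_mem_nhds hu)

theorem differentiableAt_localRep {f : M → W} (hf : ContMDiff (𝓡 n) 𝓘(ℝ, W) ∞ f)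
    (hu : u ∈ (extChartAt (𝓡 n) q).target) : DifferentiableAt ℝ (localRep q f) u :=
  (contDiffAt_localRep hf hu).differentiableAt (by simp)

theorem mdifferentiableAt_symm (hu : u ∈ (extChartAt (𝓡 n) q).target) :
    MDifferentiableAt 𝓘(ℝ, EuclideanSpace ℝ (Fin n)) (𝓡 n) (extChartAt (𝓡 n) q).symm u :=
  ((contMDiffOn_extChartAt_symm (I := 𝓡 n) (n := ∞) q).contMDiffAt
    (target_mem_nhds hu)).mdifferentiableAt (by simp)

theorem pd_localRep {f : M → W} (hf : ContMDiff (𝓡 n) 𝓘(ℝ, W) ∞ f)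
    (hu : u ∈ (extChartAt (𝓡 n) q).target) (i : Fin n) :
    pd i (localRep q f) u
      = mfderiv (𝓡 n) 𝓘(ℝ, W) f ((extChartAt (𝓡 n) q).symm u) (coordVec q i u) := by
  have h := mfderiv_comp u ((hf _).mdifferentiableAt (by simp)) (mdifferentiableAt_symm hu)
  simp only [pd, coordVec]
  rw [← mfderiv_eq_fderiv]
  exact congrArg (fun L => L (EuclideanSpace.single i (1 : ℝ))) h

/-- The differential of the inverse chart has the differential of the chart as a left inverse, hence
is injective. This is what makes the Gram matrix positive definite. -/
theorem sum_smul_coordVec_eq_zero (hu : u ∈ (extChartAt (𝓡 n) q).target) {a : Fin n → ℝ}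
    (h : ∑ i, a i • coordVec q i u = 0) : a = 0 := by
  have h1 : mfderiv 𝓘(ℝ, EuclideanSpace ℝ (Fin n)) (𝓡 n) (extChartAt (𝓡 n) q).symm u
      (WithLp.toLp 2 a) = 0 := by
    rw [← h]
    have : (WithLp.toLp 2 a : EuclideanSpace ℝ (Fin n))
        = ∑ i, a i • EuclideanSpace.single i (1 : ℝ) := by
      simpa using ((EuclideanSpace.basisFun (Fin n) ℝ).sum_repr (WithLp.toLp 2 a)).symm
    rw [this]
    simp only [coordVec]
    erw [map_sum]
    refine Finset.sum_congr rfl fun i _ => ?_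
    erw [map_smul]
  have hinv : (fun v => extChartAt (𝓡 n) q ((extChartAt (𝓡 n) q).symm v)) =ᶠ[nhds u] id := by
    filter_upwards [target_mem_nhds hu] with v hv
    exact (extChartAt (𝓡 n) q).right_inv hv
  have hs : (extChartAt (𝓡 n) q).symm u ∈ (chartAt (EuclideanSpace ℝ (Fin n)) q).source := by
    rw [← extChartAt_source (𝓡 n)]; exact (extChartAt (𝓡 n) q).map_target hu
  have h2 := mfderiv_comp u (mdifferentiableAt_extChartAt (I := 𝓡 n) hs)
    (mdifferentiableAt_symm hu)
  have h3 : mfderiv 𝓘(ℝ, EuclideanSpace ℝ (Fin n)) 𝓘(ℝ, EuclideanSpace ℝ (Fin n))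
      (extChartAt (𝓡 n) q ∘ (extChartAt (𝓡 n) q).symm) u = ContinuousLinearMap.id ℝ _ := by
    rw [mfderiv_eq_fderiv]
    exact (hinv.fderiv_eq).trans fderiv_id
  rw [h3] at h2
  have h4 : (WithLp.toLp 2 a : EuclideanSpace ℝ (Fin n)) = 0 :=
    (congrArg (fun L => L (WithLp.toLp 2 a)) h2).trans
      ((congrArg (mfderiv (𝓡 n) 𝓘(ℝ, EuclideanSpace ℝ (Fin n)) (extChartAt (𝓡 n) q)
        ((extChartAt (𝓡 n) q).symm u)) h1).trans (map_zero _))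
  funext i
  exact congrArg (fun v : EuclideanSpace ℝ (Fin n) => v i) h4

end Charts

/-! ### The Gram matrix, changes of chart, and traces of bilinear forms -/

section Operators

variable {n : ℕ} {M : Type*} [TopologicalSpace M] [ChartedSpace (EuclideanSpace ℝ (Fin n)) M]
  [IsManifold (𝓡 n) ∞ M]
  {W W₁ W₂ W₃ : Type*} [NormedAddCommGroup W] [NormedSpace ℝ W]
  [NormedAddCommGroup W₁] [NormedSpace ℝ W₁] [NormedAddCommGroup W₂] [NormedSpace ℝ W₂]
  [NormedAddCommGroup W₃] [NormedSpace ℝ W₃]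

/-- The `g`-trace `∑ gⁱʲ B(∂ᵢ f, ∂ⱼ h)` in the chart at `q`, at the point with coordinates `u`. -/
def traceIn (g : RMetric n M) (B : W₁ →L[ℝ] W₂ →L[ℝ] W₃) (f : M → W₁) (h : M → W₂) (q : M)
    (u : EuclideanSpace ℝ (Fin n)) : W₃ :=
  ∑ i, ∑ j, (gram g q u)⁻¹ i j • B (pd i (localRep q f) u) (pd j (localRep q h) u)

/-- The `g`-trace of the bilinear form `B(df, dh)`. -/
def traceForm (g : RMetric n M) (B : W₁ →L[ℝ] W₂ →L[ℝ] W₃) (f : M → W₁) (h : M → W₂) (p : M) : W₃ :=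
  traceIn g B f h p (extChartAt (𝓡 n) p p)

/-- The Laplacian of a vector-valued function in the chart at `q`. -/
def lapIn (g : RMetric n M) (f : M → W) (q : M) (u : EuclideanSpace ℝ (Fin n)) : W :=
  ∑ i, ∑ j, (gram g q u)⁻¹ i j • (pd i (pd j (localRep q f)) u
    - ∑ k, christoffel g q u i j k • pd k (localRep q f) u)

/-- The Laplacian of a vector-valued function on `(M, g)`. -/
def lap (g : RMetric n M) (f : M → W) (p : M) : W :=
  lapIn g f p (extChartAt (𝓡 n) p p)

variable {c : ℝ} {g : RMetric n M} {x : M → Amb n} {q q' p : M} {u : EuclideanSpace ℝ (Fin n)}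

/-- Since `g` is induced by `x`, smoothness and derivatives of its coefficients can be read off from
`x` from here on. -/
theorem gram_eq (hx : IsIsometricImmersion c g x) (hu : u ∈ (extChartAt (𝓡 n) q).target)
    (i j : Fin n) : gram g q u i j
      = metricL n c (pd i (localRep q x) u) (pd j (localRep q x) u) := by
  rw [← metric_eq_metricL, pd_localRep hx.smooth hu, pd_localRep hx.smooth hu]
  exact (hx.isometric _ _ _).symm

theorem gram_eventuallyEq (hx : IsIsometricImmersion c g x)
    (hu : u ∈ (extChartAt (𝓡 n) q).target) (i j : Fin n) :
    (fun v => gram g q v i j) =ᶠ[nhds u]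
      fun v => metricL n c (pd i (localRep q x) v) (pd j (localRep q x) v) := by
  filter_upwards [target_mem_nhds hu] with v hv using gram_eq hx hv i j

theorem contDiffAt_bilin (B : W₁ →L[ℝ] W₂ →L[ℝ] W₃) {f : EuclideanSpace ℝ (Fin n) → W₁}
    {h : EuclideanSpace ℝ (Fin n) → W₂} (hf : ContDiffAt ℝ ∞ f u) (hh : ContDiffAt ℝ ∞ h u) :
    ContDiffAt ℝ ∞ (fun v => B (f v) (h v)) u :=
  (B.contDiff.contDiffAt.comp u hf).clm_apply hh

theorem contDiffAt_gram (hx : IsIsometricImmersion c g x)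
    (hu : u ∈ (extChartAt (𝓡 n) q).target) (i j : Fin n) :
    ContDiffAt ℝ ∞ (fun v => gram g q v i j) u :=
  (contDiffAt_bilin _ (contDiffAt_pd (contDiffAt_localRep hx.smooth hu) i)
    (contDiffAt_pd (contDiffAt_localRep hx.smooth hu) j)).congr_of_eventuallyEq
      (gram_eventuallyEq hx hu i j)

theorem gram_posDef (g : RMetric n M) (hu : u ∈ (extChartAt (𝓡 n) q).target) :
    (gram g q u).PosDef := by
  refine Matrix.PosDef.of_dotProduct_mulVec_pos ?_ fun a ha => ?_
  · ext i j
    simp only [Matrix.conjTranspose_apply, gram, Matrix.of_apply, star_trivial]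
    exact g.symm _ _ _
  · have hne : ∑ i, a i • coordVec q i u ≠ 0 := fun h => ha (sum_smul_coordVec_eq_zero hu h)
    have := g.pos _ _ hne
    refine this.trans_eq ?_
    simp only [map_sum, map_smul, _root_.sum_apply, _root_.smul_apply,
      dotProduct, Matrix.mulVec, gram, Matrix.of_apply, star_trivial, Finset.mul_sum, smul_eq_mul]
    rw [Finset.sum_comm]
    refine Finset.sum_congr rfl fun i _ => Finset.sum_congr rfl fun j _ => ?_
    ring

theorem gram_symm (g : RMetric n M) (i j : Fin n) : gram g q u i j = gram g q u j i := by
  simp only [gram, Matrix.of_apply]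
  exact g.symm _ _ _

theorem gram_inv_symm (g : RMetric n M) (i j : Fin n) :
    (gram g q u)⁻¹ i j = (gram g q u)⁻¹ j i := by
  have h : (gram g q u).transpose = gram g q u := by
    ext i j; exact gram_symm g j i
  have := Matrix.transpose_nonsing_inv (gram g q u)
  rw [h] at this
  exact congrFun (congrFun this j) i

theorem gram_det_pos (g : RMetric n M) (hu : u ∈ (extChartAt (𝓡 n) q).target) :
    0 < (gram g q u).det := (gram_posDef g hu).det_pos

theorem gram_mul_inv (g : RMetric n M) (hu : u ∈ (extChartAt (𝓡 n) q).target) :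
    gram g q u * (gram g q u)⁻¹ = 1 :=
  Matrix.mul_nonsing_inv _ (gram_det_pos g hu).ne'.isUnit

theorem gram_inv_mul (g : RMetric n M) (hu : u ∈ (extChartAt (𝓡 n) q).target) :
    (gram g q u)⁻¹ * gram g q u = 1 :=
  Matrix.nonsing_inv_mul _ (gram_det_pos g hu).ne'.isUnit

theorem contDiffAt_gram_det (hx : IsIsometricImmersion c g x)
    (hu : u ∈ (extChartAt (𝓡 n) q).target) : ContDiffAt ℝ ∞ (fun v => (gram g q v).det) u := by
  simp only [Matrix.det_apply]
  refine ContDiffAt.sum fun σ _ => ?_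
  refine ContDiffAt.const_smul _ ?_
  exact contDiffAt_prod fun i _ => contDiffAt_gram hx hu _ _

theorem contDiffAt_gram_inv (hx : IsIsometricImmersion c g x)
    (hu : u ∈ (extChartAt (𝓡 n) q).target) (i j : Fin n) :
    ContDiffAt ℝ ∞ (fun v => (gram g q v)⁻¹ i j) u := by
  have h : ∀ v, (gram g q v)⁻¹ i j = (gram g q v).det⁻¹ * (gram g q v).adjugate i j := by
    intro v; rw [Matrix.inv_def]; simp
  simp only [h]
  refine ((contDiffAt_gram_det hx hu).inv (gram_det_pos g hu).ne').mul ?_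
  simp only [Matrix.adjugate_apply, Matrix.det_apply]
  refine ContDiffAt.sum fun σ _ => ?_
  refine ContDiffAt.const_smul _ ?_
  refine contDiffAt_prod fun k _ => ?_
  by_cases hk : σ k = j
  · simp only [Matrix.updateRow_apply, hk, if_true]
    exact contDiffAt_const
  · simp only [Matrix.updateRow_apply, hk, if_false]
    exact contDiffAt_gram hx hu _ _

/-- The matrix of partial derivatives of the change of coordinates from the chart at `q` to the
chart at `q'`. -/
def transMatrix (q q' : M) (u : EuclideanSpace ℝ (Fin n)) : Matrix (Fin n) (Fin n) ℝ :=
  Matrix.of fun i a =>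
    (pd i (fun v => extChartAt (𝓡 n) q' ((extChartAt (𝓡 n) q).symm v)) u) a

theorem contDiffAt_transition (hu : u ∈ (extChartAt (𝓡 n) q).target)
    (hu' : (extChartAt (𝓡 n) q).symm u ∈ (extChartAt (𝓡 n) q').source) :
    ContDiffAt ℝ ∞ (fun v => extChartAt (𝓡 n) q' ((extChartAt (𝓡 n) q).symm v)) u := by
  have h1 : ContMDiffAt (𝓡 n) 𝓘(ℝ, EuclideanSpace ℝ (Fin n)) ∞ (extChartAt (𝓡 n) q')
      ((extChartAt (𝓡 n) q).symm u) :=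
    contMDiffAt_extChartAt' (by rwa [← extChartAt_source (𝓡 n)])
  have h2 := (contMDiffOn_extChartAt_symm (I := 𝓡 n) (n := ∞) q).contMDiffAt
    (target_mem_nhds hu)
  exact contMDiffAt_iff_contDiffAt.1 (h1.comp u h2)

theorem localRep_eventuallyEq_transition (f : M → W) (hu : u ∈ (extChartAt (𝓡 n) q).target)
    (hu' : (extChartAt (𝓡 n) q).symm u ∈ (extChartAt (𝓡 n) q').source) :
    localRep q f =ᶠ[nhds u]
      fun v => localRep q' f (extChartAt (𝓡 n) q' ((extChartAt (𝓡 n) q).symm v)) := by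
  have h2 : ContinuousAt (extChartAt (𝓡 n) q).symm u :=
    (continuousOn_extChartAt_symm q).continuousAt (target_mem_nhds hu)
  filter_upwards [h2.preimage_mem_nhds ((isOpen_extChartAt_source q').mem_nhds hu')] with v hv
  simp only [localRep]
  rw [(extChartAt (𝓡 n) q').left_inv hv]

theorem pd_localRep_transition {f : M → W} (hf : ContMDiff (𝓡 n) 𝓘(ℝ, W) ∞ f)
    (hu : u ∈ (extChartAt (𝓡 n) q).target)
    (hu' : (extChartAt (𝓡 n) q).symm u ∈ (extChartAt (𝓡 n) q').source) (i : Fin n) :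
    pd i (localRep q f) u = ∑ a, transMatrix q q' u i a •
      pd a (localRep q' f) (extChartAt (𝓡 n) q' ((extChartAt (𝓡 n) q).symm u)) := by
  rw [pd_congr i (localRep_eventuallyEq_transition f hu hu'),
    pd_comp i (differentiableAt_localRep hf ((extChartAt (𝓡 n) q').map_source hu'))
      ((contDiffAt_transition hu hu').differentiableAt (by simp))]
  rfl

theorem gram_transition (hx : IsIsometricImmersion c g x)
    (hu : u ∈ (extChartAt (𝓡 n) q).target)
    (hu' : (extChartAt (𝓡 n) q).symm u ∈ (extChartAt (𝓡 n) q').source) :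
    gram g q u = transMatrix q q' u
      * gram g q' (extChartAt (𝓡 n) q' ((extChartAt (𝓡 n) q).symm u))
      * (transMatrix q q' u).transpose := by
  ext i j
  rw [gram_eq hx hu, pd_localRep_transition hx.smooth hu hu' i,
    pd_localRep_transition hx.smooth hu hu' j]
  simp only [map_sum, map_smul, _root_.sum_apply, _root_.smul_apply,
    Matrix.mul_apply, Matrix.transpose_apply, Finset.sum_mul, smul_eq_mul,
    gram_eq hx ((extChartAt (𝓡 n) q').map_source hu')]
  refine Finset.sum_congr rfl fun a _ => ?_
  rw [mul_comm, Finset.sum_mul]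

/-- With `K` the Jacobian matrix, `G = K G' Kᵀ`. Invertibility of `G` forces that of `K`, so the
relation can be inverted. -/
theorem gram_inv_transition (hx : IsIsometricImmersion c g x)
    (hu : u ∈ (extChartAt (𝓡 n) q).target)
    (hu' : (extChartAt (𝓡 n) q).symm u ∈ (extChartAt (𝓡 n) q').source) :
    (transMatrix q q' u).transpose * (gram g q u)⁻¹ * transMatrix q q' u =
      (gram g q' (extChartAt (𝓡 n) q' ((extChartAt (𝓡 n) q).symm u)))⁻¹ := by
  have h := gram_transition hx hu hu'
  set K := transMatrix q q' u
  set G := gram g q u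
  set G' := gram g q' (extChartAt (𝓡 n) q' ((extChartAt (𝓡 n) q).symm u))
  have hG : G.det ≠ 0 := (gram_det_pos g hu).ne'
  have hK : IsUnit K.det := by
    rw [h, Matrix.det_mul, Matrix.det_mul] at hG
    exact (left_ne_zero_of_mul (left_ne_zero_of_mul hG)).isUnit
  have hKt : IsUnit K.transpose.det := by rwa [Matrix.det_transpose]
  rw [h, Matrix.mul_inv_rev, Matrix.mul_inv_rev, ← Matrix.mul_assoc, ← Matrix.mul_assoc,
    Matrix.mul_nonsing_inv _ hKt, Matrix.one_mul, Matrix.mul_assoc, Matrix.nonsing_inv_mul _ hK,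
    Matrix.mul_one]

theorem sum_comm_reverse {ι W : Type*} [Fintype ι] [AddCommMonoid W] (F : ι → ι → ι → ι → W) :
    ∑ i, ∑ j, ∑ b, ∑ a, F i j b a = ∑ a, ∑ b, ∑ j, ∑ i, F i j b a := by
  have h3 : ∀ F : ι → ι → ι → W, ∑ i, ∑ j, ∑ b, F i j b = ∑ b, ∑ j, ∑ i, F i j b := fun F => by
    rw [Finset.sum_comm]
    simp_rw [Finset.sum_comm (f := fun i b => F i _ b)]
    rw [Finset.sum_comm]
  simp_rw [h3 (F _)]
  rw [Finset.sum_comm]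
  refine Finset.sum_congr rfl fun a _ => ?_
  rw [Finset.sum_comm]
  exact Finset.sum_congr rfl fun b _ => Finset.sum_comm

theorem traceIn_transition (hx : IsIsometricImmersion c g x) (B : W₁ →L[ℝ] W₂ →L[ℝ] W₃)
    {f : M → W₁} {h : M → W₂} (hf : ContMDiff (𝓡 n) 𝓘(ℝ, W₁) ∞ f)
    (hh : ContMDiff (𝓡 n) 𝓘(ℝ, W₂) ∞ h) (hu : u ∈ (extChartAt (𝓡 n) q).target)
    (hu' : (extChartAt (𝓡 n) q).symm u ∈ (extChartAt (𝓡 n) q').source) :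
    traceIn g B f h q u
      = traceIn g B f h q' (extChartAt (𝓡 n) q' ((extChartAt (𝓡 n) q).symm u)) := by
  simp only [traceIn, ← gram_inv_transition hx hu hu', pd_localRep_transition hf hu hu',
    pd_localRep_transition hh hu hu', map_sum, map_smul, _root_.sum_apply,
    _root_.smul_apply, Matrix.mul_apply, Matrix.transpose_apply, Finset.sum_smul,
    Finset.smul_sum, Finset.sum_mul, smul_smul]
  rw [sum_comm_reverse]
  refine Finset.sum_congr rfl fun a _ => Finset.sum_congr rfl fun b _ =>
    Finset.sum_congr rfl fun j _ => Finset.sum_congr rfl fun i _ => ?_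
  congr 1
  ring

/-- `traceForm` evaluates each point in its own chart. Independence of the chart lets it be
computed, and differentiated, in one fixed chart near a point. -/
theorem traceForm_symm_apply (hx : IsIsometricImmersion c g x) (B : W₁ →L[ℝ] W₂ →L[ℝ] W₃)
    {f : M → W₁} {h : M → W₂} (hf : ContMDiff (𝓡 n) 𝓘(ℝ, W₁) ∞ f)
    (hh : ContMDiff (𝓡 n) 𝓘(ℝ, W₂) ∞ h) (hu : u ∈ (extChartAt (𝓡 n) q).target) :
    traceForm g B f h ((extChartAt (𝓡 n) q).symm u) = traceIn g B f h q u :=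
  (traceIn_transition hx B hf hh hu (mem_extChartAt_source _)).symm

theorem contMDiff_of_contDiffAt_localRep {f : M → W}
    (h : ∀ q : M, ContDiffAt ℝ ∞ (localRep q f) (extChartAt (𝓡 n) q q)) :
    ContMDiff (𝓡 n) 𝓘(ℝ, W) ∞ f := by
  intro p
  have h1 := (h p).contMDiffAt.comp p (contMDiffAt_extChartAt (I := 𝓡 n) (n := ∞))
  refine h1.congr_of_eventuallyEq ?_
  filter_upwards [extChartAt_source_mem_nhds (I := 𝓡 n) p] with y hy
  simp only [localRep, Function.comp_apply, (extChartAt (𝓡 n) p).left_inv hy]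

theorem contMDiff_traceForm (hx : IsIsometricImmersion c g x) (B : W₁ →L[ℝ] W₂ →L[ℝ] W₃)
    {f : M → W₁} {h : M → W₂} (hf : ContMDiff (𝓡 n) 𝓘(ℝ, W₁) ∞ f)
    (hh : ContMDiff (𝓡 n) 𝓘(ℝ, W₂) ∞ h) :
    ContMDiff (𝓡 n) 𝓘(ℝ, W₃) ∞ (traceForm g B f h) := by
  refine contMDiff_of_contDiffAt_localRep fun q => ?_
  have hu := mem_extChartAt_target (I := 𝓡 n) q
  have h1 : localRep q (traceForm g B f h) =ᶠ[nhds (extChartAt (𝓡 n) q q)]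
      traceIn g B f h q := by
    filter_upwards [target_mem_nhds hu] with v hv using traceForm_symm_apply hx B hf hh hv
  refine ContDiffAt.congr_of_eventuallyEq ?_ h1
  refine ContDiffAt.sum fun i _ => ContDiffAt.sum fun j _ => ?_
  exact (contDiffAt_gram_inv hx hu i j).smul (contDiffAt_bilin B
    (contDiffAt_pd (contDiffAt_localRep hf hu) i) (contDiffAt_pd (contDiffAt_localRep hh hu) j))

end Operators

/-! ### The Laplacian of vector-valued maps -/

section Laplacian

variable {n : ℕ} {M : Type*} [TopologicalSpace M] [ChartedSpace (EuclideanSpace ℝ (Fin n)) M]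
  [IsManifold (𝓡 n) ∞ M]
  {W W₁ W₂ W₃ : Type*} [NormedAddCommGroup W] [NormedSpace ℝ W]
  [NormedAddCommGroup W₁] [NormedSpace ℝ W₁] [NormedAddCommGroup W₂] [NormedSpace ℝ W₂]
  [NormedAddCommGroup W₃] [NormedSpace ℝ W₃]
  {c : ℝ} {g : RMetric n M} {x : M → Amb n} {q q' p : M} {u : EuclideanSpace ℝ (Fin n)}

theorem differentiableAt_pd {f : EuclideanSpace ℝ (Fin n) → W} (hf : ContDiffAt ℝ ∞ f u)
    (i : Fin n) : DifferentiableAt ℝ (pd i f) u :=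
  (contDiffAt_pd hf i).differentiableAt (by simp)

theorem pd_gram (hx : IsIsometricImmersion c g x) (hu : u ∈ (extChartAt (𝓡 n) q).target)
    (i j l : Fin n) :
    pd i (fun w => gram g q w j l) u
      = metricL n c (pd i (pd j (localRep q x)) u) (pd l (localRep q x) u)
        + metricL n c (pd j (localRep q x) u) (pd i (pd l (localRep q x)) u) := by
  have hX := contDiffAt_localRep hx.smooth hu
  rw [pd_congr i (gram_eventuallyEq hx hu j l),
    pd_bilin _ i (differentiableAt_pd hX j) (differentiableAt_pd hX l)]

/-- Expanding each `∂g` by the product rule gives six terms; by symmetry of second derivatives four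
cancel and the other two coincide. -/
theorem christoffel_eq (hx : IsIsometricImmersion c g x) (hu : u ∈ (extChartAt (𝓡 n) q).target)
    (i j k : Fin n) :
    christoffel g q u i j k = ∑ l, (gram g q u)⁻¹ k l *
      metricL n c (pd i (pd j (localRep q x)) u) (pd l (localRep q x) u) := by
  have hX := contDiffAt_localRep hx.smooth hu
  rw [christoffel, Finset.mul_sum]
  refine Finset.sum_congr rfl fun l _ => ?_
  rw [pd_gram hx hu, pd_gram hx hu, pd_gram hx hu, pd_comm hX j i, pd_comm hX l i,
    pd_comm hX l j, metricL_comm c (pd j (localRep q x) u)]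
  rw [metricL_comm c (pd i (localRep q x) u)]
  ring

/-- The bilinear map `(w, v) ↦ ⟨v, ·⟩ w`. -/
def dyadL (n : ℕ) (c : ℝ) (W : Type*) [NormedAddCommGroup W] [NormedSpace ℝ W] :
    W →L[ℝ] Amb n →L[ℝ] Amb n →L[ℝ] W :=
  ((ContinuousLinearMap.smulRightL ℝ (Amb n) W).comp (metricL n c)).flip

theorem dyadL_apply (w : W) (v v' : Amb n) : dyadL n c W w v v' = metricL n c v v' • w := by
  simp [dyadL]

/-- The differential of `f`, extended to the ambient space by zero on the normal space of `x`. -/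
def ambDiff (c : ℝ) (g : RMetric n M) (x : M → Amb n) (f : M → W) : M → Amb n →L[ℝ] W :=
  traceForm g (dyadL n c W) f x

/-- The evaluation of linear maps, as a bilinear map. -/
def evalL (n : ℕ) (W : Type*) [NormedAddCommGroup W] [NormedSpace ℝ W] :
    (Amb n →L[ℝ] W) →L[ℝ] Amb n →L[ℝ] W := ContinuousLinearMap.id ℝ _

theorem ambDiff_pd (hx : IsIsometricImmersion c g x) {f : M → W}
    (hf : ContMDiff (𝓡 n) 𝓘(ℝ, W) ∞ f) (hu : u ∈ (extChartAt (𝓡 n) q).target) (j : Fin n) :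
    localRep q (ambDiff c g x f) u (pd j (localRep q x) u) = pd j (localRep q f) u := by
  simp only [localRep, ambDiff]
  rw [traceForm_symm_apply hx _ hf hx.smooth hu]
  simp only [traceIn, _root_.sum_apply, _root_.smul_apply, dyadL_apply, ← gram_eq hx hu, smul_smul]
  simp_rw [← Finset.sum_smul, ← Matrix.mul_apply, gram_inv_mul g hu, Matrix.one_apply]
  simp

/-- The extended differential only sees the tangential part of `∂ᵢ∂ⱼx`, whose components are the
Christoffel symbols by `christoffel_eq`. -/
theorem ambDiff_second (hx : IsIsometricImmersion c g x) {f : M → W}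
    (hf : ContMDiff (𝓡 n) 𝓘(ℝ, W) ∞ f) (hu : u ∈ (extChartAt (𝓡 n) q).target) (i j : Fin n) :
    localRep q (ambDiff c g x f) u (pd i (pd j (localRep q x)) u)
      = ∑ k, christoffel g q u i j k • pd k (localRep q f) u := by
  have : localRep q (ambDiff c g x f) u = traceIn g (dyadL n c W) f x q u :=
    traceForm_symm_apply hx _ hf hx.smooth hu
  rw [this]
  simp only [traceIn, _root_.sum_apply, _root_.smul_apply, dyadL_apply, christoffel_eq hx hu,
    smul_smul, Finset.sum_smul]
  simp_rw [metricL_comm c (pd i (pd j (localRep q x)) u)]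

theorem contMDiff_ambDiff (hx : IsIsometricImmersion c g x) {f : M → W}
    (hf : ContMDiff (𝓡 n) 𝓘(ℝ, W) ∞ f) :
    ContMDiff (𝓡 n) 𝓘(ℝ, Amb n →L[ℝ] W) ∞ (ambDiff c g x f) :=
  contMDiff_traceForm hx _ hf hx.smooth

/-- Differentiate `∂ⱼf = (ambDiff f)(∂ⱼx)` by the product rule; the term with `∂ᵢ∂ⱼx` is the
Christoffel term and cancels. Only first derivatives of maps on `M` remain, so the Laplacian becomes
a `traceForm` and inherits chart independence and smoothness. -/
theorem hess_eq (hx : IsIsometricImmersion c g x) {f : M → W}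
    (hf : ContMDiff (𝓡 n) 𝓘(ℝ, W) ∞ f) (hu : u ∈ (extChartAt (𝓡 n) q).target) (i j : Fin n) :
    pd i (pd j (localRep q f)) u - ∑ k, christoffel g q u i j k • pd k (localRep q f) u
      = evalL n W (pd i (localRep q (ambDiff c g x f)) u) (pd j (localRep q x) u) := by
  have h : pd j (localRep q f) =ᶠ[nhds u] fun v => evalL n W (localRep q (ambDiff c g x f) v)
      (pd j (localRep q x) v) := by
    filter_upwards [target_mem_nhds hu] with v hv using (ambDiff_pd hx hf hv j).symm
  rw [pd_congr i h, pd_bilin _ i (differentiableAt_localRep (contMDiff_ambDiff hx hf) hu)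
    (differentiableAt_pd (contDiffAt_localRep hx.smooth hu) j), ← ambDiff_second hx hf hu]
  exact add_sub_cancel_right _ _

theorem lapIn_eq_traceIn (hx : IsIsometricImmersion c g x) {f : M → W}
    (hf : ContMDiff (𝓡 n) 𝓘(ℝ, W) ∞ f) (hu : u ∈ (extChartAt (𝓡 n) q).target) :
    lapIn g f q u = traceIn g (evalL n W) (ambDiff c g x f) x q u := by
  simp only [lapIn, traceIn, hess_eq hx hf hu]

theorem lap_eq_traceForm (hx : IsIsometricImmersion c g x) {f : M → W}
    (hf : ContMDiff (𝓡 n) 𝓘(ℝ, W) ∞ f) :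
    lap g f = traceForm g (evalL n W) (ambDiff c g x f) x :=
  funext fun p => lapIn_eq_traceIn hx hf (mem_extChartAt_target p)

theorem lap_symm_apply (hx : IsIsometricImmersion c g x) {f : M → W}
    (hf : ContMDiff (𝓡 n) 𝓘(ℝ, W) ∞ f) (hu : u ∈ (extChartAt (𝓡 n) q).target) :
    lap g f ((extChartAt (𝓡 n) q).symm u) = lapIn g f q u := by
  rw [lap_eq_traceForm hx hf, lapIn_eq_traceIn hx hf hu,
    traceForm_symm_apply hx _ (contMDiff_ambDiff hx hf) hx.smooth hu]

theorem contMDiff_lap (hx : IsIsometricImmersion c g x) {f : M → W}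
    (hf : ContMDiff (𝓡 n) 𝓘(ℝ, W) ∞ f) : ContMDiff (𝓡 n) 𝓘(ℝ, W) ∞ (lap g f) := by
  rw [lap_eq_traceForm hx hf]
  exact contMDiff_traceForm hx _ (contMDiff_ambDiff hx hf) hx.smooth

theorem traceForm_self (hx : IsIsometricImmersion c g x) :
    traceForm g (metricL n c) x x p = n := by
  have hu := mem_extChartAt_target (I := 𝓡 n) p
  simp only [traceForm, traceIn, ← gram_eq hx hu, smul_eq_mul]
  have key : ∀ i, ∑ j, (gram g p (extChartAt (𝓡 n) p p))⁻¹ i j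
      * gram g p (extChartAt (𝓡 n) p p) i j = 1 := fun i => by
    have h := congrFun (congrFun (gram_inv_mul g hu) i) i
    rw [Matrix.mul_apply, Matrix.one_apply_eq] at h
    rw [← h]
    exact Finset.sum_congr rfl fun j _ => by rw [gram_symm g i j]
  rw [Finset.sum_congr rfl fun i _ => key i]
  simp

theorem traceForm_flip (B : W₁ →L[ℝ] W₂ →L[ℝ] W₃) (f : M → W₁) (h : M → W₂) :
    traceForm g B.flip h f p = traceForm g B f h p := by
  simp only [traceForm, traceIn, ContinuousLinearMap.flip_apply]
  rw [Finset.sum_comm]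
  simp_rw [gram_inv_symm g]

theorem traceForm_add_left (B : W₁ →L[ℝ] W₂ →L[ℝ] W₃) {f f' : M → W₁} (h : M → W₂)
    (hf : ContMDiff (𝓡 n) 𝓘(ℝ, W₁) ∞ f) (hf' : ContMDiff (𝓡 n) 𝓘(ℝ, W₁) ∞ f') :
    traceForm g B (fun p => f p + f' p) h p = traceForm g B f h p + traceForm g B f' h p := by
  have hu := mem_extChartAt_target (I := 𝓡 n) p
  have key : ∀ i, pd i (localRep p fun p => f p + f' p) (extChartAt (𝓡 n) p p)
      = pd i (localRep p f) (extChartAt (𝓡 n) p p) + pd i (localRep p f') (extChartAt (𝓡 n) p p) :=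
    fun i => pd_add i (differentiableAt_localRep hf hu) (differentiableAt_localRep hf' hu)
  simp only [traceForm, traceIn, key, map_add, _root_.add_apply, smul_add, Finset.sum_add_distrib]

theorem traceForm_clm_left (B : W₁ →L[ℝ] W₂ →L[ℝ] W₃) (L : W →L[ℝ] W₁) {f : M → W} (h : M → W₂)
    (hf : ContMDiff (𝓡 n) 𝓘(ℝ, W) ∞ f) :
    traceForm g B (fun p => L (f p)) h p = traceForm g (B.comp L) f h p := by
  have hu := mem_extChartAt_target (I := 𝓡 n) p
  have key : ∀ i, pd i (localRep p fun p => L (f p)) (extChartAt (𝓡 n) p p)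
      = L (pd i (localRep p f) (extChartAt (𝓡 n) p p)) :=
    fun i => pd_clm L i (differentiableAt_localRep hf hu)
  simp only [traceForm, traceIn, key, ContinuousLinearMap.comp_apply]

theorem traceForm_const_left (B : W₁ →L[ℝ] W₂ →L[ℝ] W₃) (w : W₁) (h : M → W₂) :
    traceForm g B (fun _ => w) h p = 0 := by
  have key : ∀ i, pd i (localRep p fun _ => w) (extChartAt (𝓡 n) p p) = 0 :=
    fun i => pd_const i w
  simp only [traceForm, traceIn, key, map_zero, _root_.zero_apply, smul_zero,
    Finset.sum_const_zero]

theorem lap_congr {f h : M → W} (hfh : f =ᶠ[nhds p] h) : lap g f p = lap g h p := by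
  have h1 : localRep p f =ᶠ[nhds (extChartAt (𝓡 n) p p)] localRep p h := by
    have h2 : ContinuousAt (extChartAt (𝓡 n) p).symm (extChartAt (𝓡 n) p p) :=
      continuousAt_extChartAt_symm p
    have h3 := h2.eventually (p := fun y => f y = h y)
      (by rw [extChartAt_to_inv]; exact hfh)
    exact h3
  have h2 : ∀ i, pd i (localRep p f) (extChartAt (𝓡 n) p p)
      = pd i (localRep p h) (extChartAt (𝓡 n) p p) := fun i => pd_congr i h1
  have h3 : ∀ i j, pd i (pd j (localRep p f)) (extChartAt (𝓡 n) p p)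
      = pd i (pd j (localRep p h)) (extChartAt (𝓡 n) p p) :=
    fun i j => pd_congr i (pd_eventually_congr j h1)
  simp only [lap, lapIn, h2, h3]

theorem lap_const (w : W) : lap g (fun _ : M => w) p = 0 := by
  have h2 : ∀ j : Fin n, pd j (localRep p fun _ : M => w) = fun _ => 0 :=
    fun j => funext fun v => pd_const j w
  simp only [lap, lapIn, h2, pd_const, smul_zero, sub_zero, Finset.sum_const_zero]

theorem lap_clm (L : W →L[ℝ] W₁) {f : M → W} (hf : ContMDiff (𝓡 n) 𝓘(ℝ, W) ∞ f) :
    lap g (fun p => L (f p)) p = L (lap g f p) := by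
  have hu := mem_extChartAt_target (I := 𝓡 n) p
  have h1 : ∀ j, ∀ v ∈ (extChartAt (𝓡 n) p).target, pd j (localRep p fun p => L (f p)) v
      = L (pd j (localRep p f) v) := fun j v hv => pd_clm L j (differentiableAt_localRep hf hv)
  have h2 : ∀ i j, pd i (pd j (localRep p fun p => L (f p))) (extChartAt (𝓡 n) p p)
      = L (pd i (pd j (localRep p f)) (extChartAt (𝓡 n) p p)) := fun i j => by
    rw [pd_congr i (Filter.eventually_of_mem (target_mem_nhds hu) (h1 j)),
      pd_clm L i (differentiableAt_pd (contDiffAt_localRep hf hu) j)]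
  simp only [lap, lapIn, h1 _ _ hu, h2, map_sum, map_smul, map_sub]

/-- Addition is a linear map on `W × W`, so this is an instance of `lap_clm`. -/
theorem lap_add {f h : M → W} (hf : ContMDiff (𝓡 n) 𝓘(ℝ, W) ∞ f)
    (hh : ContMDiff (𝓡 n) 𝓘(ℝ, W) ∞ h) :
    lap g (fun p => f p + h p) p = lap g f p + lap g h p := by
  have h1 := lap_clm (g := g) (p := p) (ContinuousLinearMap.fst ℝ W W + ContinuousLinearMap.snd ℝ W W)
    (hf.prodMk_space hh)
  have h2 := lap_clm (g := g) (p := p) (ContinuousLinearMap.fst ℝ W W) (hf.prodMk_space hh)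
  have h3 := lap_clm (g := g) (p := p) (ContinuousLinearMap.snd ℝ W W) (hf.prodMk_space hh)
  simp only [_root_.add_apply] at h1
  rw [← h2, ← h3] at h1
  exact h1

theorem lap_bilin (B : W₁ →L[ℝ] W₂ →L[ℝ] W₃) {f : M → W₁} {h : M → W₂}
    (hf : ContMDiff (𝓡 n) 𝓘(ℝ, W₁) ∞ f) (hh : ContMDiff (𝓡 n) 𝓘(ℝ, W₂) ∞ h) :
    lap g (fun p => B (f p) (h p)) p
      = B (lap g f p) (h p) + B (f p) (lap g h p) + (2 : ℝ) • traceForm g B f h p := by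
  have hu := mem_extChartAt_target (I := 𝓡 n) p
  have h1 : ∀ j, ∀ v ∈ (extChartAt (𝓡 n) p).target,
      pd j (localRep p fun p => B (f p) (h p)) v
      = B (pd j (localRep p f) v) (localRep p h v) + B (localRep p f v) (pd j (localRep p h) v) :=
    fun j v hv => pd_bilin B j (differentiableAt_localRep hf hv) (differentiableAt_localRep hh hv)
  have hF := contDiffAt_localRep hf hu
  have hH := contDiffAt_localRep hh hu
  have hF' := differentiableAt_localRep hf hu
  have hH' := differentiableAt_localRep hh hu
  have h2 : ∀ i j, pd i (pd j (localRep p fun p => B (f p) (h p))) (extChartAt (𝓡 n) p p)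
      = B (pd i (pd j (localRep p f)) (extChartAt (𝓡 n) p p)) (h p)
        + B (f p) (pd i (pd j (localRep p h)) (extChartAt (𝓡 n) p p))
        + (B (pd i (localRep p f) (extChartAt (𝓡 n) p p))
            (pd j (localRep p h) (extChartAt (𝓡 n) p p))
          + B.flip (pd i (localRep p h) (extChartAt (𝓡 n) p p))
            (pd j (localRep p f) (extChartAt (𝓡 n) p p))) := fun i j => by
    rw [pd_congr i (Filter.eventually_of_mem (target_mem_nhds hu) (h1 j)),
      pd_add i, pd_bilin B i (differentiableAt_pd hF j) hH',
      pd_bilin B i hF' (differentiableAt_pd hH j)]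
    · simp only [localRep, extChartAt_to_inv, ContinuousLinearMap.flip_apply]
      abel
    · exact (B.hasFDerivAt_of_bilinear (differentiableAt_pd hF j).hasFDerivAt
        hH'.hasFDerivAt).differentiableAt
    · exact (B.hasFDerivAt_of_bilinear hF'.hasFDerivAt
        (differentiableAt_pd hH j).hasFDerivAt).differentiableAt
  have h3 : localRep p f (extChartAt (𝓡 n) p p) = f p := by simp only [localRep, extChartAt_to_inv]
  have h4 : localRep p h (extChartAt (𝓡 n) p p) = h p := by simp only [localRep, extChartAt_to_inv]
  rw [two_smul]
  -- The product rule yields the cross terms `B(∂ᵢf, ∂ⱼh)` and `B(∂ⱼf, ∂ᵢh)`; flipping one of the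
  -- two copies of the trace makes the sums match term by term.
  nth_rewrite 2 [← traceForm_flip]
  simp only [lap, lapIn, traceForm, traceIn, h1 _ _ hu, h2, h3, h4, map_sum, map_smul, map_sub,
    _root_.sum_apply, _root_.smul_apply, _root_.sub_apply, ← Finset.sum_add_distrib, ← smul_add]
  refine Finset.sum_congr rfl fun i _ => Finset.sum_congr rfl fun j _ => ?_
  congr 1
  simp only [smul_add, Finset.sum_add_distrib]
  abel

end Laplacian

/-! ### The Riemannian measure -/

section Volume

variable {n : ℕ} {M : Type*} [TopologicalSpace M] [ChartedSpace (EuclideanSpace ℝ (Fin n)) M]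
  [IsManifold (𝓡 n) ∞ M] [MeasurableSpace M] [BorelSpace M]
  {c : ℝ} {g : RMetric n M} {x : M → Amb n} {q q' p : M} {u : EuclideanSpace ℝ (Fin n)}

/-- The measure `√(det gᵢⱼ) du` of the chart at `q`, transported to `M`. -/
def chartMeasure (g : RMetric n M) (q : M) : Measure M :=
  Measure.map (extChartAt (𝓡 n) q).symm
    ((volume.restrict (extChartAt (𝓡 n) q).target).withDensity
      fun u => ENNReal.ofReal √(gram g q u).det)

theorem riemVol_eq_iSup (g : RMetric n M) : riemVol g = ⨆ q, chartMeasure g q := rfl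

theorem measurableSet_target (q : M) : MeasurableSet (extChartAt (𝓡 n) q).target :=
  (isOpen_extChartAt_target q).measurableSet

theorem measurableSet_source (q : M) : MeasurableSet (extChartAt (𝓡 n) q).source :=
  (isOpen_extChartAt_source q).measurableSet

theorem aemeasurable_symm (g : RMetric n M) (q : M) : AEMeasurable (extChartAt (𝓡 n) q).symm
    ((volume.restrict (extChartAt (𝓡 n) q).target).withDensity
      fun u => ENNReal.ofReal √(gram g q u).det) :=
  ((continuousOn_extChartAt_symm q).aemeasurable (measurableSet_target q)).mono_ac
    (withDensity_absolutelyContinuous _ _)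

theorem chartMeasure_apply (g : RMetric n M) (q : M) {s : Set M} (hs : MeasurableSet s) :
    chartMeasure g q s
      = ∫⁻ u in (extChartAt (𝓡 n) q).symm ⁻¹' s ∩ (extChartAt (𝓡 n) q).target,
          ENNReal.ofReal √(gram g q u).det := by
  rw [chartMeasure, Measure.map_apply_of_aemeasurable (aemeasurable_symm g q) hs,
    withDensity_apply', Measure.restrict_restrict' (measurableSet_target q)]

theorem measurableSet_preimage_symm (q : M) {s : Set M} (hs : MeasurableSet s) :
    MeasurableSet ((extChartAt (𝓡 n) q).symm ⁻¹' s ∩ (extChartAt (𝓡 n) q).target) := by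
  have h : Measurable ((extChartAt (𝓡 n) q).target.domRestrict (extChartAt (𝓡 n) q).symm) :=
    (continuousOn_iff_continuous_domRestrict.1 (continuousOn_extChartAt_symm q)).measurable
  have h2 := (measurableSet_target q).subtype_image (h hs)
  convert h2 using 1
  ext v
  simp only [mem_inter_iff, mem_preimage, mem_image, Subtype.exists]
  constructor
  · rintro ⟨h1, h2⟩; exact ⟨v, h2, h1, rfl⟩
  · rintro ⟨v', h2, h1, rfl⟩; exact ⟨h1, h2⟩

theorem det_fderiv_transition (q q' : M) (u : EuclideanSpace ℝ (Fin n)) :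
    (fderiv ℝ (fun v => extChartAt (𝓡 n) q' ((extChartAt (𝓡 n) q).symm v)) u).det
      = (transMatrix q q' u).det := by
  rw [ContinuousLinearMap.det, ← LinearMap.det_toMatrix (EuclideanSpace.basisFun (Fin n) ℝ).toBasis,
    ← Matrix.det_transpose]
  congr 1

theorem sqrt_det_gram_transition (hx : IsIsometricImmersion c g x)
    (hu : u ∈ (extChartAt (𝓡 n) q).target)
    (hu' : (extChartAt (𝓡 n) q).symm u ∈ (extChartAt (𝓡 n) q').source) :
    √(gram g q u).det = |(transMatrix q q' u).det|
      * √(gram g q' (extChartAt (𝓡 n) q' ((extChartAt (𝓡 n) q).symm u))).det := by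
  have h : (gram g q u).det = (transMatrix q q' u).det ^ 2
      * (gram g q' (extChartAt (𝓡 n) q' ((extChartAt (𝓡 n) q).symm u))).det := by
    rw [gram_transition hx hu hu', Matrix.det_mul, Matrix.det_mul, Matrix.det_transpose]
    ring
  rw [h, Real.sqrt_mul (sq_nonneg _), Real.sqrt_sq_eq_abs]

/-- Change of variables: `√det g` picks up the absolute value of the Jacobian determinant of the
transition map. -/
theorem chartMeasure_eq_of_subset (hx : IsIsometricImmersion c g x) {s : Set M}
    (hs : MeasurableSet s) (hq : s ⊆ (extChartAt (𝓡 n) q).source)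
    (hq' : s ⊆ (extChartAt (𝓡 n) q').source) : chartMeasure g q s = chartMeasure g q' s := by
  rw [chartMeasure_apply g q hs, chartMeasure_apply g q' hs]
  set S := (extChartAt (𝓡 n) q).symm ⁻¹' s ∩ (extChartAt (𝓡 n) q).target
  set T := fun v => extChartAt (𝓡 n) q' ((extChartAt (𝓡 n) q).symm v) with hT
  have himg : (extChartAt (𝓡 n) q').symm ⁻¹' s ∩ (extChartAt (𝓡 n) q').target = T '' S := by
    ext w
    constructor
    · rintro ⟨h1, h2⟩
      refine ⟨extChartAt (𝓡 n) q ((extChartAt (𝓡 n) q').symm w), ⟨?_, ?_⟩, ?_⟩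
      · simp only [mem_preimage]
        rw [(extChartAt (𝓡 n) q).left_inv (hq h1)]
        exact h1
      · exact (extChartAt (𝓡 n) q).map_source (hq h1)
      · simp only [hT]
        rw [(extChartAt (𝓡 n) q).left_inv (hq h1), (extChartAt (𝓡 n) q').right_inv h2]
    · rintro ⟨v, ⟨h1, h2⟩, rfl⟩
      refine ⟨?_, (extChartAt (𝓡 n) q').map_source (hq' h1)⟩
      simp only [mem_preimage, hT]
      rw [(extChartAt (𝓡 n) q').left_inv (hq' h1)]
      exact h1
  have hinj : InjOn T S := by
    rintro v ⟨h1, h2⟩ v' ⟨h1', h2'⟩ h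
    exact (extChartAt (𝓡 n) q).symm.injOn h2 h2'
      ((extChartAt (𝓡 n) q').injOn (hq' h1) (hq' h1') h)
  rw [himg, lintegral_image_eq_lintegral_abs_det_fderiv_mul volume
    (measurableSet_preimage_symm q hs) (f' := fun v => fderiv ℝ T v)
    (fun v hv => ((contDiffAt_transition hv.2 (hq' hv.1)).differentiableAt
      (by simp)).hasFDerivAt.hasFDerivWithinAt) hinj]
  refine setLIntegral_congr_fun (measurableSet_preimage_symm q hs) fun v hv => ?_
  simp only [hT]
  rw [det_fderiv_transition, sqrt_det_gram_transition hx hv.2 (hq' hv.1),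
    ENNReal.ofReal_mul (abs_nonneg _)]

theorem chartMeasure_compl_source (g : RMetric n M) (q : M) :
    chartMeasure g q (extChartAt (𝓡 n) q).sourceᶜ = 0 := by
  rw [chartMeasure_apply g q (measurableSet_source q).compl]
  have : (extChartAt (𝓡 n) q).symm ⁻¹' (extChartAt (𝓡 n) q).sourceᶜ
      ∩ (extChartAt (𝓡 n) q).target = ∅ := by
    ext v
    simp only [mem_inter_iff, mem_preimage, mem_compl_iff, mem_empty_iff_false, iff_false, not_and]
    intro h h'
    exact h ((extChartAt (𝓡 n) q).map_target h')
  rw [this]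
  simp

theorem chartMeasure_restrict_le (hx : IsIsometricImmersion c g x) :
    (chartMeasure g q').restrict (extChartAt (𝓡 n) q).source ≤ chartMeasure g q := by
  refine Measure.le_iff.2 fun s hs => ?_
  rw [Measure.restrict_apply hs]
  set t := s ∩ (extChartAt (𝓡 n) q).source
  have ht : MeasurableSet t := hs.inter (measurableSet_source q)
  calc chartMeasure g q' t
      ≤ chartMeasure g q' (t ∩ (extChartAt (𝓡 n) q').source)
          + chartMeasure g q' (extChartAt (𝓡 n) q').sourceᶜ := by
        refine (measure_mono ?_).trans (measure_union_le _ _)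
        intro y hy
        by_cases h : y ∈ (extChartAt (𝓡 n) q').source
        · exact Or.inl ⟨hy, h⟩
        · exact Or.inr h
    _ = chartMeasure g q (t ∩ (extChartAt (𝓡 n) q').source) := by
        rw [chartMeasure_compl_source, add_zero]
        exact chartMeasure_eq_of_subset hx (ht.inter (measurableSet_source q'))
          inter_subset_right (inter_subset_left.trans inter_subset_right)
    _ ≤ chartMeasure g q s := measure_mono (inter_subset_left.trans inter_subset_left)

/-- The supremum defining `riemVol` is hard to evaluate directly. As the chart measures agree on
overlaps, none of them exceeds that of `q` on the domain of the chart at `q`, so the supremum is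
attained there. -/
theorem riemVol_restrict_source (hx : IsIsometricImmersion c g x) (q : M) :
    (riemVol g).restrict (extChartAt (𝓡 n) q).source = chartMeasure g q := by
  have hself : (chartMeasure g q).restrict (extChartAt (𝓡 n) q).source = chartMeasure g q :=
    Measure.restrict_eq_self_of_ae_mem
      (by rw [ae_iff]; exact chartMeasure_compl_source g q)
  refine le_antisymm ?_ ?_
  -- Split each chart measure into its parts inside and outside the domain at `q`. The right side
  -- bounds all of them at once, hence their supremum, and its second term disappears on
  -- restriction.
  · have h : riemVol g ≤ chartMeasure g q
        + (riemVol g).restrict (extChartAt (𝓡 n) q).sourceᶜ := by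
      rw [riemVol_eq_iSup]
      refine iSup_le fun q' => ?_
      rw [← Measure.restrict_add_restrict_compl (μ := chartMeasure g q')
        (measurableSet_source (n := n) q)]
      exact add_le_add (chartMeasure_restrict_le hx)
        (Measure.restrict_mono le_rfl (le_iSup (fun q' => chartMeasure g q') q'))
    refine (Measure.restrict_mono (le_refl (extChartAt (𝓡 n) q).source) h).trans ?_
    rw [Measure.restrict_add, hself, Measure.restrict_restrict (measurableSet_source q)]
    simp
  · conv_lhs => rw [← hself]
    exact Measure.restrict_mono le_rfl (le_iSup (fun q' => chartMeasure g q') q)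

theorem riemVol_apply_of_subset (hx : IsIsometricImmersion c g x) {s : Set M}
    (hs : MeasurableSet s) (hq : s ⊆ (extChartAt (𝓡 n) q).source) :
    riemVol g s = ∫⁻ u in (extChartAt (𝓡 n) q).symm ⁻¹' s ∩ (extChartAt (𝓡 n) q).target,
          ENNReal.ofReal √(gram g q u).det := by
  rw [← chartMeasure_apply g q hs, ← riemVol_restrict_source hx q, Measure.restrict_apply hs,
    inter_eq_self_of_subset_left hq]

theorem continuousOn_sqrt_det (hx : IsIsometricImmersion c g x) (q : M) :
    ContinuousOn (fun u => √(gram g q u).det) (extChartAt (𝓡 n) q).target := fun _ hu =>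
  (contDiffAt_gram_det hx hu).continuousAt.sqrt.continuousWithinAt

theorem isLocallyFiniteMeasure_riemVol (hx : IsIsometricImmersion c g x) :
    IsLocallyFiniteMeasure (riemVol g) := by
  refine ⟨fun p => ?_⟩
  -- On a closed ball inside the chart target the density is continuous on a compact set, hence
  -- integrable.
  obtain ⟨r, hr, hsub⟩ := Metric.nhds_basis_closedBall.mem_iff.1
    (target_mem_nhds (mem_extChartAt_target (I := 𝓡 n) p))
  set s := (extChartAt (𝓡 n) p).source ∩
    extChartAt (𝓡 n) p ⁻¹' Metric.ball (extChartAt (𝓡 n) p p) r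
  have hso : IsOpen s := (continuousOn_extChartAt p).isOpen_inter_preimage
    (isOpen_extChartAt_source p) Metric.isOpen_ball
  refine ⟨s, hso.mem_nhds ⟨mem_extChartAt_source p, Metric.mem_ball_self hr⟩, ?_⟩
  rw [riemVol_apply_of_subset hx hso.measurableSet inter_subset_left]
  refine (lintegral_mono_set (t := Metric.closedBall (extChartAt (𝓡 n) p p) r) ?_).trans_lt ?_
  · rintro v ⟨⟨_, h1⟩, h2⟩
    simp only [mem_preimage] at h1
    rw [(extChartAt (𝓡 n) p).right_inv h2] at h1
    exact Metric.ball_subset_closedBall h1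
  · have h := ((continuousOn_sqrt_det hx p).mono hsub).integrableOn_compact (μ := volume)
      (isCompact_closedBall _ _)
    refine (lintegral_mono fun v => ?_).trans_lt h.2
    rw [← Real.enorm_of_nonneg (Real.sqrt_nonneg _)]

theorem isOpenPosMeasure_riemVol (hx : IsIsometricImmersion c g x) :
    (riemVol g).IsOpenPosMeasure := by
  refine ⟨fun s hs ⟨p, hp⟩ h0 => ?_⟩
  set t := s ∩ (extChartAt (𝓡 n) p).source
  have ht : MeasurableSet t := hs.measurableSet.inter (measurableSet_source p)
  have h1 : riemVol g t = 0 := measure_mono_null inter_subset_left h0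
  rw [riemVol_apply_of_subset hx ht inter_subset_right] at h1
  set O := (extChartAt (𝓡 n) p).symm ⁻¹' t ∩ (extChartAt (𝓡 n) p).target with hO
  have hOo : IsOpen O := by
    rw [hO, inter_comm]
    exact (continuousOn_extChartAt_symm p).isOpen_inter_preimage (isOpen_extChartAt_target p)
      (hs.inter (isOpen_extChartAt_source p))
  have hOn : O.Nonempty := ⟨extChartAt (𝓡 n) p p, by
    refine ⟨?_, mem_extChartAt_target p⟩
    simp only [mem_preimage]
    rw [extChartAt_to_inv]
    exact ⟨hp, mem_extChartAt_source p⟩⟩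
  have hcont : ContinuousOn (fun u => ENNReal.ofReal √(gram g p u).det) O :=
    ENNReal.continuous_ofReal.comp_continuousOn
      ((continuousOn_sqrt_det hx p).mono inter_subset_right)
  rw [lintegral_eq_zero_iff' (hcont.aemeasurable hOo.measurableSet)] at h1
  have h2 : ∀ᵐ v ∂(volume.restrict O), v ∉ O := by
    filter_upwards [h1] with v hv hvO
    have := Real.sqrt_pos.2 (gram_det_pos g hvO.2)
    simp only [Pi.zero_apply, ENNReal.ofReal_eq_zero] at hv
    linarith
  rw [ae_restrict_iff' hOo.measurableSet] at h2
  have h3 : volume O = 0 := by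
    rw [← compl_compl O]
    refine measure_mono_null ?_ (ae_iff.1 h2)
    intro v hv
    simp only [mem_ofPred_eq, not_forall]
    exact ⟨by simpa using hv, fun h => h (by simpa using hv)⟩
  exact hOo.measure_ne_zero volume hOn h3

theorem isFiniteMeasure_riemVol [CompactSpace M] (hx : IsIsometricImmersion c g x) :
    IsFiniteMeasure (riemVol g) := by
  have := isLocallyFiniteMeasure_riemVol hx
  infer_instance

theorem integral_riemVol_of_support (hx : IsIsometricImmersion c g x) (q : M) {F : M → ℝ}
    (hF : Continuous F) (h0 : ∀ p ∉ (extChartAt (𝓡 n) q).source, F p = 0) :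
    ∫ p, F p ∂(riemVol g) = ∫ u in (extChartAt (𝓡 n) q).target,
      √(gram g q u).det * F ((extChartAt (𝓡 n) q).symm u) := by
  rw [← setIntegral_eq_integral_of_forall_compl_eq_zero h0, riemVol_restrict_source hx q,
    chartMeasure, integral_map (aemeasurable_symm g q) (hF.stronglyMeasurable.aestronglyMeasurable),
    integral_withDensity_eq_integral_toReal_smul₀]
  · simp only [ENNReal.toReal_ofReal (Real.sqrt_nonneg _), smul_eq_mul]
  · exact ((ENNReal.continuous_ofReal.comp_continuousOn
      (continuousOn_sqrt_det hx q)).aemeasurable (measurableSet_target q))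
  · exact Filter.Eventually.of_forall fun _ => ENNReal.ofReal_lt_top

end Volume

/-! ### The divergence theorem for gradients -/

section Divergence

theorem differentiable_det (n : ℕ) :
    Differentiable ℝ (fun A : Fin n → Fin n → ℝ => (Matrix.of A).det) := by
  simp only [Matrix.det_apply, Matrix.of_apply]
  fun_prop

/-- Jacobi's formula, by computing the derivative of `s ↦ det(A + s A')` at `0` in two ways. -/
theorem fderiv_det {n : ℕ} {A : Fin n → Fin n → ℝ} (hA : (Matrix.of A).det ≠ 0)
    (A' : Fin n → Fin n → ℝ) :
    fderiv ℝ (fun A : Fin n → Fin n → ℝ => (Matrix.of A).det) A A'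
      = (Matrix.of A).det * ((Matrix.of A)⁻¹ * Matrix.of A').trace := by
  have h1 : HasDerivAt (fun s : ℝ => (Matrix.of (A + s • A')).det)
      (fderiv ℝ (fun A : Fin n → Fin n → ℝ => (Matrix.of A).det) A A') 0 := by
    have hl : HasDerivAt (fun s : ℝ => A + s • A') A' 0 := by
      simpa using ((hasDerivAt_id (0 : ℝ)).smul_const A').const_add A
    have hd := (differentiable_det n A).hasFDerivAt
    have hd' : HasFDerivAt (fun A : Fin n → Fin n → ℝ => (Matrix.of A).det)
      (fderiv ℝ (fun A : Fin n → Fin n → ℝ => (Matrix.of A).det) A) (A + (0 : ℝ) • A') := by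
      simpa using hd
    exact hd'.comp_hasDerivAt (0 : ℝ) hl
  set M := (Matrix.of A)⁻¹ * Matrix.of A' with hM
  -- Factor out `A` and use `det(1 + sM) = 1 + s tr M + s² P(s)` with a polynomial `P`.
  have h2 : (fun s : ℝ => (Matrix.of (A + s • A')).det)
      = fun s => (Matrix.of A).det * (1 + M.trace * s + (Polynomial.eval s
          (Matrix.det (1 + (Polynomial.X : Polynomial ℝ) • M.map Polynomial.C)).divX.divX) * s ^ 2) := by
    funext s
    rw [← Matrix.det_one_add_smul, ← Matrix.det_mul, hM, mul_add, mul_one, Matrix.mul_smul,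
      ← mul_assoc, Matrix.mul_nonsing_inv _ hA.isUnit, one_mul]
    rfl
  rw [h2] at h1
  refine h1.unique ?_
  set P := (Matrix.det (1 + (Polynomial.X : Polynomial ℝ) • M.map Polynomial.C)).divX.divX
  have h3 := (((hasDerivAt_id (0 : ℝ)).const_mul M.trace).const_add 1).add
    ((P.hasDerivAt 0).mul ((hasDerivAt_id (0 : ℝ)).pow 2))
  have h4 := h3.const_mul (Matrix.of A).det
  simpa using h4

variable {n : ℕ} {M : Type*} [TopologicalSpace M] [ChartedSpace (EuclideanSpace ℝ (Fin n)) M]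
  [IsManifold (𝓡 n) ∞ M]
  {c : ℝ} {g : RMetric n M} {x : M → Amb n} {q q' p : M} {u : EuclideanSpace ℝ (Fin n)}

theorem pd_sqrt_det_gram (hx : IsIsometricImmersion c g x)
    (hu : u ∈ (extChartAt (𝓡 n) q).target) (l : Fin n) :
    pd l (fun v => √(gram g q v).det) u = √(gram g q u).det *
      (2⁻¹ * ∑ i, ∑ j, (gram g q u)⁻¹ i j * pd l (fun w => gram g q w i j) u) := by
  have hd := gram_det_pos g hu
  have hA : DifferentiableAt ℝ (fun v => (fun i j => gram g q v i j : Fin n → Fin n → ℝ)) u :=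
    differentiableAt_pi.2 fun i => differentiableAt_pi.2 fun j =>
      (contDiffAt_gram hx hu i j).differentiableAt (by simp)
  have h1 : HasFDerivAt (fun v => (gram g q v).det) _ u :=
    HasFDerivAt.comp (f := fun v => (fun i j => gram g q v i j : Fin n → Fin n → ℝ))
      (g := fun A : Fin n → Fin n → ℝ => (Matrix.of A).det) u
      (differentiable_det n (fun i j => gram g q u i j)).hasFDerivAt hA.hasFDerivAt
  have h2 := h1.sqrt hd.ne'
  have h3 : ∀ i j, fderiv ℝ (fun v => (fun i j => gram g q v i j : Fin n → Fin n → ℝ)) u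
      (EuclideanSpace.single l 1) i j = pd l (fun w => gram g q w i j) u := fun i j => by
    have := (hasFDerivAt_pi'.1 ((hasFDerivAt_pi'.1 hA.hasFDerivAt) i) j).fderiv
    rw [pd, this]
    rfl
  rw [pd, h2.fderiv]
  simp only [_root_.smul_apply, ContinuousLinearMap.comp_apply, smul_eq_mul]
  rw [fderiv_det (A := fun i j => gram g q u i j) hd.ne']
  simp only [Matrix.trace, Matrix.diag_apply, Matrix.mul_apply, Matrix.of_apply, h3]
  have h4 : (Matrix.of fun i j => gram g q u i j) = gram g q u := rfl
  have h5 : ∀ i j, (fun w => gram g q w j i) = fun w => gram g q w i j := fun i j =>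
    funext fun w => gram_symm g j i
  have h6 : ∑ i, ∑ j, (gram g q u)⁻¹ i j * pd l (fun w => gram g q w j i) u
      = ∑ i, ∑ j, (gram g q u)⁻¹ i j * pd l (fun w => gram g q w i j) u :=
    Finset.sum_congr rfl fun i _ => Finset.sum_congr rfl fun j _ => by rw [h5 i j]
  rw [h4, h6]
  have hs := (Real.sqrt_pos.2 hd).ne'
  have hsq := Real.mul_self_sqrt hd.le
  field_simp
  linear_combination (-∑ i, ∑ j, (gram g q u)⁻¹ i j * pd l (fun w => gram g q w i j) u) * hsq

/-- The components of the gradient of `ψ` in the chart at `q`. -/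
def gradIn (g : RMetric n M) (ψ : M → ℝ) (q : M) (l : Fin n) (v : EuclideanSpace ℝ (Fin n)) : ℝ :=
  ∑ k, (gram g q v)⁻¹ l k * pd k (localRep q ψ) v

theorem contDiffAt_gradIn (hx : IsIsometricImmersion c g x) {ψ : M → ℝ}
    (hψ : ContMDiff (𝓡 n) 𝓘(ℝ, ℝ) ∞ ψ) (hu : u ∈ (extChartAt (𝓡 n) q).target) (l : Fin n) :
    ContDiffAt ℝ ∞ (gradIn g ψ q l) u :=
  ContDiffAt.sum fun k _ => (contDiffAt_gram_inv hx hu l k).mul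
    (contDiffAt_pd (contDiffAt_localRep hψ hu) k)

theorem pd_eq_sum_gradIn (g : RMetric n M) (ψ : M → ℝ)
    (hu : u ∈ (extChartAt (𝓡 n) q).target) (j : Fin n) :
    pd j (localRep q ψ) u = ∑ k, gram g q u j k * gradIn g ψ q k u := by
  simp only [gradIn, Finset.mul_sum]
  rw [Finset.sum_comm]
  simp_rw [← mul_assoc, ← Finset.sum_mul, ← Matrix.mul_apply, gram_mul_inv g hu]
  simp [Matrix.one_apply]

/-- Write `∂ⱼψ = gⱼₖVᵏ` with `V` the gradient. After tracing, the two Christoffel terms `½ ∂ᵢgⱼₗ Vˡ`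
and `½ ∂ⱼgᵢₗ Vˡ` are equal by symmetry and cancel the derivative of `gⱼₖ`; the third one remains and
is the logarithmic derivative of `√det g` along `V`. -/
theorem lapIn_eq_div (hx : IsIsometricImmersion c g x) {ψ : M → ℝ}
    (hψ : ContMDiff (𝓡 n) 𝓘(ℝ, ℝ) ∞ ψ) (hu : u ∈ (extChartAt (𝓡 n) q).target) :
    lapIn g ψ q u = ∑ i, pd i (gradIn g ψ q i) u + ∑ l, gradIn g ψ q l u *
      (2⁻¹ * ∑ i, ∑ j, (gram g q u)⁻¹ i j * pd l (fun w => gram g q w i j) u) := by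
  set G' := fun l i j => pd l (fun w => gram g q w i j) u with hG'
  set V := fun l => gradIn g ψ q l u with hV
  set I := fun i j => (gram g q u)⁻¹ i j with hI
  have h1 : ∀ i j, pd i (pd j (localRep q ψ)) u
      = ∑ k, (G' i j k * V k + gram g q u j k * pd i (gradIn g ψ q k) u) := fun i j => by
    have he : pd j (localRep q ψ) =ᶠ[nhds u] fun v => ∑ k, gram g q v j k * gradIn g ψ q k v := by
      filter_upwards [target_mem_nhds hu] with v hv using pd_eq_sum_gradIn g ψ hv j
    have hd := fun k => (contDiffAt_gram hx hu j k).differentiableAt (by simp)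
    have hd' := fun k => (contDiffAt_gradIn hx hψ hu k).differentiableAt (by simp)
    rw [pd_congr i he]
    refine (pd_sum (f := fun k v => gram g q v j k * gradIn g ψ q k v) _ i
      fun k _ => (hd k).mul (hd' k)).trans ?_
    exact Finset.sum_congr rfl fun k _ => pd_smul i (hd k) (hd' k)
  have h2 : ∀ i j, ∑ k, christoffel g q u i j k * pd k (localRep q ψ) u
      = ∑ l, 2⁻¹ * (G' i j l + G' j i l - G' l i j) * V l := fun i j => by
    simp only [christoffel, hV, gradIn, Finset.mul_sum, Finset.sum_mul]
    rw [Finset.sum_comm]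
    refine Finset.sum_congr rfl fun l _ => Finset.sum_congr rfl fun k _ => ?_
    rw [gram_inv_symm g k l]
    ring
  have h3 : ∀ i, ∑ j, I i j * ∑ k, gram g q u j k * pd i (gradIn g ψ q k) u
      = pd i (gradIn g ψ q i) u := fun i => by
    simp only [Finset.mul_sum]
    rw [Finset.sum_comm]
    simp_rw [← mul_assoc, ← Finset.sum_mul, hI, ← Matrix.mul_apply, gram_inv_mul g hu]
    simp [Matrix.one_apply]
  have h4 : ∑ i, ∑ j, I i j * ∑ k, G' i j k * V k = ∑ i, ∑ j, I i j * ∑ k, G' j i k * V k := by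
    rw [Finset.sum_comm]
    refine Finset.sum_congr rfl fun i _ => Finset.sum_congr rfl fun j _ => ?_
    simp only [hI]
    rw [gram_inv_symm g]
  have h5 : ∑ l, V l * (2⁻¹ * ∑ i, ∑ j, I i j * G' l i j)
      = 2⁻¹ * ∑ i, ∑ j, I i j * ∑ l, G' l i j * V l := by
    simp only [Finset.mul_sum]
    rw [Finset.sum_comm]
    refine Finset.sum_congr rfl fun i _ => ?_
    rw [Finset.sum_comm]
    refine Finset.sum_congr rfl fun j _ => Finset.sum_congr rfl fun l _ => ?_
    ring
  rw [h5]
  simp only [lapIn, smul_eq_mul, h1, h2]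
  have h6 : ∀ i j, I i j * (∑ k, (G' i j k * V k + gram g q u j k * pd i (gradIn g ψ q k) u)
      - ∑ l, 2⁻¹ * (G' i j l + G' j i l - G' l i j) * V l)
      = 2⁻¹ * (I i j * ∑ k, G' i j k * V k) - 2⁻¹ * (I i j * ∑ k, G' j i k * V k)
        + 2⁻¹ * (I i j * ∑ l, G' l i j * V l)
        + I i j * ∑ k, gram g q u j k * pd i (gradIn g ψ q k) u := fun i j => by
    have : ∑ l, 2⁻¹ * (G' i j l + G' j i l - G' l i j) * V l
        = 2⁻¹ * ((∑ l, G' i j l * V l) + (∑ l, G' j i l * V l) - ∑ l, G' l i j * V l) := by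
      rw [← Finset.sum_add_distrib, ← Finset.sum_sub_distrib, Finset.mul_sum]
      exact Finset.sum_congr rfl fun l _ => by ring
    rw [this, Finset.sum_add_distrib]
    ring
  refine (Finset.sum_congr rfl fun i _ => Finset.sum_congr rfl fun j _ => h6 i j).trans ?_
  simp only [Finset.sum_add_distrib, Finset.sum_sub_distrib, ← Finset.mul_sum]
  rw [h4, Finset.sum_congr rfl fun i _ => h3 i]
  ring

theorem sqrt_det_mul_lapIn (hx : IsIsometricImmersion c g x) {ψ : M → ℝ}
    (hψ : ContMDiff (𝓡 n) 𝓘(ℝ, ℝ) ∞ ψ) (hu : u ∈ (extChartAt (𝓡 n) q).target) :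
    √(gram g q u).det * lapIn g ψ q u
      = ∑ i, pd i (fun v => √(gram g q v).det * gradIn g ψ q i v) u := by
  have hs : DifferentiableAt ℝ (fun v => √(gram g q v).det) u :=
    ((contDiffAt_gram_det hx hu).differentiableAt (by simp)).sqrt (gram_det_pos g hu).ne'
  have h : ∀ i, pd i (fun v => √(gram g q v).det * gradIn g ψ q i v) u = _ := fun i =>
    pd_smul i hs ((contDiffAt_gradIn hx hψ hu i).differentiableAt (by simp))
  simp only [h, smul_eq_mul, pd_sqrt_det_gram hx hu, lapIn_eq_div hx hψ hu,
    Finset.sum_add_distrib, ← Finset.mul_sum, mul_add]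
  rw [add_comm]
  congr 1
  rw [Finset.mul_sum]
  refine Finset.sum_congr rfl fun i _ => ?_
  ring

/-- Integration by parts against the constant function `1`. -/
theorem integral_pd_eq_zero {f : EuclideanSpace ℝ (Fin n) → ℝ} (hf : ContDiff ℝ 1 f)
    (hs : HasCompactSupport f) (i : Fin n) : ∫ v, pd i f v = 0 := by
  have hc : Continuous (pd i f) :=
    (hf.continuous_fderiv (by simp)).clm_apply continuous_const
  have hs' : HasCompactSupport (pd i f) := hs.fderiv_apply ℝ _
  have hi : Integrable (fun v => fderiv ℝ f v (EuclideanSpace.single i 1)) :=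
    hc.integrable_of_hasCompactSupport hs'
  have h := integral_mul_fderiv_eq_neg_fderiv_mul_of_integrable (𝕜 := ℝ) (μ := volume)
    (f := fun _ : EuclideanSpace ℝ (Fin n) => (1 : ℝ)) (g := f)
    (v := EuclideanSpace.single i 1) (by simp) (by simpa using hi)
    (by simpa using hf.continuous.integrable_of_hasCompactSupport hs)
    (fun v _ => differentiableAt_const _) (fun v _ => hf.differentiable (by simp) v)
  simpa [pd] using h

variable [T2Space M] [CompactSpace M] [MeasurableSpace M] [BorelSpace M]

theorem integral_lap_of_tsupport_subset (hx : IsIsometricImmersion c g x) {ψ : M → ℝ}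
    (hψ : ContMDiff (𝓡 n) 𝓘(ℝ, ℝ) ∞ ψ) (hs : tsupport ψ ⊆ (extChartAt (𝓡 n) q).source) :
    ∫ p, lap g ψ p ∂(riemVol g) = 0 := by
  have hzero : ∀ p ∉ tsupport ψ, ψ =ᶠ[nhds p] fun _ => 0 := fun p hp =>
    notMem_tsupport_iff_eventuallyEq.1 hp
  rw [integral_riemVol_of_support hx q (contMDiff_lap hx hψ).continuous fun p hp => by
    rw [lap_congr (hzero p fun h => hp (hs h)), lap_const]]
  set U := (extChartAt (𝓡 n) q).target with hU
  set K := extChartAt (𝓡 n) q '' tsupport ψ with hK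
  have hKc : IsCompact K := (isClosed_tsupport ψ).isCompact.image_of_continuousOn
    ((continuousOn_extChartAt q).mono hs)
  have hKU : K ⊆ U := by
    rintro _ ⟨p, hp, rfl⟩
    exact (extChartAt (𝓡 n) q).map_source (hs hp)
  -- The vector field `√det g · grad ψ`, extended by zero. It vanishes off the compact image `K ⊆ U`
  -- of the support of `ψ`, so the extension is `C¹` with compact support on all of `ℝⁿ`.
  set Φ := fun i v => U.indicator (fun v => √(gram g q v).det * gradIn g ψ q i v) v with hΦ
  have hΦK : ∀ i, ∀ v ∉ K, Φ i v = 0 := fun i v hv => by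
    by_cases hvU : v ∈ U
    · have hv' : (extChartAt (𝓡 n) q).symm v ∉ tsupport ψ := fun h =>
        hv ⟨_, h, (extChartAt (𝓡 n) q).right_inv hvU⟩
      have hc : ContinuousAt (extChartAt (𝓡 n) q).symm v :=
        (continuousOn_extChartAt_symm q).continuousAt (target_mem_nhds hvU)
      have h0 : localRep q ψ =ᶠ[nhds v] fun _ => 0 := hc.eventually (hzero _ hv')
      have h1 : ∀ k, pd k (localRep q ψ) v = 0 := fun k => by rw [pd_congr k h0, pd_const]
      simp [hΦ, hvU, gradIn, h1]
    · simp [hΦ, hvU]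
  have hΦU : ∀ i, ∀ v ∈ U, Φ i =ᶠ[nhds v] fun v => √(gram g q v).det * gradIn g ψ q i v :=
    fun i v hv => by
      filter_upwards [target_mem_nhds hv] with w hw
      exact indicator_of_mem hw _
  have hΦd : ∀ i, ContDiff ℝ 1 (Φ i) := fun i => contDiff_iff_contDiffAt.2 fun v => by
    by_cases hv : v ∈ U
    · refine ContDiffAt.congr_of_eventuallyEq ?_ (hΦU i v hv)
      exact (((contDiffAt_gram_det hx hv).sqrt (gram_det_pos g hv).ne').mul
        (contDiffAt_gradIn hx hψ hv i)).of_le (by simp)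
    · have : Φ i =ᶠ[nhds v] fun _ => 0 := by
        filter_upwards [hKc.isClosed.isOpen_compl.mem_nhds fun h => hv (hKU h)] with w hw
        exact hΦK i w hw
      exact contDiffAt_const.congr_of_eventuallyEq this
  have hΦs : ∀ i, HasCompactSupport (Φ i) := fun i => HasCompactSupport.intro hKc (hΦK i)
  have hint : ∀ i, Integrable (pd i (Φ i)) := fun i => by
    have hc : Continuous (pd i (Φ i)) :=
      ((hΦd i).continuous_fderiv (by simp)).clm_apply continuous_const
    exact hc.integrable_of_hasCompactSupport ((hΦs i).fderiv_apply ℝ _)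
  have h1 : ∫ u in U, √(gram g q u).det * lap g ψ ((extChartAt (𝓡 n) q).symm u)
      = ∫ u in U, ∑ i, pd i (Φ i) u := by
    refine setIntegral_congr_fun (measurableSet_target q) fun v hv => ?_
    rw [lap_symm_apply hx hψ hv, sqrt_det_mul_lapIn hx hψ hv]
    exact Finset.sum_congr rfl fun i _ => (pd_congr i (hΦU i v hv)).symm
  have h2 : ∫ u in U, ∑ i, pd i (Φ i) u = ∫ u, ∑ i, pd i (Φ i) u := by
    refine setIntegral_eq_integral_of_forall_compl_eq_zero fun v hv => ?_
    refine Finset.sum_eq_zero fun i _ => ?_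
    have : Φ i =ᶠ[nhds v] fun _ => 0 := by
      filter_upwards [hKc.isClosed.isOpen_compl.mem_nhds fun h => hv (hKU h)] with w hw
      exact hΦK i w hw
    rw [pd_congr i this, pd_const]
  rw [h1, h2, integral_finsetSum _ fun i _ => hint i]
  exact Finset.sum_eq_zero fun i _ => integral_pd_eq_zero (hΦd i) (hΦs i) i

theorem integrable_of_continuous (hx : IsIsometricImmersion c g x) {F : M → ℝ}
    (hF : Continuous F) : Integrable F (riemVol g) := by
  have := isFiniteMeasure_riemVol hx
  exact hF.integrable_of_hasCompactSupport (HasCompactSupport.of_compactSpace F)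

/-- The divergence theorem on a closed manifold, for gradients. -/
theorem integral_lap_eq_zero (hx : IsIsometricImmersion c g x) {ψ : M → ℝ}
    (hψ : ContMDiff (𝓡 n) 𝓘(ℝ, ℝ) ∞ ψ) : ∫ p, lap g ψ p ∂(riemVol g) = 0 := by
  -- A partition of unity subordinate to chart domains reduces the claim to functions supported in
  -- one chart; by compactness only finitely many members are nonzero.
  obtain ⟨ρ, hρ⟩ := SmoothPartitionOfUnity.exists_isSubordinate_chartAt_source (I := 𝓡 n) M
  have hfin := ρ.locallyFinite.finite_nonempty_of_compact
  set s := hfin.toFinset with hs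
  have hψi : ∀ q, ContMDiff (𝓡 n) 𝓘(ℝ, ℝ) ∞ (fun p => ρ q p * ψ p) := fun q =>
    (ρ q).contMDiff.mul hψ
  have hsum : ∀ p, ψ p = ∑ q ∈ s, ρ q p * ψ p := fun p => by
    have h := ρ.sum_eq_one (mem_univ p)
    rw [finsum_eq_sum_of_support_subset (s := s) _ fun q hq => by
      simp only [hs, Finite.coe_toFinset]; exact ⟨p, hq⟩] at h
    rw [← Finset.sum_mul, h, one_mul]
  have hlap : ∀ p, lap g ψ p = ∑ q ∈ s, lap g (fun p => ρ q p * ψ p) p := fun p => by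
    have key : ∀ t : Finset M, lap g (fun p => ∑ q ∈ t, ρ q p * ψ p) p
        = ∑ q ∈ t, lap g (fun p => ρ q p * ψ p) p := fun t => by
      classical
      induction t using Finset.induction_on with
      | empty => simpa using lap_const (g := g) (p := p) (0 : ℝ)
      | insert a t ha ih =>
        simp only [Finset.sum_insert ha]
        rw [lap_add (hψi a) (contMDiff_finsetSum fun q _ => hψi q), ih]
    rw [← key s]
    exact congrArg (fun f => lap g f p) (funext hsum)
  simp only [hlap]
  rw [integral_finsetSum _ fun q _ =>
    integrable_of_continuous hx (contMDiff_lap hx (hψi q)).continuous]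
  refine Finset.sum_eq_zero fun q _ => integral_lap_of_tsupport_subset (q := q) hx (hψi q) ?_
  rw [extChartAt_source]
  refine (closure_mono ?_).trans (hρ q)
  exact Function.support_mul_subset_left _ _

end Divergence

/-! ### Gauss and Weingarten formulas: the Laplacian and tension field of `x` -/

section Hypersurface

/-- The factor `c` makes this uniform in `c`: for `c = 0` the position vector need not be
`metric`-orthogonal to tangent vectors, but such products then only occur multiplied by `c`. -/
theorem mul_metricL_eq_zero {n : ℕ} {c : ℝ} {v w : Amb n} (h : quadL n c v w = 0) :
    c * metricL n c v w = 0 := by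
  rcases eq_or_ne c 0 with hc | hc
  · simp [hc]
  · rw [← quadL_eq_mul_metricL hc, h]

theorem snd_ne_zero {n : ℕ} {y : Amb n} (hy : y ∈ spaceForm n 0) : y.2 ≠ 0 :=
  (hy.2 le_rfl).ne'

theorem snd_eq_zero_of_tangent {n : ℕ} {y v : Amb n} (hy : y ∈ spaceForm n 0)
    (h : quadL n 0 y v = 0) : v.2 = 0 := by
  rw [← quad_eq_quadL] at h
  simpa [quad, snd_ne_zero hy] using h

/-- For `c = 0` both sides vanish, because tangent vectors have last coordinate `0`. -/
theorem quadL_of_tangent {n : ℕ} {c : ℝ} {y v : Amb n} (hy : y ∈ spaceForm n c)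
    (h : quadL n c y v = 0) (w : Amb n) : quadL n c v w = c * metricL n c v w := by
  rcases eq_or_ne c 0 with rfl | hc
  · simp [← quad_eq_quadL, quad, snd_eq_zero_of_tangent hy h]
  · exact quadL_eq_mul_metricL hc _ _

theorem quadL_mul_metricL_eq_zero {n : ℕ} {c : ℝ} {y v w : Amb n} (hy : y ∈ spaceForm n c)
    (hv : quadL n c y v = 0) (hw : quadL n c y w = 0) (a : Amb n) :
    quadL n c a v * metricL n c y w = 0 := by
  rcases eq_or_ne c 0 with rfl | hc
  · simp [← quad_eq_quadL, quad, snd_eq_zero_of_tangent hy hv]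
  · rw [quadL_eq_mul_metricL hc, mul_eq_zero, or_iff_right hc] at hw
    rw [hw, mul_zero]

theorem quadL_self {n : ℕ} {c : ℝ} {y : Amb n} (hy : y ∈ spaceForm n c) : quadL n c y y = 1 := by
  rw [← quad_eq_quadL]; exact hy.1

variable {n : ℕ} {M : Type*} [TopologicalSpace M] [ChartedSpace (EuclideanSpace ℝ (Fin n)) M]
  [IsManifold (𝓡 n) ∞ M]
  {c : ℝ} {g : RMetric n M} {x N : M → Amb n} {q q' p : M} {u : EuclideanSpace ℝ (Fin n)}

theorem localRep_self {W : Type*} (f : M → W) (p : M) :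
    localRep p f (extChartAt (𝓡 n) p p) = f p := by
  simp only [localRep, extChartAt_to_inv]

theorem quadL_pd_eq_zero {f : M → Amb n} (hf : ContMDiff (𝓡 n) 𝓘(ℝ, Amb n) ∞ f)
    (hm : ∀ p, f p ∈ spaceForm n c) (hu : u ∈ (extChartAt (𝓡 n) q).target) (i : Fin n) :
    quadL n c (localRep q f u) (pd i (localRep q f) u) = 0 := by
  have h1 : (fun v : EuclideanSpace ℝ (Fin n) => quadL n c (localRep q f v) (localRep q f v))
      = fun _ => 1 := funext fun v => quadL_self (hm _)
  have hd := differentiableAt_localRep hf hu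
  have h2 := pd_bilin (quadL n c) i hd hd
  rw [h1, pd_const, quadL_comm c (pd i _ u)] at h2
  linarith

/-- The Christoffel terms are already tangent to the space form, so projecting only the second
derivatives amounts to projecting the whole Laplacian. -/
theorem tension_eq {f : M → Amb n} (hf : ContMDiff (𝓡 n) 𝓘(ℝ, Amb n) ∞ f)
    (hm : ∀ p, f p ∈ spaceForm n c) (p : M) :
    tension c g f p = lap g f p - quadL n c (f p) (lap g f p) • f p := by
  have hu := mem_extChartAt_target (I := 𝓡 n) p
  have h0 : ∀ k, quadL n c (f p) (pd k (localRep p f) (extChartAt (𝓡 n) p p)) = 0 := fun k => by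
    have := quadL_pd_eq_zero hf hm hu k
    rwa [localRep_self] at this
  simp only [tension, hessMap, tangentProj, lap, lapIn, localRep_self, quad_eq_quadL, map_sum,
    map_smul, map_sub, h0, smul_zero, Finset.sum_const_zero, sub_zero, Finset.sum_smul,
    ← Finset.sum_sub_distrib]
  refine Finset.sum_congr rfl fun i _ => Finset.sum_congr rfl fun j _ => ?_
  rw [smul_assoc, ← smul_sub]
  congr 1
  abel

theorem tangentSpace_pd (hx : IsIsometricImmersion c g x) (p : M) (i : Fin n) :
    quadL n c (x p) (pd i (localRep p x) (extChartAt (𝓡 n) p p)) = 0 := by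
  have := quadL_pd_eq_zero hx.smooth hx.mem (mem_extChartAt_target (I := 𝓡 n) p) i
  rwa [localRep_self] at this

theorem traceForm_quadL_self (hx : IsIsometricImmersion c g x) (p : M) :
    traceForm g (quadL n c) x x p = n * c := by
  rw [← traceForm_self (g := g) (p := p) hx]
  simp only [traceForm, traceIn, Finset.sum_mul]
  refine Finset.sum_congr rfl fun i _ => Finset.sum_congr rfl fun j _ => ?_
  rw [quadL_of_tangent (hx.mem p) (tangentSpace_pd hx p i)]
  simp only [smul_eq_mul]
  ring

/-- Take the Laplacian of `quad(x, x) = 1`. -/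
theorem quadL_lap_self (hx : IsIsometricImmersion c g x) (p : M) :
    quadL n c (x p) (lap g x p) = -(n * c) := by
  have h1 : (fun p => quadL n c (x p) (x p)) = fun _ => 1 := funext fun p => quadL_self (hx.mem p)
  have h2 := lap_bilin (g := g) (p := p) (quadL n c) hx.smooth hx.smooth
  rw [h1, lap_const, traceForm_quadL_self hx, quadL_comm c (lap g x p)] at h2
  simp only [smul_eq_mul] at h2
  linarith

/-- The Christoffel symbols remove precisely the tangential components of `∂ᵢ∂ⱼx`. -/
theorem metricL_lap_pd (hx : IsIsometricImmersion c g x) (p : M) (k : Fin n) :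
    metricL n c (lap g x p) (pd k (localRep p x) (extChartAt (𝓡 n) p p)) = 0 := by
  have hu := mem_extChartAt_target (I := 𝓡 n) p
  simp only [lap, lapIn, map_sum, map_smul, map_sub, _root_.sum_apply, _root_.smul_apply,
    _root_.sub_apply, smul_eq_mul]
  refine Finset.sum_eq_zero fun i _ => Finset.sum_eq_zero fun j _ => ?_
  rw [mul_eq_zero]
  right
  rw [sub_eq_zero]
  simp only [christoffel_eq hx hu, ← gram_eq hx hu, Finset.sum_mul]
  rw [Finset.sum_comm]
  have h : ∀ l, ∑ k', (gram g p (extChartAt (𝓡 n) p p))⁻¹ k' l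
      * metricL n c (pd i (pd j (localRep p x)) (extChartAt (𝓡 n) p p))
        (pd l (localRep p x) (extChartAt (𝓡 n) p p)) * gram g p (extChartAt (𝓡 n) p p) k' k
      = metricL n c (pd i (pd j (localRep p x)) (extChartAt (𝓡 n) p p))
        (pd l (localRep p x) (extChartAt (𝓡 n) p p)) * (1 : Matrix (Fin n) (Fin n) ℝ) l k := by
    intro l
    rw [← gram_inv_mul g hu, Matrix.mul_apply, Finset.mul_sum]
    refine Finset.sum_congr rfl fun k' _ => ?_
    rw [gram_inv_symm g k' l]
    ring
  rw [Finset.sum_congr rfl fun l _ => h l]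
  simp [Matrix.one_apply]

theorem quadL_normal (hN : IsUnitNormal c x N) (p : M) : quadL n c (x p) (N p) = 0 := by
  rw [← quad_eq_quadL]; exact hN.tangent p

theorem metricL_normal_self (hN : IsUnitNormal c x N) (p : M) : metricL n c (N p) (N p) = 1 := by
  rw [← metric_eq_metricL]; exact hN.unit p

theorem metricL_normal_pd (hx : IsIsometricImmersion c g x) (hN : IsUnitNormal c x N)
    (hu : u ∈ (extChartAt (𝓡 n) q).target) (i : Fin n) :
    metricL n c (localRep q N u) (pd i (localRep q x) u) = 0 := by
  rw [← metric_eq_metricL, pd_localRep hx.smooth hu]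
  exact hN.normal _ _

theorem metricL_normal_pd_self (hx : IsIsometricImmersion c g x) (hN : IsUnitNormal c x N)
    (p : M) (i : Fin n) :
    metricL n c (N p) (pd i (localRep p x) (extChartAt (𝓡 n) p p)) = 0 := by
  have := metricL_normal_pd hx hN (mem_extChartAt_target (I := 𝓡 n) p) i
  rwa [localRep_self] at this

/-- Differentiate `⟨N, ∂ⱼx⟩ = 0` in direction `i` and take the trace. -/
theorem metricL_lap_normal (hx : IsIsometricImmersion c g x) (hN : IsUnitNormal c x N) (p : M) :
    metricL n c (lap g x p) (N p) = -traceForm g (metricL n c) N x p := by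
  have hu := mem_extChartAt_target (I := 𝓡 n) p
  have h : ∀ i j, metricL n c (pd i (pd j (localRep p x)) (extChartAt (𝓡 n) p p)) (N p)
      = -metricL n c (pd i (localRep p N) (extChartAt (𝓡 n) p p))
        (pd j (localRep p x) (extChartAt (𝓡 n) p p)) := fun i j => by
    have h0 : (fun v => metricL n c (localRep p N v) (pd j (localRep p x) v))
        =ᶠ[nhds (extChartAt (𝓡 n) p p)] fun _ => 0 := by
      filter_upwards [target_mem_nhds hu] with v hv using metricL_normal_pd hx hN hv j
    have h1 := pd_bilin (metricL n c) i (differentiableAt_localRep hN.smooth hu)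
      (differentiableAt_pd (contDiffAt_localRep hx.smooth hu) j)
    rw [pd_congr i h0, pd_const, localRep_self, metricL_comm c (N p)] at h1
    linarith
  have h2 : ∀ k, metricL n c (pd k (localRep p x) (extChartAt (𝓡 n) p p)) (N p) = 0 := fun k => by
    rw [metricL_comm]; exact metricL_normal_pd_self hx hN p k
  simp only [lap, lapIn, traceForm, traceIn, map_sum, map_smul, map_sub, _root_.sum_apply,
    _root_.smul_apply, _root_.sub_apply, h, h2, smul_eq_mul, mul_zero, Finset.sum_const_zero,
    sub_zero, mul_neg, Finset.sum_neg_distrib]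

theorem quadL_pd_normal_eq_zero (hx : IsIsometricImmersion (0 : ℝ) g x)
    (hN : IsUnitNormal (0 : ℝ) x N) (p : M) (i : Fin n) :
    quadL n 0 (x p) (pd i (localRep p N) (extChartAt (𝓡 n) p p)) = 0 := by
  have hu := mem_extChartAt_target (I := 𝓡 n) p
  have h0 : (fun v : EuclideanSpace ℝ (Fin n) => ContinuousLinearMap.snd ℝ (EuclideanSpace ℝ (Fin (n + 1))) ℝ
      (localRep p N v)) = fun _ => 0 :=
    funext fun v => snd_eq_zero_of_tangent (hx.mem _) (quadL_normal hN _)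
  have h1 := pd_clm (ContinuousLinearMap.snd ℝ (EuclideanSpace ℝ (Fin (n + 1))) ℝ) i
    (differentiableAt_localRep hN.smooth hu)
  rw [h0, pd_const] at h1
  rw [← quad_eq_quadL, quad]
  simp only [ContinuousLinearMap.coe_snd'] at h1
  rw [← h1]
  simp

/-- The projection in `weingartenForm` can be dropped: for `c ≠ 0` the removed multiple of `x` is
orthogonal to `dx`, and for `c = 0` nothing is removed since `∂ᵢN` has last coordinate `0`. -/
theorem meanCurv_eq (hx : IsIsometricImmersion c g x) (hN : IsUnitNormal c x N) (p : M) :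
    meanCurv c g x N p = -((n : ℝ)⁻¹ * traceForm g (metricL n c) N x p) := by
  have key : ∀ i j, weingartenForm c x N p i j
      = -metricL n c (pd i (localRep p N) (extChartAt (𝓡 n) p p))
        (pd j (localRep p x) (extChartAt (𝓡 n) p p)) := fun i j => by
    have h : quadL n c (x p) (pd i (localRep p N) (extChartAt (𝓡 n) p p))
        * metricL n c (x p) (pd j (localRep p x) (extChartAt (𝓡 n) p p)) = 0 := by
      rcases eq_or_ne c 0 with rfl | hc
      · rw [quadL_pd_normal_eq_zero hx hN p i, zero_mul]
      · have := tangentSpace_pd hx p j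
        rw [quadL_eq_mul_metricL hc, mul_eq_zero, or_iff_right hc] at this
        rw [this, mul_zero]
    simp only [weingartenForm, tangentProj, metric_eq_metricL, quad_eq_quadL, map_neg, map_sub,
      map_smul, _root_.neg_apply, _root_.sub_apply, _root_.smul_apply, smul_eq_mul, h, sub_zero]
  simp only [meanCurv, key, traceForm, traceIn, smul_eq_mul, mul_neg, Finset.sum_neg_distrib]

theorem contMDiff_meanCurv (hx : IsIsometricImmersion c g x) (hN : IsUnitNormal c x N) :
    ContMDiff (𝓡 n) 𝓘(ℝ, ℝ) ∞ (meanCurv c g x N) := by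
  have h : meanCurv c g x N = fun p => (-(n : ℝ)⁻¹) * traceForm g (metricL n c) N x p :=
    funext fun p => by rw [meanCurv_eq hx hN]; ring
  rw [h]
  exact contMDiff_const.mul (contMDiff_traceForm hx _ hN.smooth hx.smooth)

/-- The `n + 2` vectors `x p`, `N p`, `∂ᵢx` form a basis of the ambient space, and the three
conditions kill the coefficients in this order. Testing with `quad` against `x p` and with `metric`
against the rest covers indefinite (`c < 0`) and degenerate (`c = 0`) forms too. -/
theorem eq_zero_of_orthogonal_frame (hx : IsIsometricImmersion c g x) (hN : IsUnitNormal c x N)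
    (p : M) {v : Amb n} (h1 : quadL n c (x p) v = 0) (h2 : metricL n c v (N p) = 0)
    (h3 : ∀ k, metricL n c v (pd k (localRep p x) (extChartAt (𝓡 n) p p)) = 0) : v = 0 := by
  have hu := mem_extChartAt_target (I := 𝓡 n) p
  set X := fun k => pd k (localRep p x) (extChartAt (𝓡 n) p p) with hX
  have hgram : ∀ a : Fin n → ℝ, (∀ k, metricL n c (∑ i, a i • X i) (X k) = 0) → a = 0 := by
    intro a ha
    by_contra hne
    have hpos := (gram_posDef g hu).dotProduct_mulVec_pos hne
    refine hpos.ne' ?_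
    simp only [dotProduct, Matrix.mulVec, star_trivial]
    refine Finset.sum_eq_zero fun k _ => ?_
    have : ∑ i, gram g p (extChartAt (𝓡 n) p p) k i * a i = 0 := by
      rw [← ha k]
      simp only [map_sum, map_smul, _root_.sum_apply, _root_.smul_apply, smul_eq_mul]
      refine Finset.sum_congr rfl fun i _ => ?_
      rw [gram_symm g k i, gram_eq hx hu]
      ring
    rw [this, mul_zero]
  let e : Option (Option (Fin n)) → Amb n
    | none => x p
    | some none => N p
    | some (some i) => X i
  have hcomb : ∀ a : Option (Option (Fin n)) → ℝ, ∑ o, a o • e o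
      = a none • x p + (a (some none) • N p + ∑ i, a (some (some i)) • X i) := fun a => by
    rw [Fintype.sum_option, Fintype.sum_option]
  have hqX : ∀ k, quadL n c (x p) (X k) = 0 := fun k => tangentSpace_pd hx p k
  have hNX : ∀ k, metricL n c (N p) (X k) = 0 := fun k => metricL_normal_pd_self hx hN p k
  have hcoef : ∀ a : Option (Option (Fin n)) → ℝ,
      quadL n c (x p) (∑ o, a o • e o) = 0 → metricL n c (∑ o, a o • e o) (N p) = 0 →
      (∀ k, metricL n c (∑ o, a o • e o) (X k) = 0) → a = 0 := by
    intro a ha1 ha2 ha3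
    rw [hcomb] at ha1 ha2
    have a1 : a none = 0 := by
      simpa [quadL_self (hx.mem p), quadL_normal hN, hqX] using ha1
    have hXN : ∀ k, metricL n c (X k) (N p) = 0 := fun k => by rw [metricL_comm]; exact hNX k
    have a2 : a (some none) = 0 := by
      simpa [a1, metricL_normal_self hN, hXN] using ha2
    have a3 : (fun i => a (some (some i))) = 0 := hgram _ fun k => by
      have := ha3 k
      rw [hcomb, a1, a2] at this
      simpa using this
    funext o
    rcases o with _ | _ | i
    · exact a1
    · exact a2
    · exact congrFun a3 i
  have hli : LinearIndependent ℝ e := by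
    rw [Fintype.linearIndependent_iff]
    intro a ha
    have := hcoef a (by simp [ha]) (by simp [ha]) (by simp [ha])
    exact congrFun this
  have hcard : Fintype.card (Option (Option (Fin n))) = Module.finrank ℝ (Amb n) := by
    simp
  have hspan := hli.span_eq_top_of_card_eq_finrank' hcard
  have hv : v ∈ Submodule.span ℝ (range e) := by rw [hspan]; trivial
  obtain ⟨a, rfl⟩ := (Submodule.mem_span_range_iff_exists_fun ℝ).1 hv
  rw [hcoef a h1 h2 h3]
  simp

theorem lap_immersion (hn : 1 ≤ n) (hx : IsIsometricImmersion c g x) (hN : IsUnitNormal c x N)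
    (p : M) :
    lap g x p = (n * meanCurv c g x N p) • N p - (n * c) • x p := by
  have hn' : (n : ℝ) ≠ 0 := by positivity
  have hH : (n : ℝ) * meanCurv c g x N p = -traceForm g (metricL n c) N x p := by
    rw [meanCurv_eq hx hN]; field_simp
  rw [← sub_eq_zero]
  refine eq_zero_of_orthogonal_frame hx hN p ?_ ?_ fun k => ?_
  · simp [quadL_lap_self hx, quadL_normal hN, quadL_self (hx.mem p)]
  · have h := mul_metricL_eq_zero (quadL_normal hN p)
    simp only [map_sub, map_smul, _root_.sub_apply, _root_.smul_apply, smul_eq_mul,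
      metricL_lap_normal hx hN, metricL_normal_self hN, hH]
    linear_combination (n : ℝ) * h
  · have h := mul_metricL_eq_zero (tangentSpace_pd hx p k)
    simp only [map_sub, map_smul, _root_.sub_apply, _root_.smul_apply, smul_eq_mul,
      metricL_lap_pd hx, metricL_normal_pd_self hx hN]
    linear_combination (n : ℝ) * h

theorem tension_immersion (hn : 1 ≤ n) (hx : IsIsometricImmersion c g x)
    (hN : IsUnitNormal c x N) (p : M) :
    tension c g x p = (n * meanCurv c g x N p) • N p := by
  rw [tension_eq hx.smooth hx.mem, quadL_lap_self hx, lap_immersion hn hx hN]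
  module

end Hypersurface

/-! ### Differentiation under the integral sign -/

section ParametricIntegral

/-- The integrand depends on the point only through the continuous map `k`, so compactness of `M`
gives one time interval and one bound on the derivative for all points. -/
theorem hasDerivAt_integral_comp_of_contDiffAt {M V : Type*} [TopologicalSpace M] [CompactSpace M]
    [MeasurableSpace M] [BorelSpace M] [NormedAddCommGroup V] [NormedSpace ℝ V]
    {μ : Measure M} [IsFiniteMeasure μ] {k : M → V} (hk : Continuous k) {Φ : ℝ × V → ℝ}
    {D : M → ℝ} (hΦ : ∀ p, ContDiffAt ℝ ∞ Φ (0, k p))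
    (hD : ∀ p, HasDerivAt (fun t => Φ (t, k p)) (D p) 0) :
    HasDerivAt (fun t => ∫ p, Φ (t, k p) ∂μ) (∫ p, D p ∂μ) 0 := by
  have h1 : ∀ p, ∀ᶠ z in nhds ((0 : ℝ), k p), ContDiffAt ℝ 1 Φ z := fun p =>
    ((hΦ p).of_le (by simp)).eventually (by simp)
  set Ω := {z : ℝ × V | ContDiffAt ℝ 1 Φ z} with hΩ
  have h2 : ∀ᶠ t in nhds (0 : ℝ), ∀ p : M, (t, k p) ∈ interior Ω := by
    have : ∀ p ∈ (univ : Set M), ∀ᶠ z : ℝ × M in nhds ((0 : ℝ), p), (z.1, k z.2) ∈ interior Ω := by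
      intro p _
      have hc : ContinuousAt (fun z : ℝ × M => (z.1, k z.2)) (0, p) := by fun_prop
      exact hc.preimage_mem_nhds (isOpen_interior.mem_nhds (mem_interior_iff_mem_nhds.2 (h1 p)))
    have h3 := isCompact_univ.eventually_forall_of_forall_eventually (x₀ := (0 : ℝ))
      (P := fun t p => (t, k p) ∈ interior Ω) this
    simpa using h3
  obtain ⟨δ, hδ, hball⟩ := Metric.nhds_basis_closedBall.mem_iff.1 h2
  have hmem : ∀ t ∈ Metric.closedBall (0 : ℝ) δ, ∀ p, ContDiffAt ℝ 1 Φ (t, k p) :=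
    fun t ht p => interior_subset (hball ht p)
  set F' := fun (t : ℝ) (p : M) => fderiv ℝ Φ (t, k p) (1, 0) with hF'
  have hcont : ContinuousOn (fun z : ℝ × M => F' z.1 z.2)
      (Metric.closedBall (0 : ℝ) δ ×ˢ univ) := by
    intro z hz
    have h4 : ContinuousAt (fderiv ℝ Φ) (z.1, k z.2) :=
      (hmem z.1 hz.1 z.2).continuousAt_fderiv (by simp)
    have h5 : ContinuousAt (fun z : ℝ × M => fderiv ℝ Φ (z.1, k z.2)) z :=
      ContinuousAt.comp (f := fun z : ℝ × M => (z.1, k z.2)) h4 (by fun_prop)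
    exact (h5.clm_apply continuousAt_const).continuousWithinAt
  obtain ⟨C, hC⟩ := ((isCompact_closedBall (0 : ℝ) δ).prod isCompact_univ).exists_bound_of_continuousOn
    hcont
  have hder : ∀ t ∈ Metric.closedBall (0 : ℝ) δ, ∀ p,
      HasDerivAt (fun t => Φ (t, k p)) (F' t p) t := fun t ht p => by
    have h4 := ((hmem t ht p).differentiableAt (by simp)).hasFDerivAt
    exact h4.comp_hasDerivAt t ((hasDerivAt_id t).prodMk (hasDerivAt_const t (k p)))
  have hFc : ∀ t ∈ Metric.closedBall (0 : ℝ) δ, Continuous fun p => Φ (t, k p) := fun t ht =>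
    continuous_iff_continuousAt.2 fun p =>
      ContinuousAt.comp (f := fun p => (t, k p)) (hmem t ht p).continuousAt (by fun_prop)
  have h0 : (0 : ℝ) ∈ Metric.closedBall (0 : ℝ) δ := Metric.mem_closedBall_self hδ.le
  have hF'c : Continuous (F' 0) := by
    have : ContinuousOn (fun p : M => F' 0 p) univ :=
      hcont.comp (f := fun p : M => ((0 : ℝ), p)) (by fun_prop) fun p _ => ⟨h0, mem_univ p⟩
    exact continuousOn_univ.1 this
  have hDF : D = F' 0 := funext fun p => (hD p).unique (hder 0 h0 p)
  rw [hDF]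
  refine (hasDerivAt_integral_of_dominated_loc_of_deriv_le (bound := fun _ => C)
    (Metric.closedBall_mem_nhds (0 : ℝ) hδ) ?_ ?_ ?_ ?_ (integrable_const C) ?_).2
  · filter_upwards [Metric.closedBall_mem_nhds (0 : ℝ) hδ] with t ht
    exact (hFc t ht).aestronglyMeasurable
  · exact (hFc 0 h0).integrable_of_hasCompactSupport (HasCompactSupport.of_compactSpace _)
  · exact hF'c.aestronglyMeasurable
  · exact Filter.Eventually.of_forall fun p t ht => hC (t, p) ⟨ht, mem_univ p⟩
  · exact Filter.Eventually.of_forall fun p t ht => hder t ht p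

end ParametricIntegral

/-! ### Radial projections and their tension fields -/

section Variation

variable {n : ℕ} {M : Type*} [TopologicalSpace M] [ChartedSpace (EuclideanSpace ℝ (Fin n)) M]
  [IsManifold (𝓡 n) ∞ M]
  {c : ℝ} {g : RMetric n M} {x N Z : M → Amb n} {q q' p : M} {u : EuclideanSpace ℝ (Fin n)}
  {W W₁ W₂ : Type*} [NormedAddCommGroup W] [NormedSpace ℝ W] [NormedAddCommGroup W₁]
  [NormedSpace ℝ W₁] [NormedAddCommGroup W₂] [NormedSpace ℝ W₂]

theorem traceForm_comp_left (B : ℝ →L[ℝ] W₁ →L[ℝ] W₂) {φ : ℝ → ℝ} {φ' : ℝ} {f : M → ℝ}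
    (h : M → W₁) (hf : ContMDiff (𝓡 n) 𝓘(ℝ, ℝ) ∞ f) (hφ : HasDerivAt φ φ' (f p)) :
    traceForm g B (fun p => φ (f p)) h p = φ' • traceForm g B f h p := by
  have hu := mem_extChartAt_target (I := 𝓡 n) p
  have key : ∀ i, pd i (localRep p fun p => φ (f p)) (extChartAt (𝓡 n) p p)
      = φ' • pd i (localRep p f) (extChartAt (𝓡 n) p p) := fun i => by
    have hφ' : HasDerivAt φ φ' (localRep p f (extChartAt (𝓡 n) p p)) := by
      rwa [localRep_self]
    have := (hφ'.comp_hasFDerivAt _ (differentiableAt_localRep hf hu).hasFDerivAt).fderiv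
    simp only [pd]
    erw [this]
    rfl
  simp only [traceForm, traceIn, key, map_smul, _root_.smul_apply, Finset.smul_sum]
  refine Finset.sum_congr rfl fun i _ => Finset.sum_congr rfl fun j _ => ?_
  rw [smul_comm]

theorem traceForm_add_right (B : W →L[ℝ] W₁ →L[ℝ] W₂) (f : M → W) {h h' : M → W₁}
    (hh : ContMDiff (𝓡 n) 𝓘(ℝ, W₁) ∞ h) (hh' : ContMDiff (𝓡 n) 𝓘(ℝ, W₁) ∞ h') :
    traceForm g B f (fun p => h p + h' p) p = traceForm g B f h p + traceForm g B f h' p := by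
  simp only [← traceForm_flip B]
  exact traceForm_add_left _ _ hh hh'

theorem traceForm_smul_left (B : W →L[ℝ] W₁ →L[ℝ] W₂) (t : ℝ) {f : M → W} (h : M → W₁)
    (hf : ContMDiff (𝓡 n) 𝓘(ℝ, W) ∞ f) :
    traceForm g B (fun p => t • f p) h p = t • traceForm g B f h p := by
  have := traceForm_clm_left (g := g) (p := p) B (t • ContinuousLinearMap.id ℝ W) h hf
  simp only [_root_.smul_apply, ContinuousLinearMap.id_apply] at this
  rw [this]
  simp only [traceForm, traceIn, ContinuousLinearMap.comp_apply, _root_.smul_apply,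
    ContinuousLinearMap.id_apply, map_smul, Finset.smul_sum]
  refine Finset.sum_congr rfl fun i _ => Finset.sum_congr rfl fun j _ => ?_
  rw [smul_comm]

theorem traceForm_smul_right (B : W →L[ℝ] W₁ →L[ℝ] W₂) (t : ℝ) (f : M → W) {h : M → W₁}
    (hh : ContMDiff (𝓡 n) 𝓘(ℝ, W₁) ∞ h) :
    traceForm g B f (fun p => t • h p) p = t • traceForm g B f h p := by
  simp only [← traceForm_flip B]
  exact traceForm_smul_left _ t _ hh

theorem contMDiff_bilin (B : W →L[ℝ] W₁ →L[ℝ] W₂) {f : M → W} {h : M → W₁}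
    (hf : ContMDiff (𝓡 n) 𝓘(ℝ, W) ∞ f) (hh : ContMDiff (𝓡 n) 𝓘(ℝ, W₁) ∞ h) :
    ContMDiff (𝓡 n) 𝓘(ℝ, W₂) ∞ (fun p => B (f p) (h p)) :=
  (B.contMDiff.comp hf).clm_apply hh

/-- The radial projection of a map into the space form. -/
def radial (c : ℝ) (Y : M → Amb n) (p : M) : Amb n :=
  (√(quadL n c (Y p) (Y p)))⁻¹ • Y p

theorem radial_quadL {Y : M → Amb n} (hQ : 0 < quadL n c (Y p) (Y p)) :
    quadL n c (radial c Y p) (radial c Y p) = 1 := by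
  have h := Real.mul_self_sqrt hQ.le
  have h' := (Real.sqrt_pos.2 hQ).ne'
  simp only [radial, map_smul, _root_.smul_apply, smul_eq_mul]
  field_simp
  linarith

theorem radial_mem {Y : M → Amb n} (hQ : 0 < quadL n c (Y p) (Y p)) (hY : c ≤ 0 → 0 < (Y p).2) :
    radial c Y p ∈ spaceForm n c := by
  refine ⟨?_, fun hc => ?_⟩
  · rw [quad_eq_quadL]; exact radial_quadL hQ
  · exact mul_pos (inv_pos.2 (Real.sqrt_pos.2 hQ)) (hY hc)

theorem contMDiff_radial {Y : M → Amb n} (hY : ContMDiff (𝓡 n) 𝓘(ℝ, Amb n) ∞ Y)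
    (hQ : ∀ p, 0 < quadL n c (Y p) (Y p)) : ContMDiff (𝓡 n) 𝓘(ℝ, Amb n) ∞ (radial c Y) := by
  intro p
  have h : ContDiffAt ℝ ∞ (fun y : Amb n => (√(quadL n c y y))⁻¹ • y) (Y p) := by
    have hq : ContDiffAt ℝ ∞ (fun y : Amb n => quadL n c y y) (Y p) :=
      (((quadL n c).contDiff).clm_apply contDiff_id).contDiffAt
    exact ((hq.sqrt (hQ p).ne').inv (Real.sqrt_pos.2 (hQ p)).ne').smul contDiffAt_id
  exact h.contMDiffAt.comp p (hY p)

/-- The tension field of a radial projection, up to the factor `(√(quad c Y Y))⁻¹`. -/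
def radialTension (n : ℕ) (c : ℝ) (Y L D : Amb n) : Amb n :=
  (L - (quadL n c Y Y)⁻¹ • D)
    - ((quadL n c Y Y)⁻¹ * quadL n c Y (L - (quadL n c Y Y)⁻¹ • D)) • Y

/-- With `Q = quad(Y, Y)` and `h = Q^(-1/2)`, `Δ(hY) = h ΔY + 2⟨dh, dY⟩ + (Δh) Y`. Here `2 dh =
-Q^(-3/2) dQ`, and the unknown term `(Δh) Y` is radial, so the tangential projection removes it. -/
theorem tension_radial {Y : M → Amb n} (hY : ContMDiff (𝓡 n) 𝓘(ℝ, Amb n) ∞ Y)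
    (hQ : ∀ p, 0 < quadL n c (Y p) (Y p)) (hY0 : c ≤ 0 → ∀ p, 0 < (Y p).2) (p : M) :
    tension c g (radial c Y) p = (√(quadL n c (Y p) (Y p)))⁻¹ •
      radialTension n c (Y p) (lap g Y p) (traceForm g (ContinuousLinearMap.lsmul ℝ ℝ)
        (fun p => quadL n c (Y p) (Y p)) Y p) := by
  have hQs : ContMDiff (𝓡 n) 𝓘(ℝ, ℝ) ∞ (fun p => quadL n c (Y p) (Y p)) := contMDiff_bilin _ hY hY
  have hpos := hQ p
  set h : M → ℝ := fun p => (√(quadL n c (Y p) (Y p)))⁻¹ with hh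
  have hhs : ContMDiff (𝓡 n) 𝓘(ℝ, ℝ) ∞ h := fun p => by
    have : ContDiffAt ℝ ∞ (fun r : ℝ => (√r)⁻¹) (quadL n c (Y p) (Y p)) :=
      (contDiffAt_id.sqrt (hQ p).ne').inv (Real.sqrt_pos.2 (hQ p)).ne'
    exact ContMDiffAt.comp (g := fun r : ℝ => (√r)⁻¹)
      (f := fun p => quadL n c (Y p) (Y p)) p this.contMDiffAt (hQs p)
  rw [tension_eq (contMDiff_radial hY hQ) (fun p => radial_mem (hQ p) fun hc => hY0 hc p)]
  have hr : radial c Y = fun p => ContinuousLinearMap.lsmul ℝ ℝ (h p) (Y p) := rfl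
  have hlap := lap_bilin (g := g) (p := p) (ContinuousLinearMap.lsmul ℝ ℝ) hhs hY
  set Q := quadL n c (Y p) (Y p) with hQd
  set s := √Q with hs
  have hs0 : 0 < s := Real.sqrt_pos.2 hpos
  have hss : Q = s ^ 2 := (Real.sq_sqrt hpos.le).symm
  have hder : HasDerivAt (fun r : ℝ => (√r)⁻¹) (-(1 / (2 * s)) / s ^ 2) Q :=
    (Real.hasDerivAt_sqrt hpos.ne').inv hs0.ne'
  have htr := traceForm_comp_left (g := g) (p := p) (ContinuousLinearMap.lsmul ℝ ℝ)
    (φ := fun r => (√r)⁻¹) (f := fun p => quadL n c (Y p) (Y p)) Y hQs hder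
  change traceForm g (ContinuousLinearMap.lsmul ℝ ℝ) h Y p = _ at htr
  rw [htr] at hlap
  set D := traceForm g (ContinuousLinearMap.lsmul ℝ ℝ) (fun p => quadL n c (Y p) (Y p)) Y p
  rw [hr, hlap]
  have hhp : h p = s⁻¹ := rfl
  simp only [ContinuousLinearMap.lsmul_apply, radialTension, hhp]
  set a := quadL n c (Y p) (lap g Y p) with ha
  set b := quadL n c (Y p) D with hb
  set l := lap g h p
  simp only [map_add, map_sub, map_smul, _root_.smul_apply, smul_eq_mul, ← ha, ← hb, ← hQd]
  rw [hss]
  match_scalars <;> field_simp <;> ring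

end Variation

/-! ### The first variation of the bienergy -/

section FirstVariation

/-- The squared length of the tension field of the radial projection of `k 0 + t • k 1`, where `k`
lists the values at a point of the maps involved and of their Laplacians and trace forms. -/
def radialEnergy (n : ℕ) (c : ℝ) (z : ℝ × (Fin 7 → Amb n)) : ℝ :=
  (quadL n c (z.2 0 + z.1 • z.2 1) (z.2 0 + z.1 • z.2 1))⁻¹ *
    metricL n c
      (radialTension n c (z.2 0 + z.1 • z.2 1) (z.2 2 + z.1 • z.2 3)
        (z.1 • z.2 4 + z.1 ^ 2 • z.2 5 + z.1 ^ 3 • z.2 6))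
      (radialTension n c (z.2 0 + z.1 • z.2 1) (z.2 2 + z.1 • z.2 3)
        (z.1 • z.2 4 + z.1 ^ 2 • z.2 5 + z.1 ^ 3 • z.2 6))

theorem contDiffAt_radialEnergy {n : ℕ} {c : ℝ} {k : Fin 7 → Amb n}
    (hk : quadL n c (k 0) (k 0) = 1) : ContDiffAt ℝ ∞ (radialEnergy n c) (0, k) := by
  have hB : ∀ (B : Amb n →L[ℝ] Amb n →L[ℝ] ℝ) {f h : ℝ × (Fin 7 → Amb n) → Amb n},
      ContDiffAt ℝ ∞ f (0, k) → ContDiffAt ℝ ∞ h (0, k) →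
      ContDiffAt ℝ ∞ (fun z => B (f z) (h z)) (0, k) := fun B f h hf hh =>
    (B.contDiff.contDiffAt.comp _ hf).clm_apply hh
  have hY : ContDiffAt ℝ ∞ (fun z : ℝ × (Fin 7 → Amb n) => z.2 0 + z.1 • z.2 1) (0, k) := by
    fun_prop
  have hL : ContDiffAt ℝ ∞ (fun z : ℝ × (Fin 7 → Amb n) => z.2 2 + z.1 • z.2 3) (0, k) := by
    fun_prop
  have hD : ContDiffAt ℝ ∞ (fun z : ℝ × (Fin 7 → Amb n) =>
      z.1 • z.2 4 + z.1 ^ 2 • z.2 5 + z.1 ^ 3 • z.2 6) (0, k) := by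
    fun_prop
  have hQ := (hB (quadL n c) hY hY).inv (by simp [hk])
  have hT : ContDiffAt ℝ ∞ (fun z : ℝ × (Fin 7 → Amb n) =>
      radialTension n c (z.2 0 + z.1 • z.2 1) (z.2 2 + z.1 • z.2 3)
        (z.1 • z.2 4 + z.1 ^ 2 • z.2 5 + z.1 ^ 3 • z.2 6)) (0, k) :=
    (hL.sub (hQ.smul hD)).sub ((hQ.mul (hB (quadL n c) hY (hL.sub (hQ.smul hD)))).smul hY)
  exact hQ.mul (hB (metricL n c) hT hT)

theorem hasDerivAt_bilin {V W : Type*} [NormedAddCommGroup V] [NormedSpace ℝ V]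
    [NormedAddCommGroup W] [NormedSpace ℝ W] (B : V →L[ℝ] V →L[ℝ] W) {f h : ℝ → V} {f' h' : V}
    {t : ℝ} (hf : HasDerivAt f f' t) (hh : HasDerivAt h h' t) :
    HasDerivAt (fun t => B (f t) (h t)) (B f' (h t) + B (f t) h') t := by
  have := (B.hasFDerivAt_of_bilinear hf.hasFDerivAt hh.hasFDerivAt).hasDerivAt
  simpa [add_comm] using this

/-- Product and quotient rules at `t = 0`, where `quad(Y, Y) = 1` has derivative `2 quad(k 0, k 1)`.
The entries `k 5` and `k 6` carry `t²` and `t³` and drop out. -/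
theorem hasDerivAt_radialEnergy {n : ℕ} {c : ℝ} {k : Fin 7 → Amb n}
    (hk : quadL n c (k 0) (k 0) = 1) {τ : Amb n} (hτ : τ = k 2 - quadL n c (k 0) (k 2) • k 0) :
    HasDerivAt (fun t => radialEnergy n c (t, k))
      (2 * (-(quadL n c (k 0) (k 1) * metricL n c τ τ) + metricL n c τ
        (k 3 - k 4 - quadL n c (k 0) (k 2) • k 1
          - (-(2 * quadL n c (k 0) (k 1) * quadL n c (k 0) (k 2)) + quadL n c (k 1) (k 2)
            + quadL n c (k 0) (k 3 - k 4)) • k 0))) 0 := by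
  have hY : HasDerivAt (fun t : ℝ => k 0 + t • k 1) (k 1) 0 := by
    simpa using ((hasDerivAt_id (0 : ℝ)).smul_const (k 1)).const_add (k 0)
  have hL : HasDerivAt (fun t : ℝ => k 2 + t • k 3) (k 3) 0 := by
    simpa using ((hasDerivAt_id (0 : ℝ)).smul_const (k 3)).const_add (k 2)
  have hD : HasDerivAt (fun t : ℝ => t • k 4 + t ^ 2 • k 5 + t ^ 3 • k 6) (k 4) 0 := by
    have := ((((hasDerivAt_id (0 : ℝ)).smul_const (k 4)).add
      (((hasDerivAt_id (0 : ℝ)).pow 2).smul_const (k 5))).add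
      (((hasDerivAt_id (0 : ℝ)).pow 3).smul_const (k 6)))
    exact this.congr_deriv (by simp)
  have hQ0 : quadL n c (k 0 + (0 : ℝ) • k 1) (k 0 + (0 : ℝ) • k 1) = 1 := by simpa using hk
  have hQ := (hasDerivAt_bilin (quadL n c) hY hY).inv (by rw [hQ0]; exact one_ne_zero)
  have hLD := hL.sub (hQ.smul hD)
  have hT := hLD.sub ((hQ.mul (hasDerivAt_bilin (quadL n c) hY hLD)).smul hY)
  have hE := hQ.mul (hasDerivAt_bilin (metricL n c) hT hT)
  refine hE.congr_deriv ?_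
  simp only [Pi.sub_apply, Pi.smul_apply', Pi.mul_apply, Pi.inv_apply, hQ0]
  simp only [zero_smul, add_zero, smul_zero, ne_eq, OfNat.ofNat_ne_zero, not_false_eq_true, zero_pow,
    inv_one, sub_zero, one_smul, one_mul, one_pow, div_one]
  rw [quadL_comm c (k 1) (k 0), ← hτ]
  simp only [map_sub, map_add, map_smul, _root_.sub_apply, _root_.add_apply, _root_.smul_apply,
    smul_eq_mul]
  rw [metricL_comm c (k 3) τ, metricL_comm c (k 4) τ, metricL_comm c (k 1) τ,
    metricL_comm c (k 0) τ]
  ring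

variable {n : ℕ} {M : Type*} [TopologicalSpace M] [ChartedSpace (EuclideanSpace ℝ (Fin n)) M]
  [IsManifold (𝓡 n) ∞ M]
  {c : ℝ} {g : RMetric n M} {x N Z : M → Amb n} {p : M}

/-- The scalar multiplication of maps into the ambient space, as a bilinear map. -/
abbrev smulL (n : ℕ) : ℝ →L[ℝ] Amb n →L[ℝ] Amb n := ContinuousLinearMap.lsmul ℝ ℝ

/-- The values at `p` on which the energy density of a radial variation depends. -/
def variationData (c : ℝ) (g : RMetric n M) (x Z : M → Amb n) (p : M) : Fin 7 → Amb n :=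
  ![x p, Z p, lap g x p, lap g Z p,
    (2 : ℝ) • traceForm g (smulL n) (fun p => quadL n c (x p) (Z p)) x p,
    (2 : ℝ) • traceForm g (smulL n) (fun p => quadL n c (x p) (Z p)) Z p
      + traceForm g (smulL n) (fun p => quadL n c (Z p) (Z p)) x p,
    traceForm g (smulL n) (fun p => quadL n c (Z p) (Z p)) Z p]

theorem continuous_variationData (hx : IsIsometricImmersion c g x)
    (hZ : ContMDiff (𝓡 n) 𝓘(ℝ, Amb n) ∞ Z) : Continuous (variationData c g x Z) := by
  have hα := contMDiff_bilin (quadL n c) hx.smooth hZ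
  have hβ := contMDiff_bilin (quadL n c) hZ hZ
  have h1 := (contMDiff_traceForm hx (smulL n) hα hx.smooth).continuous
  have h2 := (contMDiff_traceForm hx (smulL n) hα hZ).continuous
  have h3 := (contMDiff_traceForm hx (smulL n) hβ hx.smooth).continuous
  have h4 := (contMDiff_traceForm hx (smulL n) hβ hZ).continuous
  have h5 := (contMDiff_lap hx hx.smooth).continuous
  have h6 := (contMDiff_lap hx hZ).continuous
  have h7 := hx.smooth.continuous
  have h8 := hZ.continuous
  refine continuous_pi fun i => ?_
  fin_cases i
  · exact h7
  · exact h8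
  · exact h5
  · exact h6
  · exact h1.const_smul (2 : ℝ)
  · exact (h2.const_smul (2 : ℝ)).add h3
  · exact h4

theorem metric_tension_radial (hx : IsIsometricImmersion c g x)
    (hZ : ContMDiff (𝓡 n) 𝓘(ℝ, Amb n) ∞ Z) {t : ℝ}
    (hQ : ∀ p, 0 < quadL n c (x p + t • Z p) (x p + t • Z p))
    (hY0 : c ≤ 0 → ∀ p, 0 < (x p + t • Z p).2) (p : M) :
    metric c (tension c g (radial c fun p => x p + t • Z p) p)
      (tension c g (radial c fun p => x p + t • Z p) p)
      = radialEnergy n c (t, variationData c g x Z p) := by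
  have htZ : ContMDiff (𝓡 n) 𝓘(ℝ, Amb n) ∞ (fun p => t • Z p) :=
    (contMDiff_const (I' := 𝓘(ℝ, ℝ)) (c := t)).smul hZ
  have hY : ContMDiff (𝓡 n) 𝓘(ℝ, Amb n) ∞ (fun p => x p + t • Z p) := hx.smooth.add htZ
  have hα := contMDiff_bilin (quadL n c) hx.smooth hZ
  have hβ := contMDiff_bilin (quadL n c) hZ hZ
  have hlap : lap g (fun p => x p + t • Z p) p = lap g x p + t • lap g Z p := by
    rw [lap_add hx.smooth htZ]
    congr 1
    exact lap_clm (t • ContinuousLinearMap.id ℝ (Amb n)) hZ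
  -- The constant term is `1` because `x` lies in the space form; thus the gradient of this
  -- function, and with it the trace term, starts at order `t`.
  have hQt : (fun p => quadL n c (x p + t • Z p) (x p + t • Z p))
      = fun p => ((1 : ℝ) + (2 * t) • quadL n c (x p) (Z p)) + (t ^ 2) • quadL n c (Z p) (Z p) := by
    funext p
    simp only [map_add, map_smul, _root_.add_apply, _root_.smul_apply, smul_eq_mul,
      quadL_self (hx.mem p), quadL_comm c (Z p) (x p)]
    ring
  have hD : traceForm g (smulL n) (fun p => quadL n c (x p + t • Z p) (x p + t • Z p))
      (fun p => x p + t • Z p) p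
      = t • variationData c g x Z p 4 + t ^ 2 • variationData c g x Z p 5
        + t ^ 3 • variationData c g x Z p 6 := by
    have h1 : ContMDiff (𝓡 n) 𝓘(ℝ, ℝ) ∞ fun p => (2 * t) • quadL n c (x p) (Z p) :=
      (contMDiff_const (I' := 𝓘(ℝ, ℝ)) (c := 2 * t)).smul hα
    have h2 : ContMDiff (𝓡 n) 𝓘(ℝ, ℝ) ∞ fun p => (t ^ 2) • quadL n c (Z p) (Z p) :=
      (contMDiff_const (I' := 𝓘(ℝ, ℝ)) (c := t ^ 2)).smul hβ
    have h3 : ContMDiff (𝓡 n) 𝓘(ℝ, ℝ) ∞ fun p => (1 : ℝ) + (2 * t) • quadL n c (x p) (Z p) :=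
      contMDiff_const.add h1
    rw [hQt, traceForm_add_left _ _ h3 h2,
      traceForm_add_left _ _ contMDiff_const h1, traceForm_const_left,
      traceForm_smul_left _ _ _ hα, traceForm_smul_left _ _ _ hβ]
    simp only [traceForm_add_right _ _ hx.smooth htZ, traceForm_smul_right _ _ _ hZ]
    simp only [variationData]
    change _ = t • ((2 : ℝ) • traceForm g (smulL n) (fun p => quadL n c (x p) (Z p)) x p)
      + t ^ 2 • ((2 : ℝ) • traceForm g (smulL n) (fun p => quadL n c (x p) (Z p)) Z p
        + traceForm g (smulL n) (fun p => quadL n c (Z p) (Z p)) x p)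
      + t ^ 3 • traceForm g (smulL n) (fun p => quadL n c (Z p) (Z p)) Z p
    module
  rw [tension_radial hY hQ hY0, hlap]
  change metric c (_ • radialTension n c _ _ (traceForm g (smulL n) _ _ p))
    (_ • radialTension n c _ _ (traceForm g (smulL n) _ _ p)) = _
  rw [hD, metric_eq_metricL]
  have hp := hQ p
  have hsq := Real.mul_self_sqrt hp.le
  simp only [map_smul, _root_.smul_apply, smul_eq_mul, ← mul_assoc, ← mul_inv, hsq]
  rfl

variable [CompactSpace M]

/-- Both open conditions hold at `t = 0`, hence for all small `t` uniformly over the compact `M`. -/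
theorem exists_radial_bound (hx : IsIsometricImmersion c g x) (hZ : Continuous Z) :
    ∃ ε > 0, ∀ t : ℝ, |t| ≤ ε → (∀ p, 0 < quadL n c (x p + t • Z p) (x p + t • Z p)) ∧
      (c ≤ 0 → ∀ p, 0 < (x p + t • Z p).2) := by
  have hxc := hx.smooth.continuous
  have hYc : Continuous fun z : ℝ × M => x z.2 + z.1 • Z z.2 := by fun_prop
  have h1 : ∀ᶠ t in nhds (0 : ℝ), ∀ p ∈ (univ : Set M),
      0 < quadL n c (x p + t • Z p) (x p + t • Z p) ∧ (c ≤ 0 → 0 < (x p + t • Z p).2) := by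
    refine isCompact_univ.eventually_forall_of_forall_eventually (x₀ := (0 : ℝ))
      (P := fun t p => 0 < quadL n c (x p + t • Z p) (x p + t • Z p)
        ∧ (c ≤ 0 → 0 < (x p + t • Z p).2)) fun p _ => ?_
    have hc1 : Continuous fun z : ℝ × M =>
        quadL n c (x z.2 + z.1 • Z z.2) (x z.2 + z.1 • Z z.2) :=
      ((quadL n c).continuous.comp hYc).clm_apply hYc
    refine (hc1.continuousAt.eventually (lt_mem_nhds ?_)).and ?_
    · simp [quadL_self (hx.mem p)]
    · by_cases hc : c ≤ 0
      · have h2 : (0 : ℝ) < (x p + (0 : ℝ) • Z p).2 := by simpa using (hx.mem p).2 hc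
        filter_upwards [((continuous_snd.comp hYc).continuousAt (x := ((0 : ℝ), p))).eventually
          (lt_mem_nhds h2)] with z hz _ using hz
      · exact Filter.Eventually.of_forall fun z h => absurd h hc
  obtain ⟨ε, hε, hball⟩ := Metric.nhds_basis_closedBall.mem_iff.1 h1
  refine ⟨ε, hε, fun t ht => ?_⟩
  have := hball (a := t) (by simpa [Metric.mem_closedBall, dist_zero_right] using ht)
  exact ⟨fun p => (this p (mem_univ p)).1, fun hc p => (this p (mem_univ p)).2 hc⟩

/-- A variation must be defined for every real time, whereas the projection makes sense only for
small parameters; the substitution `ε sin t` keeps the parameter in the admissible interval. -/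
theorem isVariation_radial (hx : IsIsometricImmersion c g x)
    (hZ : ContMDiff (𝓡 n) 𝓘(ℝ, Amb n) ∞ Z) {ε : ℝ}
    (hε : ∀ t : ℝ, |t| ≤ |ε| → (∀ p, 0 < quadL n c (x p + t • Z p) (x p + t • Z p)) ∧
      (c ≤ 0 → ∀ p, 0 < (x p + t • Z p).2)) :
    IsVariation c x fun t => radial c fun p => x p + (ε * Real.sin t) • Z p := by
  have hle : ∀ t, |ε * Real.sin t| ≤ |ε| := fun t => by
    rw [abs_mul]
    exact mul_le_of_le_one_right (abs_nonneg _) (Real.abs_sin_le_one t)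
  refine ⟨fun z => ?_, fun t p => ?_, ?_⟩
  · have h : ContDiffAt ℝ ∞ (fun y : Amb n => (√(quadL n c y y))⁻¹ • y)
        (x z.2 + (ε * Real.sin z.1) • Z z.2) := by
      have hq : ContDiffAt ℝ ∞ (fun y : Amb n => quadL n c y y)
          (x z.2 + (ε * Real.sin z.1) • Z z.2) :=
        (((quadL n c).contDiff).clm_apply contDiff_id).contDiffAt
      have hpos := (hε _ (hle z.1)).1 z.2
      exact ((hq.sqrt hpos.ne').inv (Real.sqrt_pos.2 hpos).ne').smul contDiffAt_id
    have hη : ContMDiff (𝓘(ℝ, ℝ).prod (𝓡 n)) 𝓘(ℝ, ℝ) ∞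
        (fun z : ℝ × M => ε * Real.sin z.1) :=
      (contDiff_const.mul Real.contDiff_sin).contMDiff.comp contMDiff_fst
    have hY : ContMDiff (𝓘(ℝ, ℝ).prod (𝓡 n)) 𝓘(ℝ, Amb n) ∞
        (fun z : ℝ × M => x z.2 + (ε * Real.sin z.1) • Z z.2) :=
      (hx.smooth.comp contMDiff_snd).add (hη.smul (hZ.comp contMDiff_snd))
    exact h.contMDiffAt.comp z (hY z)
  · exact radial_mem ((hε _ (hle t)).1 p) fun hc => (hε _ (hle t)).2 hc p
  · funext p
    simp [radial, quadL_self (hx.mem p)]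

variable [MeasurableSpace M] [BorelSpace M]

theorem integral_variation_eq_zero (hx : IsIsometricImmersion c g x)
    (hbi : IsBiharmonic c g x) (hZ : ContMDiff (𝓡 n) 𝓘(ℝ, Amb n) ∞ Z) {D : M → ℝ}
    (hD : ∀ p, HasDerivAt (fun t => radialEnergy n c (t, variationData c g x Z p)) (D p) 0) :
    ∫ p, D p ∂(riemVol g) = 0 := by
  have := isFiniteMeasure_riemVol hx
  obtain ⟨ε, hε, hb⟩ := exists_radial_bound (c := c) hx hZ.continuous
  have hb' : ∀ t : ℝ, |t| ≤ |ε| → (∀ p, 0 < quadL n c (x p + t • Z p) (x p + t • Z p)) ∧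
      (c ≤ 0 → ∀ p, 0 < (x p + t • Z p).2) := fun t ht => hb t (by rwa [abs_of_pos hε] at ht)
  have hle : ∀ t, |ε * Real.sin t| ≤ ε := fun t => by
    rw [abs_mul, abs_of_pos hε]
    exact mul_le_of_le_one_right hε.le (Real.abs_sin_le_one t)
  have hcrit := hbi.critical _ (isVariation_radial hx hZ hb')
  have hE : (fun t => bienergy c g (radial c fun p => x p + (ε * Real.sin t) • Z p))
      = fun t => 2⁻¹ * ∫ p, radialEnergy n c (ε * Real.sin t, variationData c g x Z p)
        ∂(riemVol g) := by
    funext t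
    simp only [bienergy]
    congr 2
    funext p
    exact metric_tension_radial hx hZ (hb _ (hle t)).1 (hb _ (hle t)).2 p
  rw [hE] at hcrit
  have hder := hasDerivAt_integral_comp_of_contDiffAt (μ := riemVol g)
    (continuous_variationData hx hZ) (Φ := radialEnergy n c) (D := D)
    (fun p => contDiffAt_radialEnergy (quadL_self (hx.mem p))) hD
  -- The reparametrization has speed `ε ≠ 0` at `0`, so criticality passes to the derivative in the
  -- original parameter.
  have hη : HasDerivAt (fun t : ℝ => ε * Real.sin t) ε 0 := by
    simpa using (Real.hasDerivAt_sin 0).const_mul ε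
  have hder' : HasDerivAt (fun t => ∫ p, radialEnergy n c (t, variationData c g x Z p)
      ∂(riemVol g)) (∫ p, D p ∂(riemVol g)) (ε * Real.sin 0) := by simpa using hder
  have h2 := (hder'.comp (0 : ℝ) hη).const_mul (2⁻¹ : ℝ)
  have h3 := hcrit.unique h2
  simpa [hε.ne'] using h3.symm

/-- The first variation of the bienergy of a biharmonic hypersurface along the tangential part of
`Z`. -/
theorem first_variation (hn : 1 ≤ n) (hx : IsIsometricImmersion c g x) (hN : IsUnitNormal c x N)
    (hbi : IsBiharmonic c g x) (hZ : ContMDiff (𝓡 n) 𝓘(ℝ, Amb n) ∞ Z)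
    (hZ0 : c = 0 → ∃ a, Z = fun _ => a) :
    ∫ p, (-(quadL n c (x p) (Z p) * (n * meanCurv c g x N p) ^ 2)
      + n * meanCurv c g x N p * (metricL n c (N p) (lap g Z p)
        + n * c * metricL n c (N p) (Z p))) ∂(riemVol g) = 0 := by
  have key := integral_variation_eq_zero hx hbi hZ
    (D := fun p => 2 * (-(quadL n c (x p) (Z p) * (n * meanCurv c g x N p) ^ 2)
      + n * meanCurv c g x N p * (metricL n c (N p) (lap g Z p)
        + n * c * metricL n c (N p) (Z p)))) fun p => by
    have h := hasDerivAt_radialEnergy (c := c) (k := variationData c g x Z p)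
      (quadL_self (hx.mem p)) (τ := (n * meanCurv c g x N p) • N p) (by
        rw [← tension_immersion hn hx hN, tension_eq hx.smooth hx.mem]; rfl)
    refine h.congr_deriv ?_
    change 2 * (-(quadL n c (x p) (Z p) * _) + metricL n c _ (lap g Z p
      - (2 : ℝ) • traceForm g (smulL n) (fun p => quadL n c (x p) (Z p)) x p
      - quadL n c (x p) (lap g x p) • Z p - (-(2 * quadL n c (x p) (Z p)
        * quadL n c (x p) (lap g x p)) + quadL n c (Z p) (lap g x p) + quadL n c (x p) (lap g Z p
          - (2 : ℝ) • traceForm g (smulL n) (fun p => quadL n c (x p) (Z p)) x p)) • x p)) = _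
    -- `T` is a combination of the vectors `∂ⱼx`: it is tangent to the hypersurface and does not
    -- pair with `N` or `x`.
    set T := traceForm g (smulL n) (fun p => quadL n c (x p) (Z p)) x p with hT
    have hT1 : metricL n c (N p) T = 0 := by
      rw [hT]
      simp only [traceForm, traceIn, map_sum, map_smul, ContinuousLinearMap.lsmul_apply,
        metricL_normal_pd_self hx hN, smul_zero, Finset.sum_const_zero]
    have hT2 : quadL n c (x p) T = 0 := by
      rw [hT]
      simp only [traceForm, traceIn, map_sum, map_smul, ContinuousLinearMap.lsmul_apply,
        tangentSpace_pd hx, smul_zero, Finset.sum_const_zero]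
    have hc0 := mul_metricL_eq_zero (quadL_normal hN p)
    rw [metricL_comm] at hc0
    have h1 : quadL n c (Z p) (lap g x p) * metricL n c (N p) (x p) = 0 := by
      have := quadL_mul_metricL_eq_zero (hx.mem p) (quadL_normal hN p) (quadL_normal hN p) (Z p)
      rw [metricL_comm] at this
      rw [lap_immersion hn hx hN]
      simp only [map_sub, map_smul, smul_eq_mul]
      linear_combination (n * meanCurv c g x N p) * this - n * quadL n c (Z p) (x p) * hc0
    -- For `c ≠ 0` the second factor vanishes. For `c = 0` it need not, and the constancy of `Z` is
    -- what makes the first one vanish.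
    have h2 : quadL n c (x p) (lap g Z p) * metricL n c (N p) (x p) = 0 := by
      rcases eq_or_ne c 0 with hc | hc
      · obtain ⟨a, rfl⟩ := hZ0 hc
        rw [lap_const]
        simp
      · rw [(mul_eq_zero.1 hc0).resolve_left hc, mul_zero]
    simp only [map_sub, map_smul, _root_.smul_apply, smul_eq_mul, hT1, hT2,
      metricL_normal_self hN, quadL_lap_self hx]
    linear_combination -(2 * n * meanCurv c g x N p) * h1 - (2 * n * meanCurv c g x N p) * h2
      - 4 * n ^ 2 * meanCurv c g x N p * quadL n c (x p) (Z p) * hc0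
  rw [integral_const_mul] at key
  simpa using key

end FirstVariation

/-! ### The integral formula and nonexistence for `c ≤ 0` -/

section IntegralFormula

variable {n : ℕ} {M : Type*} [TopologicalSpace M] [ChartedSpace (EuclideanSpace ℝ (Fin n)) M]
  [IsManifold (𝓡 n) ∞ M] [T2Space M] [CompactSpace M] [MeasurableSpace M] [BorelSpace M]
  {c : ℝ} {g : RMetric n M} {x N : M → Amb n}

theorem continuous_meanCurv (hx : IsIsometricImmersion c g x) (hN : IsUnitNormal c x N) :
    Continuous (meanCurv c g x N) := (contMDiff_meanCurv hx hN).continuous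

theorem continuous_quadL_immersion (hx : IsIsometricImmersion c g x) (a : Amb n) :
    Continuous fun p => quadL n c a (x p) := (quadL n c a).continuous.comp hx.smooth.continuous

theorem continuous_quadL_mul (hx : IsIsometricImmersion c g x) (hN : IsUnitNormal c x N)
    (a : Amb n) : Continuous fun p => quadL n c a (x p) * (meanCurv c g x N p ^ 2 - c) :=
  (continuous_quadL_immersion hx a).mul (((continuous_meanCurv hx hN).pow 2).sub continuous_const)

/-- The first variation along a constant field produces the term `c H ⟨N, a⟩`; the divergence
theorem for `⟨a, x⟩` trades it for `c quad(a, x)`. -/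
theorem integral_quadL_mul (hn : 1 ≤ n) (hx : IsIsometricImmersion c g x)
    (hN : IsUnitNormal c x N) (hbi : IsBiharmonic c g x) (a : Amb n) :
    ∫ p, quadL n c a (x p) * (meanCurv c g x N p ^ 2 - c) ∂(riemVol g) = 0 := by
  have hn' : (n : ℝ) ≠ 0 := by positivity
  have h1 := first_variation hn hx hN hbi (Z := fun _ => a) contMDiff_const fun _ => ⟨a, rfl⟩
  have hlin : ContMDiff (𝓡 n) 𝓘(ℝ, ℝ) ∞ (fun p => metricL n c a (x p)) :=
    (metricL n c a).contMDiff.comp hx.smooth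
  have h2 := integral_lap_eq_zero hx hlin
  have h3 : ∀ p, -(quadL n c (x p) a * (n * meanCurv c g x N p) ^ 2)
      + n * meanCurv c g x N p * (metricL n c (N p) (lap g (fun _ => a) p)
        + n * c * metricL n c (N p) a)
      = -(n : ℝ) ^ 2 * (quadL n c a (x p) * (meanCurv c g x N p ^ 2 - c))
        + n * c * lap g (fun p => metricL n c a (x p)) p := fun p => by
    have h4 : c * (n * c * metricL n c a (x p)) = n * c * quadL n c a (x p) := by
      rcases eq_or_ne c 0 with rfl | hc
      · simp
      · rw [quadL_eq_mul_metricL hc]; ring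
    rw [lap_const, lap_clm _ hx.smooth, lap_immersion hn hx hN, quadL_comm c (x p) a,
      metricL_comm c (N p) a]
    simp only [map_zero, map_sub, map_smul, smul_eq_mul]
    linear_combination (n : ℝ) * h4
  simp only [h3] at h1
  rw [integral_add ((integrable_of_continuous hx (continuous_quadL_mul hx hN a)).const_mul _)
    ((integrable_of_continuous hx (contMDiff_lap hx hlin).continuous).const_mul _),
    integral_const_mul, integral_const_mul, h2, mul_zero, add_zero] at h1
  exact (mul_eq_zero.1 h1).resolve_left (by simpa using hn')

theorem eq_zero_of_integral_eq_zero (hx : IsIsometricImmersion c g x) {F : M → ℝ}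
    (hF : Continuous F) (h0 : ∀ p, 0 ≤ F p) (hint : ∫ p, F p ∂(riemVol g) = 0) (p : M) :
    F p = 0 := by
  have := isOpenPosMeasure_riemVol hx
  rw [integral_eq_zero_iff_of_nonneg h0 (integrable_of_continuous hx hF)] at hint
  exact congrFun ((hF.ae_eq_iff_eq _ continuous_const).1 hint) p

theorem curvature_pos [Nonempty M] (hn : 1 ≤ n) (hx : IsIsometricImmersion c g x)
    (hN : IsUnitNormal c x N) (hbi : IsBiharmonic c g x) : ¬ c ≤ 0 := by
  intro hc
  have hn' : (n : ℝ) ≠ 0 := by positivity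
  have hH : ∀ p, meanCurv c g x N p ^ 2 = c := by
    intro p
    -- Pairing with `(0, 1)` reads off the last coordinate, which is positive on the model when `c ≤
    -- 0`.
    have hpos : ∀ p, quadL n c (0, 1) (x p) = (x p).2 := fun p => by
      simp [← quad_eq_quadL, quad]
    have hpos' : ∀ p, 0 < quadL n c (0, 1) (x p) := fun p => by
      rw [hpos]; exact (hx.mem p).2 hc
    have h := eq_zero_of_integral_eq_zero hx (continuous_quadL_mul hx hN (0, 1))
      (fun p => mul_nonneg (hpos' p).le (by nlinarith [sq_nonneg (meanCurv c g x N p)]))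
      (integral_quadL_mul hn hx hN hbi (0, 1)) p
    have := (mul_eq_zero.1 h).resolve_left (hpos' p).ne'
    linarith
  obtain ⟨p₀⟩ := ‹Nonempty M›
  have hc0 : c = 0 := le_antisymm hc (by rw [← hH p₀]; positivity)
  subst hc0
  have hm : ContMDiff (𝓡 n) 𝓘(ℝ, ℝ) ∞ (fun p => metricL n 0 (x p) (x p)) :=
    contMDiff_bilin _ hx.smooth hx.smooth
  -- A minimal immersion into Euclidean space is harmonic, so only the gradient term of `Δ|x|²`
  -- survives.
  have hl : ∀ p, lap g (fun p => metricL n 0 (x p) (x p)) p = 2 * n := fun p => by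
    have h0 : meanCurv 0 g x N p = 0 := by simpa using hH p
    rw [lap_bilin _ hx.smooth hx.smooth, lap_immersion hn hx hN, h0, traceForm_self hx]
    simp
  have h1 := integral_lap_eq_zero hx hm
  have h2 := eq_zero_of_integral_eq_zero hx (contMDiff_lap hx hm).continuous
    (fun p => by rw [hl]; positivity) h1 p₀
  rw [hl] at h2
  exact hn' (by linarith)

end IntegralFormula

/-! ### The Riemannian distance of the sphere -/

section Distance

variable {n : ℕ} {c : ℝ}

theorem metricL_self_nonneg (hc : 0 < c) (v : Amb n) : 0 ≤ metricL n c v v := by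
  rw [← metric_eq_metricL, metric]
  have h1 : 0 ≤ inner ℝ v.1 v.1 := real_inner_self_nonneg
  have h2 : 0 ≤ c⁻¹ * (v.2 * v.2) := mul_nonneg (inv_pos.2 hc).le (mul_self_nonneg _)
  linarith

theorem eq_zero_of_metricL_self (hc : 0 < c) {v : Amb n} (h : metricL n c v v = 0) : v = 0 := by
  rw [← metric_eq_metricL, metric] at h
  have h1 : 0 ≤ inner ℝ v.1 v.1 := real_inner_self_nonneg
  have hci := inv_pos.2 hc
  have h2 : 0 ≤ c⁻¹ * (v.2 * v.2) := mul_nonneg hci.le (mul_self_nonneg _)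
  have h3 : inner ℝ v.1 v.1 = 0 := by linarith
  have h4 : c⁻¹ * (v.2 * v.2) = 0 := by linarith
  have h5 : v.2 = 0 := by simpa [hci.ne'] using h4
  exact Prod.ext (inner_self_eq_zero.1 h3) h5

theorem quadL_self_nonneg (hc : 0 < c) (v : Amb n) : 0 ≤ quadL n c v v := by
  rw [quadL_eq_mul_metricL hc.ne']
  exact mul_nonneg hc.le (metricL_self_nonneg hc v)

theorem eq_zero_of_quadL_self (hc : 0 < c) {v : Amb n} (h : quadL n c v v = 0) : v = 0 := by
  rw [quadL_eq_mul_metricL hc.ne', mul_eq_zero, or_iff_right hc.ne'] at h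
  exact eq_zero_of_metricL_self hc h

theorem quadL_sq_le (hc : 0 < c) (v w : Amb n) :
    quadL n c v w ^ 2 ≤ quadL n c v v * quadL n c w w := by
  have h := quadL_self_nonneg hc (quadL n c w w • v - quadL n c v w • w)
  simp only [map_sub, map_smul, _root_.sub_apply, _root_.smul_apply, smul_eq_mul,
    quadL_comm c w v] at h
  rcases (quadL_self_nonneg hc w).eq_or_lt with h0 | h0
  · rw [eq_zero_of_quadL_self hc h0.symm]
    simp
  · have : 0 ≤ quadL n c w w * (quadL n c v v * quadL n c w w - quadL n c v w ^ 2) := by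
      nlinarith
    have := (mul_nonneg_iff_of_pos_left h0).1 this
    linarith

theorem quadL_le_one (hc : 0 < c) {y z : Amb n} (hy : y ∈ spaceForm n c)
    (hz : z ∈ spaceForm n c) : quadL n c y z ≤ 1 := by
  have h := quadL_sq_le hc y z
  rw [quadL_self hy, quadL_self hz] at h
  nlinarith

theorem neg_one_le_quadL (hc : 0 < c) {y z : Amb n} (hy : y ∈ spaceForm n c)
    (hz : z ∈ spaceForm n c) : -1 ≤ quadL n c y z := by
  have h := quadL_sq_le hc y z
  rw [quadL_self hy, quadL_self hz] at h
  nlinarith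

theorem mem_spaceForm_iff (hc : 0 < c) {y : Amb n} : y ∈ spaceForm n c ↔ quadL n c y y = 1 := by
  rw [← quad_eq_quadL]
  exact ⟨fun h => h.1, fun h => ⟨h, fun h' => absurd h' hc.not_ge⟩⟩

/-- The angle `arccos r` with `r = quad(y, γ)` grows at most at the rate `√c |γ'|`. Indeed `γ'` is
tangent, so in `r' = quad(y, γ')` the point `y` may be replaced by its tangential part `y - r γ`, of
square `1 - r²`; then apply Cauchy–Schwarz. -/
theorem length_lower_bound (hc : 0 < c) {y z : Amb n} (hy : y ∈ spaceForm n c)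
    {γ : ℝ → Amb n} (hγ : ContDiff ℝ 1 γ) (hm : ∀ t ∈ Icc (0 : ℝ) 1, γ t ∈ spaceForm n c)
    (h0 : γ 0 = y) (h1 : γ 1 = z) :
    Real.arccos (quadL n c y z) / √c
      ≤ ∫ t in (0 : ℝ)..1, √(metric c (deriv γ t) (deriv γ t)) := by
  have hsc : 0 < √c := Real.sqrt_pos.2 hc
  have hd : ∀ t, HasDerivAt γ (deriv γ t) t := fun t =>
    (hγ.differentiable (by simp) t).hasDerivAt
  have hdc : Continuous (deriv γ) := hγ.continuous_deriv (by simp)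
  set S := fun t => √(metricL n c (deriv γ t) (deriv γ t)) with hS
  have hSc : Continuous S :=
    (((metricL n c).continuous.comp hdc).clm_apply hdc).sqrt
  set r := fun t => quadL n c y (γ t) with hr
  have hrd : ∀ t, HasDerivAt r (quadL n c y (deriv γ t)) t := fun t =>
    (quadL n c y).hasFDerivAt.comp_hasDerivAt t (hd t)
  have hr1 : ∀ t ∈ Icc (0 : ℝ) 1, r t ≤ 1 := fun t ht => quadL_le_one hc hy (hm t ht)
  have hr2 : ∀ t ∈ Icc (0 : ℝ) 1, -1 ≤ r t := fun t ht => neg_one_le_quadL hc hy (hm t ht)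
  have htan : ∀ t ∈ Ioo (0 : ℝ) 1, quadL n c (γ t) (deriv γ t) = 0 := fun t ht => by
    have he : (fun t => quadL n c (γ t) (γ t)) =ᶠ[nhds t] fun _ => 1 := by
      filter_upwards [Ioo_mem_nhds ht.1 ht.2] with s hs
      exact quadL_self (hm s (Ioo_subset_Icc_self hs))
    have h2 := (hasDerivAt_bilin (quadL n c) (hd t) (hd t)).congr_of_eventuallyEq he.symm
    have h3 := h2.unique (hasDerivAt_const t (1 : ℝ))
    rw [quadL_comm c (deriv γ t)] at h3
    linarith
  have hspeed : ∀ t ∈ Ioo (0 : ℝ) 1,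
      quadL n c y (deriv γ t) ^ 2 ≤ (1 - r t ^ 2) * (√c * S t) ^ 2 := fun t ht => by
    have hmt := hm t (Ioo_subset_Icc_self ht)
    have h2 := quadL_sq_le hc (y - r t • γ t) (deriv γ t)
    simp only [map_sub, map_smul, _root_.sub_apply, _root_.smul_apply, smul_eq_mul, htan t ht,
      quadL_self hy, quadL_self hmt, quadL_comm c (γ t) y] at h2
    have h3 : (√c * S t) ^ 2 = quadL n c (deriv γ t) (deriv γ t) := by
      rw [mul_pow, Real.sq_sqrt hc.le, Real.sq_sqrt (metricL_self_nonneg hc _),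
        quadL_eq_mul_metricL hc.ne']
    rw [h3]
    calc _ = (quadL n c y (deriv γ t) - r t * 0) ^ 2 := by ring
      _ ≤ _ := h2
      _ = _ := by simp only [hr]; ring
  -- `arccos` is not differentiable at `±1`, and the curve starts at `r = 1`. Dividing by `1 + ε`
  -- keeps the argument inside `(-1, 1)` and only weakens the speed bound; `ε → 0` follows below.
  have hineq : ∀ ε > 0, Real.arccos (r 1 / (1 + ε)) - Real.arccos (r 0 / (1 + ε))
      ≤ ∫ t in (0 : ℝ)..1, √c * S t := fun ε hε => by
    have hε1 : (0 : ℝ) < 1 + ε := by linarith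
    have hbd : ∀ t ∈ Icc (0 : ℝ) 1, -1 < r t / (1 + ε) ∧ r t / (1 + ε) < 1 := fun t ht => by
      rw [lt_div_iff₀ hε1, div_lt_one hε1]
      constructor <;> linarith [hr1 t ht, hr2 t ht]
    have hcont : ContinuousOn (fun t => Real.arccos (r t / (1 + ε))) (Icc 0 1) :=
      (Real.continuous_arccos.comp ((continuous_iff_continuousAt.2
        fun t => (hrd t).continuousAt).div_const _)).continuousOn
    refine intervalIntegral.sub_le_integral_of_hasDeriv_right_of_le zero_le_one hcont
      (g' := fun t => -(1 / √(1 - (r t / (1 + ε)) ^ 2)) * (quadL n c y (deriv γ t) / (1 + ε)))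
      (fun t ht => ?_) ((hSc.const_mul √c).integrableOn_Icc) fun t ht => ?_
    · have hb := hbd t (Ioo_subset_Icc_self ht)
      exact ((Real.hasDerivAt_arccos hb.1.ne' hb.2.ne).comp t
        ((hrd t).div_const (1 + ε))).hasDerivWithinAt
    · have hb := hbd t (Ioo_subset_Icc_self ht)
      have hpos : 0 < 1 - (r t / (1 + ε)) ^ 2 := by nlinarith
      have hsp : 0 < √(1 - (r t / (1 + ε)) ^ 2) := Real.sqrt_pos.2 hpos
      have hs := hspeed t ht
      have hS0 : 0 ≤ √c * S t := mul_nonneg hsc.le (Real.sqrt_nonneg _)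
      have h4 : |quadL n c y (deriv γ t) / (1 + ε)|
          ≤ √(1 - (r t / (1 + ε)) ^ 2) * (√c * S t) := by
        refine abs_le_of_sq_le_sq ?_ (mul_nonneg hsp.le hS0)
        rw [mul_pow, Real.sq_sqrt hpos.le, div_pow, div_pow, div_le_iff₀ (by positivity)]
        have h5 : (1 - r t ^ 2 / (1 + ε) ^ 2) * (√c * S t) ^ 2 * (1 + ε) ^ 2
            = ((1 + ε) ^ 2 - r t ^ 2) * (√c * S t) ^ 2 := by field_simp
        rw [h5]
        refine hs.trans (mul_le_mul_of_nonneg_right ?_ (sq_nonneg _))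
        nlinarith
      have h6 := (neg_le_abs _).trans h4
      calc -(1 / √(1 - (r t / (1 + ε)) ^ 2)) * (quadL n c y (deriv γ t) / (1 + ε))
          = (-(quadL n c y (deriv γ t) / (1 + ε))) / √(1 - (r t / (1 + ε)) ^ 2) := by ring
        _ ≤ √c * S t := by rw [div_le_iff₀ hsp]; linarith
  have hlim : Real.arccos (r 1) - Real.arccos (r 0) ≤ ∫ t in (0 : ℝ)..1, √c * S t := by
    have hcl : ∀ a : ℝ, Filter.Tendsto (fun ε : ℝ => Real.arccos (a / (1 + ε)))
        (nhdsWithin 0 (Ioi 0)) (nhds (Real.arccos a)) := fun a => by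
      have : ContinuousAt (fun ε : ℝ => Real.arccos (a / (1 + ε))) 0 :=
        Real.continuous_arccos.continuousAt.comp
          (continuousAt_const.div (by fun_prop) (by simp))
      have h2 := this.tendsto.mono_left (nhdsWithin_le_nhds (s := Ioi (0 : ℝ)))
      simpa using h2
    exact le_of_tendsto ((hcl (r 1)).sub (hcl (r 0)))
      (Filter.eventually_of_mem self_mem_nhdsWithin fun ε hε => hineq ε hε)
  have hr0 : r 0 = 1 := by simp only [hr, h0]; exact quadL_self hy
  have hr1' : r 1 = quadL n c y z := by simp only [hr, h1]
  rw [hr0, hr1', Real.arccos_one, sub_zero, intervalIntegral.integral_const_mul] at hlim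
  rw [div_le_iff₀ hsc, mul_comm]
  simpa only [hS, ← metric_eq_metricL] using hlim

theorem exists_orthogonal (hn : 1 ≤ n) (hc : 0 < c) {y : Amb n} :
    ∃ w : Amb n, quadL n c w w = 1 ∧ quadL n c y w = 0 := by
  have hker : 0 < Module.finrank ℝ (LinearMap.ker (quadL n c y : Amb n →ₗ[ℝ] ℝ)) := by
    have h1 := LinearMap.finrank_range_add_finrank_ker (quadL n c y : Amb n →ₗ[ℝ] ℝ)
    have h2 : Module.finrank ℝ (LinearMap.range (quadL n c y : Amb n →ₗ[ℝ] ℝ)) ≤ 1 := by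
      simpa using Submodule.finrank_le (LinearMap.range (quadL n c y : Amb n →ₗ[ℝ] ℝ))
    have h3 : Module.finrank ℝ (Amb n) = n + 2 := by simp
    omega
  obtain ⟨⟨v, hv⟩, hv0⟩ := Module.finrank_pos_iff_exists_ne_zero.1 hker
  have hvne : v ≠ 0 := fun h => hv0 (Subtype.ext h)
  have hpos : 0 < quadL n c v v :=
    lt_of_le_of_ne (quadL_self_nonneg hc v) fun h => hvne (eq_zero_of_quadL_self hc h.symm)
  refine ⟨(√(quadL n c v v))⁻¹ • v, ?_, ?_⟩
  · have h1 := Real.mul_self_sqrt hpos.le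
    have h2 := (Real.sqrt_pos.2 hpos).ne'
    simp only [map_smul, _root_.smul_apply, smul_eq_mul]
    field_simp
    linarith
  · have : quadL n c y v = 0 := hv
    simp [this]

/-- `w` is the normalized component of `z` orthogonal to `y`. If `z = ±y` this component is zero and
any unit vector orthogonal to `y` serves. -/
theorem exists_polar (hn : 1 ≤ n) (hc : 0 < c) {y z : Amb n} (hy : y ∈ spaceForm n c)
    (hz : z ∈ spaceForm n c) :
    ∃ w : Amb n, quadL n c w w = 1 ∧ quadL n c y w = 0 ∧
      z = quadL n c y z • y + √(1 - quadL n c y z ^ 2) • w := by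
  set r := quadL n c y z with hr
  have hyy := quadL_self hy
  have hzz := quadL_self hz
  have hv : quadL n c (z - r • y) (z - r • y) = 1 - r ^ 2 := by
    simp only [map_sub, map_smul, _root_.sub_apply, _root_.smul_apply, smul_eq_mul, hyy, hzz,
      quadL_comm c z y, ← hr]
    ring
  have h0 : 0 ≤ 1 - r ^ 2 := by rw [← hv]; exact quadL_self_nonneg hc _
  rcases h0.eq_or_lt with h | h
  · obtain ⟨w, hw1, hw2⟩ := exists_orthogonal (c := c) hn hc (y := y)
    refine ⟨w, hw1, hw2, ?_⟩
    rw [← h] at hv ⊢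
    have := eq_zero_of_quadL_self hc hv
    rw [Real.sqrt_zero, zero_smul, add_zero]
    exact sub_eq_zero.1 this
  · have hs := Real.sqrt_pos.2 h
    have hsq := Real.mul_self_sqrt h.le
    refine ⟨(√(1 - r ^ 2))⁻¹ • (z - r • y), ?_, ?_, ?_⟩
    · rw [map_smul, map_smul, _root_.smul_apply, hv, smul_eq_mul, smul_eq_mul]
      field_simp
      linarith
    · simp [hyy, ← hr]
    · rw [smul_smul, mul_inv_cancel₀ hs.ne', one_smul]
      abel

/-- The infimum is attained by the great circle arc through the polar decomposition, which has
constant speed `θ / √c`. -/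
theorem sfDist_eq (hn : 1 ≤ n) (hc : 0 < c) {y z : Amb n} (hy : y ∈ spaceForm n c)
    (hz : z ∈ spaceForm n c) : sfDist c y z = Real.arccos (quadL n c y z) / √c := by
  have hsc : 0 < √c := Real.sqrt_pos.2 hc
  refine IsLeast.csInf_eq ⟨?_, ?_⟩
  · obtain ⟨w, hww, hyw, hzw⟩ := exists_polar hn hc hy hz
    set r := quadL n c y z with hr
    set θ := Real.arccos r with hθ
    have hcos : Real.cos θ = r :=
      Real.cos_arccos (neg_one_le_quadL hc hy hz) (quadL_le_one hc hy hz)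
    have hsin : Real.sin θ = √(1 - r ^ 2) := Real.sin_arccos r
    have hyy := quadL_self hy
    have hγd : ∀ t, HasDerivAt (fun t => Real.cos (θ * t) • y + Real.sin (θ * t) • w)
        ((-Real.sin (θ * t) * θ) • y + (Real.cos (θ * t) * θ) • w) t := fun t => by
      have h1 : HasDerivAt (fun t : ℝ => θ * t) θ t := by
        simpa using (hasDerivAt_id t).const_mul θ
      exact (h1.cos.smul_const y).add (h1.sin.smul_const w)
    refine ⟨fun t => Real.cos (θ * t) • y + Real.sin (θ * t) • w, ?_, fun t _ => ?_, ?_, ?_, ?_⟩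
    · have h1 : ContDiff ℝ 1 fun t : ℝ => θ * t := contDiff_const.mul contDiff_id
      exact ((Real.contDiff_cos.comp h1).smul contDiff_const).add
        ((Real.contDiff_sin.comp h1).smul contDiff_const)
    · rw [mem_spaceForm_iff hc]
      simp only [map_add, map_smul, _root_.add_apply, _root_.smul_apply, smul_eq_mul, hyy, hww,
        hyw, quadL_comm c w y]
      linear_combination Real.sin_sq_add_cos_sq (θ * t)
    · simp
    · simp only [mul_one, hcos, hsin]
      exact hzw.symm
    · have hsp : ∀ t, √(metric c (deriv (fun t => Real.cos (θ * t) • y + Real.sin (θ * t) • w) t)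
          (deriv (fun t => Real.cos (θ * t) • y + Real.sin (θ * t) • w) t)) = θ / √c := fun t => by
        rw [(hγd t).deriv]
        have h1 : metric c ((-Real.sin (θ * t) * θ) • y + (Real.cos (θ * t) * θ) • w)
            ((-Real.sin (θ * t) * θ) • y + (Real.cos (θ * t) * θ) • w) = θ ^ 2 / c := by
          rw [metric_eq_metricL, eq_div_iff hc.ne', mul_comm, ← quadL_eq_mul_metricL hc.ne']
          simp only [map_add, map_smul, _root_.add_apply, _root_.smul_apply, smul_eq_mul, hyy, hww,
            hyw, quadL_comm c w y]
          linear_combination θ ^ 2 * Real.sin_sq_add_cos_sq (θ * t)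
        rw [h1, Real.sqrt_div (sq_nonneg _), Real.sqrt_sq (Real.arccos_nonneg r)]
      simp only [hsp]
      simp
  · rintro L ⟨γ, hγ, hm, h0, h1, rfl⟩
    exact length_lower_bound hc hy hγ hm h0 h1

theorem theta_sfDist (hn : 1 ≤ n) (hc : 0 < c) {y z : Amb n} (hy : y ∈ spaceForm n c)
    (hz : z ∈ spaceForm n c) : theta c (sfDist c y z) = quadL n c y z := by
  have hsc : √c ≠ 0 := (Real.sqrt_pos.2 hc).ne'
  have hp : psi c = fun t => Real.sin (√c * t) / √c := by
    funext t; simp [psi, hc]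
  have h1 : ∀ t, HasDerivAt (psi c) (Real.cos (√c * t)) t := fun t => by
    rw [hp]
    have h := ((hasDerivAt_id' t).const_mul (√c)).sin.div_const (√c)
    rwa [mul_one, mul_div_cancel_right₀ _ hsc] at h
  rw [theta, (h1 _).deriv, sfDist_eq hn hc hy hz, mul_div_cancel₀ _ hsc,
    Real.cos_arccos (neg_one_le_quadL hc hy hz) (quadL_le_one hc hy hz)]

end Distance

/-! ### Rigidity in a hemisphere -/

section Rigidity

variable {n : ℕ} {M : Type*} [TopologicalSpace M] [ChartedSpace (EuclideanSpace ℝ (Fin n)) M]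
  [IsManifold (𝓡 n) ∞ M] {c : ℝ} {g : RMetric n M} {x N : M → Amb n}
  {W : Type*} [NormedAddCommGroup W] [NormedSpace ℝ W]

theorem pd_localRep_clm_eq_zero {f : M → Amb n} (hf : ContMDiff (𝓡 n) 𝓘(ℝ, Amb n) ∞ f)
    (L : Amb n →L[ℝ] W) {p : M}
    (h : fderiv ℝ (localRep p fun p => L (f p)) (extChartAt (𝓡 n) p p) = 0) (i : Fin n) : L (pd i (localRep p f) (extChartAt (𝓡 n) p p)) = 0 := by
  have h1 := pd_clm L i (differentiableAt_localRep hf (mem_extChartAt_target (I := 𝓡 n) p))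
  rw [← h1]
  change fderiv ℝ (localRep p fun p => L (f p)) (extChartAt (𝓡 n) p p) _ = 0
  rw [h]
  rfl

theorem continuousAt_localRep_point (p : M) :
    Filter.Tendsto (extChartAt (𝓡 n) p).symm (nhds (extChartAt (𝓡 n) p p)) (nhds p) := by
  have := continuousAt_extChartAt_symm (I := 𝓡 n) p
  rwa [ContinuousAt, extChartAt_to_inv] at this

theorem fderiv_localRep_eq_zero_of_isLocalExtr {f : M → ℝ} {p : M} (h : IsLocalExtr f p) :
    fderiv ℝ (localRep p f) (extChartAt (𝓡 n) p p) = 0 := by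
  have ht := continuousAt_localRep_point (n := n) p
  refine IsLocalExtr.fderiv_eq_zero ?_
  rcases h with h | h
  · left
    filter_upwards [ht.eventually h] with v hv
    rw [localRep_self]; exact hv
  · right
    filter_upwards [ht.eventually h] with v hv
    rw [localRep_self]; exact hv

/-- For `c > 0` the orthogonal complement of the tangent space of the hypersurface in the ambient
space is spanned by `x p` and `N p`. -/
theorem eq_normal_combination (hc : 0 < c) (hx : IsIsometricImmersion c g x)
    (hN : IsUnitNormal c x N) {p : M} {v : Amb n}
    (hv : ∀ k, quadL n c v (pd k (localRep p x) (extChartAt (𝓡 n) p p)) = 0) :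
    v = quadL n c (x p) v • x p + metricL n c v (N p) • N p := by
  have hmx : ∀ {w : Amb n}, quadL n c (x p) w = 0 → metricL n c (x p) w = 0 := fun {w} hw =>
    (mul_eq_zero.1 (mul_metricL_eq_zero hw)).resolve_left hc.ne'
  rw [← sub_eq_zero]
  refine eq_zero_of_orthogonal_frame hx hN p ?_ ?_ fun k => ?_
  · simp [quadL_self (hx.mem p), quadL_normal hN]
  · simp [hmx (quadL_normal hN p), metricL_normal_self hN]
  · have h1 := hv k
    rw [quadL_eq_mul_metricL hc.ne', mul_eq_zero, or_iff_right hc.ne'] at h1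
    simp only [map_sub, map_add, map_smul, _root_.sub_apply, _root_.add_apply, _root_.smul_apply,
      smul_eq_mul, h1, hmx (tangentSpace_pd hx p k), metricL_normal_pd_self hx hN]
    ring

/-- At a critical point `p` of `quad c y ∘ x`, where `x` maps into the sphere with pole `q` through
`y`, the point `y` is `x p` or its antipode in this sphere. -/
theorem eq_or_eq_antipode_of_critical (hc : 0 < c) (hx : IsIsometricImmersion c g x)
    (hN : IsUnitNormal c x N) {q y : Amb n} {κ : ℝ} (hq : q ∈ spaceForm n c) (hκ : κ ^ 2 < 1)
    (hxq : ∀ p, quadL n c q (x p) = κ) (hy : y ∈ spaceForm n c) (hyq : quadL n c q y = κ) {p : M}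
    (hcrit : fderiv ℝ (localRep p fun p => quadL n c y (x p)) (extChartAt (𝓡 n) p p) = 0) :
    y = x p ∨ y = (2 * κ) • q - x p := by
  have hq' := eq_normal_combination hc hx hN (p := p) (v := q) fun k => by
    refine pd_localRep_clm_eq_zero hx.smooth _ ?_ k
    have : (localRep p fun p => quadL n c q (x p)) = fun _ : EuclideanSpace ℝ (Fin n) => κ :=
      funext fun v => hxq _
    rw [this, fderiv_const_apply]
  have hy' := eq_normal_combination hc hx hN (p := p) (v := y) fun k =>
    pd_localRep_clm_eq_zero hx.smooth _ hcrit k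
  have hxx := quadL_self (hx.mem p)
  have hxN := quadL_normal hN p
  have hNN : quadL n c (N p) (N p) = c := by
    rw [quadL_eq_mul_metricL hc.ne', metricL_normal_self hN, mul_one]
  rw [quadL_comm c (x p) q, hxq p] at hq'
  set b := metricL n c q (N p)
  set σ := quadL n c (x p) y
  set d := metricL n c y (N p)
  have hqq := quadL_self hq
  have hyy := quadL_self hy
  rw [hq'] at hqq hyq
  rw [hy'] at hyy hyq
  simp only [map_add, map_smul, _root_.add_apply, _root_.smul_apply, smul_eq_mul, hxx, hxN, hNN,
    quadL_comm c (N p) (x p)] at hqq hyy hyq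
  -- Both `q = κ x + b N` and `y = σ x + d N` lie in the normal plane, and this plane has just two
  -- unit vectors with product `κ` against `q`: `x p` and its reflection in the line of `q`. The
  -- condition `κ² < 1` excludes `q = ±x p`.
  have hb : b ≠ 0 := by
    rintro h
    rw [h] at hqq
    nlinarith
  have h1 : (1 - σ) * (1 + σ - 2 * κ ^ 2) = 0 := by
    linear_combination (b * d * c + κ * (1 - σ)) * hyq - d ^ 2 * c * hqq
      - (1 - κ ^ 2) * hyy
  rcases mul_eq_zero.1 h1 with h | h
  · left
    have hσ : σ = 1 := by linarith
    rw [hσ] at hyq hy'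
    have hd : d = 0 := by
      have : b * c * d = 0 := by linear_combination hyq
      simpa [hb, hc.ne'] using this
    rw [hy', hd]
    simp
  · right
    have hσ : σ = 2 * κ ^ 2 - 1 := by linarith
    have hd : d = 2 * κ * b := by
      have : b * c * (d - 2 * κ * b) = 0 := by
        rw [hσ] at hyq
        linear_combination hyq - 2 * κ * hqq
      have := (mul_eq_zero.1 this).resolve_left (mul_ne_zero hb hc.ne')
      linarith
    rw [hy', hq', hd, hσ]
    module

/-- If `y` were missed, every critical point of `quad(y, x)` would be mapped to the antipode of `y`
in the sphere. The maximum and the minimum then agree, so the function is constant, every point is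
critical, and `x` itself is constant, which an immersion with `n ≥ 1` is not. -/
theorem range_eq_sphere [CompactSpace M] [Nonempty M] (hn : 1 ≤ n) (hc : 0 < c)
    (hx : IsIsometricImmersion c g x) (hN : IsUnitNormal c x N) {q : Amb n} {κ : ℝ}
    (hq : q ∈ spaceForm n c) (hκ : κ ^ 2 < 1) (hxq : ∀ p, quadL n c q (x p) = κ) :
    range x = {y ∈ spaceForm n c | quadL n c q y = κ} := by
  refine Subset.antisymm ?_ ?_
  · rintro _ ⟨p, rfl⟩
    exact ⟨hx.mem p, hxq p⟩
  · rintro y ⟨hy, hyq⟩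
    by_contra hyr
    have hcrit : ∀ {p}, fderiv ℝ (localRep p fun p => quadL n c y (x p)) (extChartAt (𝓡 n) p p) = 0
        → x p = (2 * κ) • q - y := fun {p} h => by
      rcases eq_or_eq_antipode_of_critical hc hx hN hq hκ hxq hy hyq h with h | h
      · exact absurd ⟨p, h.symm⟩ hyr
      · rw [h]; abel
    have hf : Continuous fun p => quadL n c y (x p) :=
      (quadL n c y).continuous.comp hx.smooth.continuous
    obtain ⟨p₁, -, h₁⟩ := isCompact_univ.exists_isMaxOn univ_nonempty hf.continuousOn
    obtain ⟨p₂, -, h₂⟩ := isCompact_univ.exists_isMinOn univ_nonempty hf.continuousOn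
    have e₁ := hcrit (fderiv_localRep_eq_zero_of_isLocalExtr
      (Or.inr (h₁.isLocalMax Filter.univ_mem)))
    have e₂ := hcrit (fderiv_localRep_eq_zero_of_isLocalExtr
      (Or.inl (h₂.isLocalMin Filter.univ_mem)))
    have hconst : ∀ p, quadL n c y (x p) = quadL n c y (x p₁) := fun p =>
      le_antisymm (h₁ (mem_univ p)) (by rw [e₁, ← e₂]; exact h₂ (mem_univ p))
    have hx0 : ∀ p, x p = (2 * κ) • q - y := fun p => hcrit (by
      have : (localRep p fun p => quadL n c y (x p))
          = fun _ : EuclideanSpace ℝ (Fin n) => quadL n c y (x p₁) := funext fun v => hconst _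
      rw [this, fderiv_const_apply])
    have hu := mem_extChartAt_target (I := 𝓡 n) p₁
    have hpos := (gram_posDef g hu).diag_pos (i := ⟨0, hn⟩)
    have hpd : pd ⟨0, hn⟩ (localRep p₁ x) (extChartAt (𝓡 n) p₁ p₁) = 0 := by
      have : localRep p₁ x = fun _ : EuclideanSpace ℝ (Fin n) => (2 * κ) • q - y :=
        funext fun v => hx0 _
      rw [this, pd_const]
    rw [gram_eq hx hu, hpd] at hpos
    simp at hpos

/-- Reduces positivity of the vector-valued trace to positivity of the matrix, one coordinate at a
time. -/
theorem sum_metricL_eq (P : Matrix (Fin n) (Fin n) ℝ) (v : Fin n → Amb n) :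
    ∑ i, ∑ j, P i j * metricL n c (v i) (v j)
      = ∑ a, (fun i => (v i).1 a) ⬝ᵥ P.mulVec (fun i => (v i).1 a)
        + c⁻¹ * ((fun i => (v i).2) ⬝ᵥ P.mulVec (fun i => (v i).2)) := by
  simp only [dotProduct, Matrix.mulVec, Finset.mul_sum, ← metric_eq_metricL, metric,
    PiLp.inner_apply, mul_add, Finset.sum_add_distrib]
  congr 1
  · rw [Finset.sum_comm' (s := (Finset.univ : Finset (Fin (n + 1)))) (t := fun _ => Finset.univ)
      (t' := Finset.univ) (s' := fun _ => Finset.univ) (by simp)]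
    refine Finset.sum_congr rfl fun i _ => ?_
    rw [Finset.sum_comm]
    refine Finset.sum_congr rfl fun a _ => Finset.sum_congr rfl fun j _ => ?_
    simp only [RCLike.inner_apply, conj_trivial]
    ring
  · refine Finset.sum_congr rfl fun i _ => Finset.sum_congr rfl fun j _ => ?_
    ring

theorem traceForm_metricL_self_nonneg (hc : 0 < c) (g : RMetric n M) (f : M → Amb n) (p : M) :
    0 ≤ traceForm g (metricL n c) f f p := by
  have hP := (gram_posDef g (mem_extChartAt_target (I := 𝓡 n) p)).inv.posSemidef
  simp only [traceForm, traceIn, smul_eq_mul]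
  rw [sum_metricL_eq]
  refine add_nonneg (Finset.sum_nonneg fun a _ => ?_) (mul_nonneg (inv_pos.2 hc).le ?_)
  · simpa using hP.dotProduct_mulVec_nonneg
      (fun i => (pd i (localRep p f) (extChartAt (𝓡 n) p p)).1 a)
  · simpa using hP.dotProduct_mulVec_nonneg
      (fun i => (pd i (localRep p f) (extChartAt (𝓡 n) p p)).2)

theorem pd_eq_zero_of_traceForm_metricL_self (hc : 0 < c) {f : M → Amb n} {p : M}
    (h : traceForm g (metricL n c) f f p = 0) (i : Fin n) :
    pd i (localRep p f) (extChartAt (𝓡 n) p p) = 0 := by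
  have hP := (gram_posDef g (mem_extChartAt_target (I := 𝓡 n) p)).inv
  have hzero : ∀ w : Fin n → ℝ, w ⬝ᵥ (gram g p (extChartAt (𝓡 n) p p))⁻¹.mulVec w = 0 → w = 0 :=
    fun w hw => by
      by_contra hne
      have := hP.dotProduct_mulVec_pos hne
      simp only [star_trivial] at this
      exact this.ne' hw
  have hnn : ∀ w : Fin n → ℝ, 0 ≤ w ⬝ᵥ (gram g p (extChartAt (𝓡 n) p p))⁻¹.mulVec w := fun w => by
    simpa using hP.posSemidef.dotProduct_mulVec_nonneg w
  simp only [traceForm, traceIn, smul_eq_mul] at h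
  rw [sum_metricL_eq] at h
  have h1 := Finset.sum_nonneg fun a (_ : a ∈ Finset.univ) =>
    hnn (fun i => (pd i (localRep p f) (extChartAt (𝓡 n) p p)).1 a)
  have h2 := mul_nonneg (inv_pos.2 hc).le
    (hnn (fun i => (pd i (localRep p f) (extChartAt (𝓡 n) p p)).2))
  have h3 := (add_eq_zero_iff_of_nonneg h1 h2).1 h
  have h4 := (Finset.sum_eq_zero_iff_of_nonneg fun a _ => hnn _).1 h3.1
  have h5 := (mul_eq_zero.1 h3.2).resolve_left (inv_pos.2 hc).ne'
  refine Prod.ext ?_ (congrFun (hzero _ h5) i)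
  ext a
  exact congrFun (hzero _ (h4 a (Finset.mem_univ a))) i

/-- The hypothesis concerns each point in its own chart; the transition formula carries it to a
whole chart, where `f` is then locally constant. -/
theorem eq_of_pd_eq_zero [PreconnectedSpace M] {f : M → W}
    (hf : ContMDiff (𝓡 n) 𝓘(ℝ, W) ∞ f)
    (h : ∀ p i, pd i (localRep p f) (extChartAt (𝓡 n) p p) = 0) (p p' : M) : f p = f p' := by
  refine IsLocallyConstant.apply_eq_of_preconnectedSpace ?_ p p'
  refine (IsLocallyConstant.iff_eventually_eq f).2 fun q => ?_
  have hu := mem_extChartAt_target (I := 𝓡 n) q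
  obtain ⟨r, hr, hsub⟩ := Metric.nhds_basis_ball.mem_iff.1 (target_mem_nhds hu)
  have hfd : ∀ v ∈ (extChartAt (𝓡 n) q).target, fderiv ℝ (localRep q f) v = 0 := fun v hv => by
    ext w
    rw [fderiv_apply_eq_sum_pd]
    simp only [_root_.zero_apply]
    refine Finset.sum_eq_zero fun i _ => ?_
    rw [pd_localRep_transition (q' := (extChartAt (𝓡 n) q).symm v) hf hv
      (mem_extChartAt_source _)]
    simp only [h, smul_zero, Finset.sum_const_zero]
  have hconst : ∀ v ∈ Metric.ball (extChartAt (𝓡 n) q q) r, localRep q f v = f q := fun v hv => by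
    rw [← localRep_self (n := n) f q]
    exact Metric.isOpen_ball.is_const_of_fderiv_eq_zero (𝕜 := ℝ)
      (convex_ball _ _).isPreconnected
      (fun w hw => (differentiableAt_localRep hf (hsub hw)).differentiableWithinAt)
      (fun w hw => hfd w (hsub hw)) hv (Metric.mem_ball_self hr)
  filter_upwards [(continuousAt_extChartAt (I := 𝓡 n) q).preimage_mem_nhds
    (Metric.ball_mem_nhds _ hr), extChartAt_source_mem_nhds (I := 𝓡 n) q] with y hy hy'
  have := hconst _ hy
  rwa [localRep, (extChartAt (𝓡 n) q).left_inv hy'] at this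

/-- The Laplacian of `quad(x₀, x) = 0` gives `H quad(x₀, N) = 0`. Were the second factor zero, `x₀`
would be orthogonal to `x`, `N` and all `∂ₖx`, hence zero. -/
theorem meanCurv_eq_zero_of_equatorial (hn : 1 ≤ n) (hc : 0 < c)
    (hx : IsIsometricImmersion c g x) (hN : IsUnitNormal c x N) {x₀ : Amb n}
    (hx₀ : x₀ ∈ spaceForm n c) {p : M} (h : ∀ᶠ p' in nhds p, quadL n c x₀ (x p') = 0) :
    meanCurv c g x N p = 0 := by
  have hn' : (n : ℝ) ≠ 0 := by positivity
  have h0 := h.self_of_nhds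
  have hl : quadL n c x₀ (lap g x p) = 0 := by
    rw [← lap_clm _ hx.smooth, lap_congr (h := fun _ => 0) h, lap_const]
  rw [lap_immersion hn hx hN] at hl
  simp only [map_sub, map_smul, smul_eq_mul, h0, mul_zero, sub_zero, mul_eq_zero, hn',
    false_or] at hl
  refine hl.resolve_right fun hN0 => ?_
  have hdec := eq_normal_combination hc hx hN (p := p) (v := x₀) fun k => by
    refine pd_localRep_clm_eq_zero hx.smooth _ ?_ k
    have he : (localRep p fun p => quadL n c x₀ (x p)) =ᶠ[nhds (extChartAt (𝓡 n) p p)]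
        fun _ => 0 := (continuousAt_localRep_point p).eventually h
    rw [he.fderiv_eq, fderiv_const_apply]
  rw [quadL_eq_mul_metricL hc.ne', mul_eq_zero, or_iff_right hc.ne'] at hN0
  rw [quadL_comm, h0, hN0, zero_smul, zero_smul, add_zero] at hdec
  have := quadL_self hx₀
  rw [hdec] at this
  simp at this

variable [T2Space M] [CompactSpace M] [MeasurableSpace M] [BorelSpace M]

theorem exists_pole_of_meanCurv_sq_eq [ConnectedSpace M] (hn : 1 ≤ n) (hc : 0 < c)
    (hx : IsIsometricImmersion c g x) (hN : IsUnitNormal c x N) (hbi : IsBiharmonic c g x)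
    (hH : ∀ p, meanCurv c g x N p ^ 2 = c) :
    ∃ q ∈ spaceForm n c, ∀ p, quadL n c q (x p) = (√2)⁻¹ := by
  have hn' : (n : ℝ) ≠ 0 := by positivity
  obtain ⟨p₀⟩ : Nonempty M := inferInstance
  set H₀ := meanCurv c g x N p₀ with hH₀
  have hH₀0 : H₀ ≠ 0 := fun h => hc.ne' (by rw [← hH p₀, ← hH₀, h]; simp)
  -- A continuous function with constant nonzero square on a connected space cannot change sign.
  have hHc : ∀ p, meanCurv c g x N p = H₀ := fun p =>
    isPreconnected_univ.eq_of_sq_eq (f := meanCurv c g x N) (g := fun _ => H₀)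
      (continuous_meanCurv hx hN).continuousOn continuousOn_const
      (fun p _ => by simp only [Pi.pow_apply, hH p, hH₀, hH p₀]) (fun _ => hH₀0)
      (mem_univ p₀) rfl (mem_univ p)
  have hHx : ContMDiff (𝓡 n) 𝓘(ℝ, Amb n) ∞ (fun p => H₀ • x p) :=
    (contMDiff_const (I' := 𝓘(ℝ, ℝ)) (c := H₀)).smul hx.smooth
  have hB : ContMDiff (𝓡 n) 𝓘(ℝ, Amb n) ∞ (fun p => N p + H₀ • x p) := hN.smooth.add hHx
  have htr : ∀ p, traceForm g (metricL n c) N x p = -(n * H₀) := fun p => by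
    rw [← hHc p, meanCurv_eq hx hN]; field_simp
  have htr' : ∀ p, traceForm g (metricL n c) x N p = -(n * H₀) := fun p => by
    have hflip : (metricL n c).flip = metricL n c := by
      ext v w
      all_goals simp [metricL_comm]
    rw [← htr p, ← traceForm_flip, hflip]
  -- `|d(N + H₀x)|² = |dN|² - 2nH₀² + nH₀²`, and `H₀² = c`. This is the squared norm of the
  -- trace-free part of the Weingarten operator.
  have hBB : ∀ p, traceForm g (metricL n c) (fun p => N p + H₀ • x p) (fun p => N p + H₀ • x p) p
      = traceForm g (metricL n c) N N p - n * c := fun p => by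
    rw [traceForm_add_left _ _ hN.smooth hHx, traceForm_smul_left _ _ _ hx.smooth]
    simp only [traceForm_add_right _ _ hN.smooth hHx, traceForm_smul_right _ _ _ hx.smooth,
      htr, htr', traceForm_self hx, smul_eq_mul]
    linear_combination (-n : ℝ) * hH p₀
  have hlapN : ∀ p, metricL n c (N p) (lap g N p) = -traceForm g (metricL n c) N N p := fun p => by
    have h1 : (fun p => metricL n c (N p) (N p)) = fun _ => 1 :=
      funext fun p => metricL_normal_self hN p
    have h2 := lap_bilin (g := g) (p := p) (metricL n c) hN.smooth hN.smooth
    rw [h1, lap_const, metricL_comm c (lap g N p)] at h2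
    simp only [smul_eq_mul] at h2
    linarith
  have hfv := first_variation hn hx hN hbi hN.smooth fun h => absurd h hc.ne'
  have hint : ∀ p, -(quadL n c (x p) (N p) * (n * meanCurv c g x N p) ^ 2)
      + n * meanCurv c g x N p * (metricL n c (N p) (lap g N p)
        + n * c * metricL n c (N p) (N p))
      = -(n * H₀) * traceForm g (metricL n c) (fun p => N p + H₀ • x p)
        (fun p => N p + H₀ • x p) p := fun p => by
    rw [hBB, hlapN, hHc, quadL_normal hN, metricL_normal_self hN]
    ring
  simp only [hint] at hfv
  rw [integral_const_mul] at hfv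
  have hfv' := (mul_eq_zero.1 hfv).resolve_left (neg_ne_zero.2 (mul_ne_zero hn' hH₀0))
  have hzero := eq_zero_of_integral_eq_zero hx (contMDiff_traceForm hx _ hB hB).continuous
    (traceForm_metricL_self_nonneg hc g _) hfv'
  have hconst := eq_of_pd_eq_zero hB fun p i =>
    pd_eq_zero_of_traceForm_metricL_self hc (hzero p) i
  have hs2 : √2 * √2 = (2 : ℝ) := Real.mul_self_sqrt (by norm_num)
  have hs20 : √2 ≠ (0 : ℝ) := by positivity
  -- `N + H₀x` has `quad`-square `c + H₀² = 2H₀²` and product `H₀` with `x`. Dividing by `√2 H₀`,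
  -- sign included, gives a point of the sphere whose product with `x` is `1/√2`.
  refine ⟨(√2 * H₀)⁻¹ • (N p₀ + H₀ • x p₀), ?_, fun p => ?_⟩
  · rw [mem_spaceForm_iff hc]
    have hNN : quadL n c (N p₀) (N p₀) = c := by
      rw [quadL_eq_mul_metricL hc.ne', metricL_normal_self hN, mul_one]
    simp only [map_add, map_smul, _root_.add_apply, _root_.smul_apply, smul_eq_mul, hNN,
      quadL_self (hx.mem p₀), quadL_normal hN, quadL_comm c (N p₀) (x p₀)]
    have := hH p₀
    rw [← hH₀] at this
    field_simp
    rw [pow_two √2, hs2]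
    linarith
  · have h1 : N p₀ + H₀ • x p₀ = N p + H₀ • x p := hconst p₀ p
    rw [h1]
    simp only [map_add, map_smul, _root_.add_apply, _root_.smul_apply, smul_eq_mul,
      quadL_self (hx.mem p), quadL_normal hN, quadL_comm c (N p) (x p)]
    field_simp
    ring

theorem hemisphere_rigidity [ConnectedSpace M] (hn : 1 ≤ n) (hc : 0 < c)
    (hx : IsIsometricImmersion c g x) (hN : IsUnitNormal c x N) (hbi : IsBiharmonic c g x)
    {x₀ : Amb n} (hx₀ : x₀ ∈ spaceForm n c) (hpos : ∀ p, 0 ≤ quadL n c x₀ (x p))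
    (hsign : (∀ p, meanCurv c g x N p ^ 2 ≤ c) ∨ (∀ p, c ≤ meanCurv c g x N p ^ 2)) :
    (∀ p, quadL n c x₀ (x p) = 0) ∨ ∀ p, meanCurv c g x N p ^ 2 = c := by
  have hint := integral_quadL_mul hn hx hN hbi x₀
  have hcont := continuous_quadL_mul hx hN x₀
  have hzero : ∀ p, quadL n c x₀ (x p) * (meanCurv c g x N p ^ 2 - c) = 0 := by
    rcases hsign with h | h
    · intro p
      have hneg : Continuous fun p => -(quadL n c x₀ (x p) * (meanCurv c g x N p ^ 2 - c)) :=
        hcont.neg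
      have := eq_zero_of_integral_eq_zero hx hneg
        (fun p => by
          have := mul_nonneg (hpos p) (sub_nonneg.2 (h p))
          linarith) (by rw [integral_neg, hint, neg_zero]) p
      linarith
    · exact eq_zero_of_integral_eq_zero hx hcont
        (fun p => mul_nonneg (hpos p) (sub_nonneg.2 (h p))) hint
  have hcH := (continuous_meanCurv hx hN).pow 2
  -- Either `p` is a limit of points with `quad(x₀, x) ≠ 0`, where `H² = c`, or `quad(x₀, x)`
  -- vanishes near `p`. Since `c ≠ 0`, the two values of `H²` split `M` into clopen sets.
  have hdich : ∀ p, meanCurv c g x N p ^ 2 = c ∨ meanCurv c g x N p ^ 2 = 0 := fun p => by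
    by_cases hp : p ∈ closure {p | quadL n c x₀ (x p) ≠ 0}
    · left
      have hcl : IsClosed {p | meanCurv c g x N p ^ 2 = c} := isClosed_eq hcH continuous_const
      refine (closure_minimal (fun p' hp' => ?_) hcl) hp
      have := (mul_eq_zero.1 (hzero p')).resolve_left hp'
      exact sub_eq_zero.1 this
    · right
      have h : ∀ᶠ p' in nhds p, quadL n c x₀ (x p') = 0 := by
        filter_upwards [isClosed_closure.isOpen_compl.mem_nhds hp] with p' hp'
        by_contra hne
        exact hp' (subset_closure hne)
      rw [meanCurv_eq_zero_of_equatorial hn hc hx hN hx₀ h]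
      simp
  have hclopen : IsClopen {p | meanCurv c g x N p ^ 2 = c} := by
    refine ⟨isClosed_eq hcH continuous_const, ?_⟩
    have : {p | meanCurv c g x N p ^ 2 = c} = {p | meanCurv c g x N p ^ 2 = 0}ᶜ := by
      ext p
      constructor
      · intro h h'
        exact hc.ne' (Eq.trans (Eq.symm h) h')
      · intro h
        exact (hdich p).resolve_right h
    rw [this]
    exact (isClosed_eq hcH continuous_const).isOpen_compl
  rcases isClopen_iff.1 hclopen with h | h
  · left
    intro p
    refine (mul_eq_zero.1 (hzero p)).resolve_right fun h' => ?_
    have : p ∈ {p | meanCurv c g x N p ^ 2 = c} := sub_eq_zero.1 h'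
    rw [h] at this
    exact this
  · right
    intro p
    have : p ∈ {p | meanCurv c g x N p ^ 2 = c} := by rw [h]; trivial
    exact this

end Rigidity

end BiharmonicHypersurface

end

/-! ### The main theorem -/

theorem theorem2 (n : ℕ) (hn : 1 ≤ n) (c : ℝ)
    {M : Type*} [TopologicalSpace M] [ChartedSpace (EuclideanSpace ℝ (Fin n)) M]
    [IsManifold (𝓡 n) ∞ M] [T2Space M] [CompactSpace M] [ConnectedSpace M]
    [MeasurableSpace M] [BorelSpace M]
    (g : RMetric n M) (x N : M → Amb n)
    (hx : IsIsometricImmersion c g x) (hN : IsUnitNormal c x N)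
    (hbi : IsBiharmonic c g x) :
    -- the integral formula
    (∀ x₀ ∈ spaceForm n c, x₀ ∉ Set.range x →
      Integrable (fun p => theta c (sfDist c x₀ (x p)) * (meanCurv c g x N p ^ 2 - c))
          (riemVol g) ∧
        ∫ p, theta c (sfDist c x₀ (x p)) * (meanCurv c g x N p ^ 2 - c) ∂(riemVol g) = 0) ∧
    -- closed biharmonic hypersurfaces do not exist for `c ≤ 0`
    ¬ c ≤ 0 ∧
    -- rigidity in a closed hemisphere, with pole `x₀`, for `c > 0`
    (0 < c → ∀ x₀ ∈ spaceForm n c,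
      (∀ p, sfDist c x₀ (x p) ≤ Real.pi / (2 * √c)) →
      ((∀ p, meanCurv c g x N p ^ 2 ≤ c) ∨ (∀ p, c ≤ meanCurv c g x N p ^ 2)) →
      Set.range x = {y ∈ spaceForm n c | sfDist c x₀ y = Real.pi / (2 * √c)} ∨
        ∃ q ∈ spaceForm n c,
          Set.range x = {y ∈ spaceForm n c | sfDist c q y = Real.pi / (4 * √c)}) := by
  -- Nonexistence comes first: the distance formula is then needed only for `c > 0`.
  have hcpos := curvature_pos hn hx hN hbi
  have hc : 0 < c := not_le.1 hcpos
  have hsc : 0 < √c := Real.sqrt_pos.2 hc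
  refine ⟨fun x₀ hx₀ _ => ?_, hcpos, fun _ x₀ hx₀ hhemi hsign => ?_⟩
  · simp only [fun p => theta_sfDist hn hc hx₀ (hx.mem p)]
    exact ⟨integrable_of_continuous hx (continuous_quadL_mul hx hN x₀),
      integral_quadL_mul hn hx hN hbi x₀⟩
  · have hpos : ∀ p, 0 ≤ quadL n c x₀ (x p) := fun p => by
      have h := hhemi p
      rw [sfDist_eq hn hc hx₀ (hx.mem p), ← div_div, div_le_div_iff_of_pos_right hsc] at h
      exact Real.arccos_le_pi_div_two.1 h
    rcases hemisphere_rigidity hn hc hx hN hbi hx₀ hpos hsign with h | h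
    · left
      -- The equator is the sphere with `κ = 0` about `x₀`.
      rw [range_eq_sphere hn hc hx hN hx₀ (by norm_num) h]
      ext y
      refine and_congr_right fun hy => ?_
      rw [sfDist_eq hn hc hx₀ hy, ← div_div, div_left_inj' hsc.ne', Real.arccos_eq_pi_div_two]
    · right
      obtain ⟨q, hq, hqx⟩ := exists_pole_of_meanCurv_sq_eq hn hc hx hN hbi h
      refine ⟨q, hq, ?_⟩
      have hs2 : √2 * √2 = (2 : ℝ) := Real.mul_self_sqrt (by norm_num)
      rw [range_eq_sphere hn hc hx hN hq (by rw [inv_pow, pow_two, hs2]; norm_num) hqx]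
      ext y
      refine and_congr_right fun hy => ?_
      -- The value `κ = 1/√2` is the cosine of the angle `π/4`, which corresponds to the distance `π
      -- / (4√c)`.
      have h4 : Real.cos (Real.pi / 4) = (√2)⁻¹ := by
        rw [Real.cos_pi_div_four]; field_simp; linarith
      rw [sfDist_eq hn hc hq hy, ← div_div, div_left_inj' hsc.ne', ← h4]
      constructor
      · intro h5
        rw [h5, Real.arccos_cos (by positivity) (by linarith [Real.pi_pos])]
      · intro h5
        rw [← h5, Real.cos_arccos (neg_one_le_quadL hc hq hy) (quadL_le_one hc hq hy)]
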